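/- **Setting.** Consider the Euclidean scalar theory in four dimensions with propagator $\Delta_\Lambda(q)=K(q^2/\Lambda^2)/(q^2+B)$, where $K$ is smooth, $K=1$ on $[0,1]$ and $K=0$ on $[4,\infty)$, and scales $0<\Lambda_R\le\Lambda_0$; let $A,B$ be real constants with $|A|\le\Lambda_R^3$, $|B|\le\Lambda_R^2$. For $n\ge 1$ and orders $(r_1,r_2)$ in the renormalized cubic and quartic couplings $\rho_4^R,\rho_5^R$ let $L_n^{(r_1,r_2)}(k_1,\dots,k_n,\Lambda)$, $\sum_i k_i=0$, $\Lambda_R\le\Lambda\le\Lambda_0$, be real vertex functions which are smooth in the momenta, symmetric, invariant under the orthogonal group, vanish for $(r_1,r_2)=(0,0)$ and for $n>2(r_1+r_2)+2$, and satisfy for all momentum derivatives $\partial^p$ of any order $p$ (products of $p$ operators $\partial_{i,j}^{\mu}=\partial/\partial k_i^\mu-\partial/\partial k_j^\mu$) Polchinski's flow equation $$\begin{aligned}\frac{d}{d\Lambda}\partial^pL_n^{(r_1,r_2)}=&-\frac12\,\partial^p\!\!\sum_{I\subseteq\{1,\dots,n\}}\ \sum_{s_1\le r_1,\,s_2\le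 r_2}\dot\Delta_\Lambda(K_I)\, L^{(s_1,s_2)}_{|I|+1}(k_I,-K_I)\,L^{(r_1-s_1,r_2-s_2)}_{n-|I|+1}(k_{I^c},K_I)\\ &-\frac12\int\frac{d^4q}{(2\pi)^4}\,\dot\Delta_\Lambda(q)\,\partial^pL^{(r_1,r_2)}_{n+2}(k_1,\dots,k_n,q,-q) -\frac12A\,\dot\Delta_\Lambda(0)\,\partial^pL^{(r_1,r_2)}_{n+1}(k_1,\dots,k_n,0),\end{aligned}$$ where $\dot\Delta_\Lambda=\frac{d}{d\Lambda}\Delta_\Lambda$ and $K_I=\sum_{i\in I}k_i$. The renormalization conditions at $\Lambda_R$ are, order by order, $L_1(0)=L_2(0,0)=\partial^\mu_{1,2}\partial^\nu_{1,2}L_2(0,0)=0$, $L_3(0,0,0)=\rho_4^R$, $L_4(0,0,0,0)=\rho_5^R$ (that is, $L_3^{(r_1,r_2)}(0)=\delta_{r_1,1}\delta_{r_2,0}$ and $L_4^{(r_1,r_2)}(0)=\delta_{r_1,0}\delta_{r_2,1}$). Put $A_n^{(r_1,r_2)}=\Lambda^{n+r_1-4}L_n^{(r_1,r_2)}$ and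 let $\|f\|$, for a function $f$ at scale $\Lambda$, be the maximum of $|f|$ over $k_i^2\le4\Lambda^2$, $i=1,\dots,n$. $\mathrm{Pln}(z)$ denotes a polynomial in $\ln z$ with nonnegative coefficients; it depends only on $n,p,r_1,r_2$, and, in a conclusion, on $K$ and on the polynomials of the hypotheses, but not on $\Lambda,\Lambda_0,\Lambda_R,A,B$, the momenta, the parameter $t$ or the vertex functions. **Theorem (Uniqueness of the no-cutoff limit).** 1. For every $t\in[0,1]$ let $A_n^{(r_1,r_2)}(\cdot,\Lambda,t)$ come from such a system satisfying the renormalization conditions, where the bare data with $n+p\ge5$ are scaled by $t$: $\partial^pA_n^{(r_1,r_2)}(\Lambda_0,t)=t\,\partial^pA_n^{(r_1,r_2)}(\Lambda_0,1)$ for $n+p\ge 5$. Assume that for $n+p\ge5$, all $(r_1,r_2)$ and $t\in[0,1]$ $$\Big\|\frac{d}{dt}\partial^pA_n^{(r_1,r_2)}(\Lambda_0,t)\Big\|\le\Lambda_0^{-p}\Big(\frac{\Lambda_0}{\Lambda_R}\Big)^{r_1}\mathrm{Pln}\Big(\frac{\Lambda_0}{\Lambda_R}\Big).$$ Then for all $n\ge1$,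 $p\ge0$, $(r_1,r_2)$, $t\in[0,1]$ and $\Lambda_R\le\Lambda\le\Lambda_0$ the function $\partial^pA_n^{(r_1,r_2)}(k,\Lambda,t)$ is differentiable in $t$ and $$\Big\|\frac{d}{dt}\partial^pA_n^{(r_1,r_2)}(\Lambda,t)\Big\|\le\Lambda^{-p}\Big(\frac{\Lambda}{\Lambda_R}\Big)^{r_1}\frac{\Lambda}{\Lambda_0}\,\mathrm{Pln}\Big(\frac{\Lambda_0}{\Lambda_R}\Big).$$ 2. Consequently the no-cutoff limit does not depend on the small bare irrelevant data: fix $\Lambda_R$, and for every $\Lambda_0\ge\Lambda_R$ let two such systems be given (with the same constants $A$, $B$, which may depend on $\Lambda_0$), both satisfying the renormalization conditions and, with polynomials $\mathrm{Pln}$ independent of $\Lambda_0$, the bounds $\|\partial^pA_n^{(r_1,r_2)}(\Lambda_0)\|\le\Lambda_0^{-p}(\Lambda_0/\Lambda_R)^{r_1}\mathrm{Pln}(\Lambda_0/\Lambda_R)$ for $n+p\ge5$. Then, for every $\Lambda\ge\Lambda_R$, $n\ge 1$, $(r_1,r_2)$ and $\partial^p$, the functions $\partial^pA_n^{(r_1,r_2)}(\Lambda)$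 of the first system converge in the norm $\|\cdot\|$ as $\Lambda_0\to\infty$ if and only if those of the second do, and then the limits agree. -/

import Mathlib

open scoped ContDiff

namespace PolchinskiFlow

/-- Euclidean momenta in four dimensions. -/
abbrev Momentum : Type := EuclideanSpace ℝ (Fin 4)

/-- The space of `n`-tuples of momenta with zero total momentum, the domain of an `n`-point
vertex function. -/
def Momenta (n : ℕ) : Submodule ℝ (Fin n → Momentum) where
  carrier := {k | ∑ i, k i = 0}
  add_mem' := by
    intro a b ha hb
    simp only [Set.mem_ofPred_eq, Pi.add_apply, Finset.sum_add_distrib] at *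
    rw [ha, hb, add_zero]
  zero_mem' := by simp
  smul_mem' := by
    intro c a ha
    simp only [Set.mem_ofPred_eq, Pi.smul_apply, ← Finset.smul_sum] at *
    rw [ha, smul_zero]

/-- The tuple whose `i`-th momentum is the `μ`-th unit vector, whose `j`-th momentum is minus that
vector, and whose other momenta vanish (it is zero if `i = j`). The derivative in this direction is
`∂/∂k_i^μ - ∂/∂k_j^μ`. -/
noncomputable def direction {n : ℕ} (i j : Fin n) (μ : Fin 4) : Momenta n :=
  ⟨Pi.single i (EuclideanSpace.single μ (1 : ℝ)) - Pi.single j (EuclideanSpace.single μ (1 : ℝ)), by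
    change ∑ l, (Pi.single i (EuclideanSpace.single μ (1 : ℝ))
      - Pi.single j (EuclideanSpace.single μ (1 : ℝ)) : Fin n → Momentum) l = 0
    simp only [Pi.sub_apply, Finset.sum_sub_distrib]
    rw [Finset.sum_pi_single', Finset.sum_pi_single']
    simp⟩

/-- The momentum derivative `∂^p = ∂_{i₁,j₁}^{μ₁} ⋯ ∂_{i_p,j_p}^{μ_p}` of order `p`, with
`∂_{i,j}^μ = ∂/∂k_i^μ - ∂/∂k_j^μ`, where `a q = (i_q, j_q, μ_q)`. -/
noncomputable def momDeriv {n p : ℕ} (a : Fin p → Fin n × Fin n × Fin 4)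
    (f : Momenta n → ℝ) (k : Momenta n) : ℝ :=
  iteratedFDeriv ℝ p f k (fun q => direction (a q).1 (a q).2.1 (a q).2.2)

/-- The region `k_i² ≤ 4 Λ²`, `i = 1, …, n`, over which the norm at scale `Λ` is taken. -/
def momentumRegion (n : ℕ) (Λ : ℝ) : Set (Momenta n) :=
  {k | ∀ i, ‖k.1 i‖ ≤ 2 * Λ}

/-- `‖f‖ ≤ C` for the norm at scale `Λ`, i.e. for the maximum of `|f|` over the region
`k_i² ≤ 4 Λ²`. -/
def NormLE {n : ℕ} (Λ : ℝ) (f : Momenta n → ℝ) (C : ℝ) : Prop :=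
  ∀ k ∈ momentumRegion n Λ, |f k| ≤ C

/-- The momenta `k_i`, `i ∈ I`, followed by minus their sum. -/
def legs {n : ℕ} (I : Finset (Fin n)) (k : Momenta n) : Momenta (I.card + 1) :=
  ⟨Fin.snoc (α := fun _ => Momentum) (fun i => k.1 (I.orderEmbOfFin rfl i)) (-∑ i ∈ I, k.1 i), by
    change ∑ l, Fin.snoc (α := fun _ => Momentum) (fun i => k.1 (I.orderEmbOfFin rfl i))
      (-∑ i ∈ I, k.1 i) l = 0
    rw [Fin.sum_univ_castSucc]
    simp only [Fin.snoc_castSucc, Fin.snoc_last]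
    have h : ∑ i, k.1 (I.orderEmbOfFin rfl i) = ∑ i ∈ I, k.1 i := by
      rw [← Finset.sum_coe_sort I]
      exact Fintype.sum_equiv (I.orderIsoOfFin rfl).toEquiv _ _ (fun i => rfl)
    rw [h, add_neg_cancel]⟩

/-- `(k_1, …, k_n, q, -q)`. -/
def addPair {n : ℕ} (k : Momenta n) (q : Momentum) : Momenta (n + 2) :=
  ⟨Fin.snoc (α := fun _ => Momentum) (Fin.snoc (α := fun _ => Momentum) k.1 q) (-q), by
    change ∑ l, Fin.snoc (α := fun _ => Momentum) (Fin.snoc (α := fun _ => Momentum) k.1 q) (-q) l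
      = 0
    have h : ∑ i, k.1 i = 0 := k.2
    rw [Fin.sum_univ_castSucc, Fin.snoc_last]
    simp only [Fin.snoc_castSucc]
    rw [Fin.sum_univ_castSucc, Fin.snoc_last]
    simp only [Fin.snoc_castSucc]
    rw [h, zero_add, add_neg_cancel]⟩

/-- `(k_1, …, k_n, 0)`. -/
def addZero {n : ℕ} (k : Momenta n) : Momenta (n + 1) :=
  ⟨Fin.snoc (α := fun _ => Momentum) k.1 0, by
    change ∑ l, Fin.snoc (α := fun _ => Momentum) k.1 0 l = 0
    have h : ∑ i, k.1 i = 0 := k.2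
    rw [Fin.sum_univ_castSucc, Fin.snoc_last]
    simp only [Fin.snoc_castSucc]
    rw [h, zero_add]⟩

/-- A momentum cutoff function: smooth, `1` on `[0, 1]` and `0` on `[4, ∞)`. -/
structure IsCutoff (K : ℝ → ℝ) : Prop where
  smooth : ContDiff ℝ ∞ K
  eq_one : ∀ z, 0 ≤ z → z ≤ 1 → K z = 1
  eq_zero : ∀ z, 4 ≤ z → K z = 0

/-- The regularized propagator `Δ_Λ(q) = K(q²/Λ²) / (q² + B)`. -/
noncomputable def propagator (K : ℝ → ℝ) (B Λ : ℝ) (q : Momentum) : ℝ :=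
  K (‖q‖ ^ 2 / Λ ^ 2) / (‖q‖ ^ 2 + B)

/-- `(d/dΛ) Δ_Λ(q)`. -/
noncomputable def propagatorDot (K : ℝ → ℝ) (B Λ : ℝ) (q : Momentum) : ℝ :=
  deriv (fun s => propagator K B s q) Λ

/-- The coefficients `L_n^{(r₁,r₂)}(k_1, …, k_n, Λ)` of the vertex functions in the expansion in
powers of the renormalized cubic and quartic couplings; the arguments are `r₁ r₂ n Λ k`. Only
`n ≥ 1` is used. -/
abbrev VertexSystem : Type := ℕ → ℕ → (n : ℕ) → ℝ → Momenta n → ℝ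

/-- The tree term of the flow equation at order `(r₁, r₂)`,
`∑_I Δ̇_Λ(K_I) L_{|I|+1}(k_I, -K_I) L_{n-|I|+1}(k_{Iᶜ}, K_I)`, where `I` runs over the sets of external
legs and `K_I = ∑_{i ∈ I} k_i` (so that `-K_{Iᶜ} = K_I`). -/
noncomputable def treeTerm (K : ℝ → ℝ) (B : ℝ) (L : VertexSystem) (r₁ r₂ n : ℕ) (Λ : ℝ)
    (k : Momenta n) : ℝ :=
  ∑ I : Finset (Fin n), ∑ s ∈ Finset.HasAntidiagonal.antidiagonal r₁, ∑ u ∈ Finset.HasAntidiagonal.antidiagonal r₂,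
    propagatorDot K B Λ (∑ i ∈ I, k.1 i) *
      (L s.1 u.1 (I.card + 1) Λ (legs I k) * L s.2 u.2 (Iᶜ.card + 1) Λ (legs Iᶜ k))

/-- The right-hand side of the flow equation for `∂^p L_n^{(r₁,r₂)}`. -/
noncomputable def flowRHS (K : ℝ → ℝ) (A B : ℝ) (L : VertexSystem) (r₁ r₂ n : ℕ) {p : ℕ}
    (a : Fin p → Fin n × Fin n × Fin 4) (Λ : ℝ) (k : Momenta n) : ℝ :=
  -(1 / 2) * momDeriv a (treeTerm K B L r₁ r₂ n Λ) k
  - (1 / 2) * ∫ q : Momentum, (1 / (2 * Real.pi) ^ 4) *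
      (momDeriv a (fun k' => L r₁ r₂ (n + 2) Λ (addPair k' q)) k * propagatorDot K B Λ q)
  - (1 / 2) * A * momDeriv a (fun k' => L r₁ r₂ (n + 1) Λ (addZero k')) k * propagatorDot K B Λ 0

/-- `L` is a perturbative solution of Polchinski's flow equation on `[Λ_R, Λ₀]`: smooth in the
momenta, Bose symmetric, invariant under the orthogonal group, vanishing at zeroth order and, at order
`(r₁, r₂)`, for more than `2 (r₁ + r₂) + 2` legs, and satisfying the flow equation for all momentum
derivatives. -/
structure IsPerturbativeSolution (K : ℝ → ℝ) (A B Λ_R Λ₀ : ℝ) (L : VertexSystem) : Prop where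
  smooth : ∀ r₁ r₂ n, 1 ≤ n → ∀ Λ ∈ Set.Icc Λ_R Λ₀, ContDiff ℝ ∞ (L r₁ r₂ n Λ)
  symmetric : ∀ r₁ r₂ n, 1 ≤ n → ∀ Λ ∈ Set.Icc Λ_R Λ₀, ∀ (σ : Equiv.Perm (Fin n))
    (k k' : Momenta n), (∀ i, k'.1 i = k.1 (σ i)) → L r₁ r₂ n Λ k' = L r₁ r₂ n Λ k
  invariant : ∀ r₁ r₂ n, 1 ≤ n → ∀ Λ ∈ Set.Icc Λ_R Λ₀, ∀ (R : Momentum ≃ₗᵢ[ℝ] Momentum)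
    (k k' : Momenta n), (∀ i, k'.1 i = R (k.1 i)) → L r₁ r₂ n Λ k' = L r₁ r₂ n Λ k
  zeroth_order : ∀ n, 1 ≤ n → ∀ Λ ∈ Set.Icc Λ_R Λ₀, ∀ k, L 0 0 n Λ k = 0
  many_legs : ∀ r₁ r₂ n, 2 * (r₁ + r₂) + 2 < n → ∀ Λ ∈ Set.Icc Λ_R Λ₀, ∀ k, L r₁ r₂ n Λ k = 0
  flow : ∀ r₁ r₂ n p, 1 ≤ n → ∀ (a : Fin p → Fin n × Fin n × Fin 4) (k : Momenta n),
    ∀ Λ ∈ Set.Icc Λ_R Λ₀,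
      HasDerivWithinAt (fun s => momDeriv a (L r₁ r₂ n s) k) (flowRHS K A B L r₁ r₂ n a Λ k)
        (Set.Icc Λ_R Λ₀) Λ

/-- The renormalization conditions at `Λ_R`, order by order: `ρ₁ = L_1(0)`, `ρ₂ = L_2(0,0)` and
`ρ₃ δ^{μν} = ∂_{1,2}^μ ∂_{1,2}^ν L_2(0,0)` vanish, `ρ₄ = L_3(0,0,0)` equals the first and
`ρ₅ = L_4(0,0,0,0)` the second expansion parameter. -/
structure RenormalizationConditions (Λ_R : ℝ) (L : VertexSystem) : Prop where
  rho_one : ∀ r₁ r₂, L r₁ r₂ 1 Λ_R 0 = 0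
  rho_two : ∀ r₁ r₂, L r₁ r₂ 2 Λ_R 0 = 0
  rho_three : ∀ r₁ r₂ (μ ν : Fin 4), momDeriv ![(0, 1, μ), (0, 1, ν)] (L r₁ r₂ 2 Λ_R) 0 = 0
  rho_four : ∀ r₁ r₂, L r₁ r₂ 3 Λ_R 0 = if r₁ = 1 ∧ r₂ = 0 then 1 else 0
  rho_five : ∀ r₁ r₂, L r₁ r₂ 4 Λ_R 0 = if r₁ = 0 ∧ r₂ = 1 then 1 else 0

/-- The dimensionless vertex functions
`A_n^{(r₁,r₂)}(k, Λ) = Λ^(n + r₁ - 4) L_n^{(r₁,r₂)}(k, Λ)`. -/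
noncomputable def dimensionless (L : VertexSystem) (r₁ r₂ n : ℕ) (Λ : ℝ) (k : Momenta n) : ℝ :=
  Λ ^ ((n : ℤ) + (r₁ : ℤ) - 4) * L r₁ r₂ n Λ k

/-- `Pln(z)`: a polynomial, evaluated at `ln z`. -/
noncomputable def Pln (P : Polynomial ℝ) (z : ℝ) : ℝ := P.eval (Real.log z)

/-- A choice of polynomials `Pln` with nonnegative coefficients, one for every number `n` of legs,
number `p` of momentum derivatives and order `(r₁, r₂)`. -/
structure PlnFamily where
  poly : ℕ → ℕ → ℕ → ℕ → Polynomial ℝ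
  nonneg : ∀ n p r₁ r₂ i, 0 ≤ (poly n p r₁ r₂).coeff i

/-- The bare data with `n + p ≥ 5` at the cutoff `Λ₀` are small:
`‖∂^p A_n^{(r₁,r₂)}(Λ₀)‖ ≤ Λ₀^(-p) (Λ₀/Λ_R)^r₁ Pln(Λ₀/Λ_R)`. -/
def SmallBareData (P : PlnFamily) (Λ_R Λ₀ : ℝ) (L : VertexSystem) : Prop :=
  ∀ r₁ r₂ n p, 1 ≤ n → 5 ≤ n + p → ∀ a : Fin p → Fin n × Fin n × Fin 4,
    NormLE Λ₀ (momDeriv a (dimensionless L r₁ r₂ n Λ₀))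
      (Λ₀ ^ (-(p : ℤ)) * (Λ₀ / Λ_R) ^ r₁ * Pln (P.poly n p r₁ r₂) (Λ₀ / Λ_R))

end PolchinskiFlow

open PolchinskiFlow

/-! The flow equation is never differentiated in `t`. Two solutions with the same renormalization
conditions are compared instead: the bound on their difference is proportional to the distance `ε`
of their irrelevant bare data, so with `ε = |s - t|` it is a Lipschitz bound in `t`, and with `ε =
2` it gives the second part.

The mechanism is power counting. `L_n` has dimension `4 - n`, and the right-hand side of its flow
one less. Derivatives with `n + p ≥ 5` are integrated down from `Λ₀`, where the bare data are
controlled; those with `n + p ≤ 4` are integrated up from `Λ_R` at zero momentum, where the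
renormalization conditions and the symmetries fix them, and Taylor expansion then reaches the other
momenta (`scaledLE_of_flow`). Each integration costs at most one logarithm. The loop term has the
same order and two more legs; the tree term contains only lower orders, since zeroth order vanishes.
Hence an induction over the order and, downwards, over the number of legs
(`IsCutoff.exists_orderLE`), started by the vanishing for many legs.

The same integration works with dimension `5 - n` in place of `4 - n`. The difference of two
solutions has vanishing renormalized data, and bare data of size `ε Λ₀^(4-n-p) = (ε/Λ₀) Λ₀^(5-n-p)`
up to logarithms; so it behaves as a system of dimension `5 - n` with weight `ε/Λ₀`, which is the
gain `Λ/Λ₀` (`IsCutoff.exists_diff_bound`).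

Differentiability in `t` comes from the same estimate with vanishing data: order by order the vertex
functions are polynomials in `t`, because their interpolation defect is a linear combination of
solutions whose tree term, loop term and boundary data vanish (`IsCutoff.polyOn_step`). -/

namespace PolchinskiFlow

open Filter Topology

/-! ### Calculus of derivative bounds in units of `Λ` -/

section ScaledBounds

variable {E F : Type*} [NormedAddCommGroup E] [NormedSpace ℝ E]
  [NormedAddCommGroup F] [NormedSpace ℝ F]

/-- The derivatives of `f` at `x` of order at most `P`, measured in units of `Λ`, are bounded by
`X`. -/
def ScaledLE (P : ℕ) (Λ : ℝ) (f : E → ℝ) (x : E) (X : ℝ) : Prop :=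
  ∀ p ≤ P, Λ ^ p * ‖iteratedFDeriv ℝ p f x‖ ≤ X

theorem ScaledLE.mono {P : ℕ} {Λ : ℝ} {f : E → ℝ} {x : E} {X Y : ℝ} (h : ScaledLE P Λ f x X)
    (hXY : X ≤ Y) : ScaledLE P Λ f x Y := fun p hp => (h p hp).trans hXY

theorem scaledLE_of_eventuallyEq_zero {P : ℕ} {Λ : ℝ} {f : E → ℝ} {x : E} {X : ℝ}
    (h : f =ᶠ[𝓝 x] fun _ => 0) (hX : 0 ≤ X) : ScaledLE P Λ f x X := by
  intro p _
  rw [(h.iteratedFDeriv ℝ p).eq_of_nhds]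
  have : iteratedFDeriv ℝ p (fun _ : E => (0 : ℝ)) x = 0 := by
    rw [iteratedFDeriv_fun_zero]; rfl
  rw [this, norm_zero, mul_zero]
  exact hX

theorem ScaledLE.nonneg {P : ℕ} {Λ : ℝ} {f : E → ℝ} {x : E} {X : ℝ} (h : ScaledLE P Λ f x X) :
    0 ≤ X := by
  have := h 0 (Nat.zero_le _)
  rw [pow_zero, one_mul] at this
  exact (norm_nonneg _).trans this

theorem ScaledLE.const_mul {P : ℕ} {Λ : ℝ} {f : E → ℝ} {x : E} {X : ℝ} (h : ScaledLE P Λ f x X)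
    (hf : ContDiff ℝ ∞ f) (c : ℝ) : ScaledLE P Λ (fun y => c * f y) x (|c| * X) := by
  intro p hp
  have h1 : iteratedFDeriv ℝ p (fun y => c * f y) x = c • iteratedFDeriv ℝ p f x :=
    iteratedFDeriv_const_smul_apply (a := c) (hf.of_le (by exact_mod_cast le_top)).contDiffAt
  rw [h1, norm_smul, Real.norm_eq_abs]
  calc Λ ^ p * (|c| * ‖iteratedFDeriv ℝ p f x‖) = |c| * (Λ ^ p * ‖iteratedFDeriv ℝ p f x‖) := by
        ring
    _ ≤ |c| * X := mul_le_mul_of_nonneg_left (h p hp) (abs_nonneg c)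

theorem ScaledLE.sum {P : ℕ} {Λ : ℝ} (hΛ : 0 ≤ Λ) {ι : Type*} {s : Finset ι} {f : ι → E → ℝ}
    {x : E} {X : ι → ℝ} (h : ∀ i ∈ s, ScaledLE P Λ (f i) x (X i))
    (hf : ∀ i ∈ s, ContDiff ℝ ∞ (f i)) :
    ScaledLE P Λ (fun y => ∑ i ∈ s, f i y) x (∑ i ∈ s, X i) := by
  intro p hp
  rw [iteratedFDeriv_fun_sum_apply
    (fun i hi => ((hf i hi).of_le (by exact_mod_cast le_top)).contDiffAt)]
  calc Λ ^ p * ‖∑ i ∈ s, iteratedFDeriv ℝ p (f i) x‖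
      ≤ Λ ^ p * ∑ i ∈ s, ‖iteratedFDeriv ℝ p (f i) x‖ := by
        gcongr; exact norm_sum_le _ _
    _ = ∑ i ∈ s, Λ ^ p * ‖iteratedFDeriv ℝ p (f i) x‖ := Finset.mul_sum _ _ _
    _ ≤ ∑ i ∈ s, X i := Finset.sum_le_sum fun i hi => h i hi p hp

theorem ScaledLE.add {P : ℕ} {Λ : ℝ} (hΛ : 0 ≤ Λ) {f g : E → ℝ} {x : E} {X Y : ℝ}
    (h : ScaledLE P Λ f x X) (h' : ScaledLE P Λ g x Y)
    (hf : ContDiff ℝ ∞ f) (hg : ContDiff ℝ ∞ g) :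
    ScaledLE P Λ (fun y => f y + g y) x (X + Y) := by
  have := ScaledLE.sum (P := P) hΛ (s := Finset.univ) (f := ![f, g]) (x := x) (X := ![X, Y])
    (by intro i _; fin_cases i <;> assumption) (by intro i _; fin_cases i <;> assumption)
  simpa [Fin.sum_univ_two] using this

theorem ScaledLE.mul {P : ℕ} {Λ : ℝ} (hΛ : 0 ≤ Λ) {f g : E → ℝ} {x : E} {X Y : ℝ}
    (h : ScaledLE P Λ f x X) (h' : ScaledLE P Λ g x Y)
    (hf : ContDiff ℝ ∞ f) (hg : ContDiff ℝ ∞ g) :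
    ScaledLE P Λ (fun y => f y * g y) x (2 ^ P * (X * Y)) := by
  intro p hp
  have hX := h.nonneg
  have hY := h'.nonneg
  calc Λ ^ p * ‖iteratedFDeriv ℝ p (fun y => f y * g y) x‖
      ≤ Λ ^ p * ∑ i ∈ Finset.range (p + 1),
        (p.choose i : ℝ) * ‖iteratedFDeriv ℝ i f x‖ * ‖iteratedFDeriv ℝ (p - i) g x‖ := by
        gcongr
        exact norm_iteratedFDeriv_mul_le hf hg x (by exact_mod_cast le_top)
    _ = ∑ i ∈ Finset.range (p + 1), (p.choose i : ℝ) * ((Λ ^ i * ‖iteratedFDeriv ℝ i f x‖) *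
          (Λ ^ (p - i) * ‖iteratedFDeriv ℝ (p - i) g x‖)) := by
        rw [Finset.mul_sum]
        refine Finset.sum_congr rfl fun i hi => ?_
        rw [← Nat.add_sub_of_le (Nat.lt_succ_iff.1 (Finset.mem_range.1 hi)), pow_add,
          Nat.add_sub_cancel_left]
        ring
    _ ≤ ∑ i ∈ Finset.range (p + 1), (p.choose i : ℝ) * (X * Y) := by
        refine Finset.sum_le_sum fun i hi => ?_
        have hi' := Nat.lt_succ_iff.1 (Finset.mem_range.1 hi)
        gcongr
        · exact h i (hi'.trans hp)
        · exact h' (p - i) ((Nat.sub_le _ _).trans hp)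
    _ = 2 ^ p * (X * Y) := by
        rw [← Finset.sum_mul]
        congr 1
        exact_mod_cast Nat.sum_range_choose p
    _ ≤ 2 ^ P * (X * Y) := by
        gcongr
        norm_num

theorem ScaledLE.comp_linear {P : ℕ} {Λ : ℝ} (hΛ : 0 ≤ Λ) {f : F → ℝ} (T : E →L[ℝ] F) {x : E}
    {X c : ℝ} (h : ScaledLE P Λ f (T x) X) (hf : ContDiff ℝ ∞ f) (hc : 1 ≤ c) (hT : ‖T‖ ≤ c) :
    ScaledLE P Λ (fun y => f (T y)) x (c ^ P * X) := by
  intro p hp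
  have h1 := T.iteratedFDeriv_comp_right hf x (i := p) (by exact_mod_cast le_top)
  have h2 : (fun y => f (T y)) = f ∘ T := rfl
  rw [h2, h1]
  have hX := h.nonneg
  calc Λ ^ p * ‖(iteratedFDeriv ℝ p f (T x)).compContinuousLinearMap fun _ => T‖
      ≤ Λ ^ p * (‖iteratedFDeriv ℝ p f (T x)‖ * ∏ _i : Fin p, ‖T‖) := by
        gcongr
        exact ContinuousMultilinearMap.norm_compContinuousLinearMap_le _ _
    _ = ‖T‖ ^ p * (Λ ^ p * ‖iteratedFDeriv ℝ p f (T x)‖) := by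
        rw [Finset.prod_const, Finset.card_univ, Fintype.card_fin]; ring
    _ ≤ c ^ p * X := by
        gcongr
        exact h p hp
    _ ≤ c ^ P * X := by gcongr

end ScaledBounds

/-! ### Quotients of flat functions by a possibly vanishing denominator -/

section Profile

/-- A smooth function on the line vanishing outside `[1, 4]`. -/
structure FlatBump (φ : ℝ → ℝ) : Prop where
  smooth : ContDiff ℝ ∞ φ
  left : ∀ z ≤ 1, φ z = 0
  right : ∀ z, 4 ≤ z → φ z = 0

theorem FlatBump.deriv {φ : ℝ → ℝ} (h : FlatBump φ) : FlatBump (deriv φ) := by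
  have hsm : ContDiff ℝ ∞ (_root_.deriv φ) := (contDiff_infty_iff_deriv.1 h.smooth).2
  have hcl : IsClosed {z | _root_.deriv φ z = 0} :=
    isClosed_eq hsm.continuous continuous_const
  refine ⟨hsm, ?_, ?_⟩
  · have : Set.Iio (1 : ℝ) ⊆ {z | _root_.deriv φ z = 0} := by
      intro z hz
      have : φ =ᶠ[𝓝 z] fun _ => 0 := by
        filter_upwards [Iio_mem_nhds hz] with y hy using h.left y (le_of_lt hy)
      simpa using this.deriv_eq
    intro z hz
    have h2 := hcl.closure_subset_iff.2 this
    rw [closure_Iio] at h2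
    exact h2 hz
  · have : Set.Ioi (4 : ℝ) ⊆ {z | _root_.deriv φ z = 0} := by
      intro z hz
      have : φ =ᶠ[𝓝 z] fun _ => 0 := by
        filter_upwards [Ioi_mem_nhds hz] with y hy using h.right y (le_of_lt hy)
      simpa using this.deriv_eq
    intro z hz
    have h2 := hcl.closure_subset_iff.2 this
    rw [closure_Ioi] at h2
    exact h2 hz

/-- The mean value inequality on `[1, z]`, starting from `φ 1 = 0`, turns a bound of order `m` for
`φ'` into one of order `m + 1` for `φ`. This flatness at `1` absorbs the pole of the propagator at
`q² = -B`. -/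
theorem FlatBump.exists_abs_le_pow (m : ℕ) : ∀ {φ : ℝ → ℝ}, FlatBump φ →
    ∃ C, 0 ≤ C ∧ ∀ z, 1 ≤ z → |φ z| ≤ C * (z - 1) ^ m := by
  induction m with
  | zero =>
    intro φ h
    obtain ⟨C, hC⟩ := isCompact_Icc.exists_bound_of_continuousOn
      (s := Set.Icc (1 : ℝ) 4) h.smooth.continuous.continuousOn
    have hC0 : 0 ≤ C := (norm_nonneg _).trans (hC 1 (by norm_num))
    refine ⟨C, hC0, fun z hz => ?_⟩
    rw [pow_zero, mul_one]
    rcases le_total z 4 with h4 | h4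
    · exact hC z ⟨hz, h4⟩
    · rw [h.right z h4, abs_zero]; exact hC0
  | succ m ih =>
    intro φ h
    obtain ⟨C, hC0, hC⟩ := ih h.deriv
    refine ⟨C, hC0, fun z hz => ?_⟩
    have := (convex_Icc 1 z).norm_image_sub_le_of_norm_deriv_le (f := φ) (C := C * (z - 1) ^ m)
      (fun x _ => (h.smooth.differentiable (by simp)).differentiableAt)
      (fun x hx => (hC x hx.1).trans (by
        have h1 := hx.1
        have h2 := hx.2
        have h3 : 0 ≤ x - 1 := by linarith
        gcongr)) (Set.left_mem_Icc.2 hz) (Set.right_mem_Icc.2 hz)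
    rw [h.left 1 le_rfl, sub_zero, Real.norm_eq_abs, Real.norm_eq_abs,
      abs_of_nonneg (show (0 : ℝ) ≤ z - 1 by linarith)] at this
    rw [pow_succ, ← mul_assoc]
    exact this

/-- For `z < 1` everything vanishes and for `z > 1` the denominator is positive. At `z = 1` it may
vanish, but there the quotient is `O((z - 1)²)`, so its derivative is `0`, in agreement with the
formula. -/
theorem FlatBump.hasDerivAt_div {φ : ℝ → ℝ} (h : FlatBump φ) (m : ℕ) {b : ℝ} (hb : -1 ≤ b)
    (z : ℝ) : HasDerivAt (fun z => φ z / (z + b) ^ m)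
      (_root_.deriv φ z / (z + b) ^ m - m * (φ z / (z + b) ^ (m + 1))) z := by
  rcases lt_trichotomy z 1 with hz | hz | hz
  · rw [h.deriv.left z hz.le, h.left z hz.le]
    have : (fun z => φ z / (z + b) ^ m) =ᶠ[𝓝 z] fun _ => 0 := by
      filter_upwards [Iio_mem_nhds hz] with y hy
      rw [h.left y (le_of_lt hy), zero_div]
    simpa using (hasDerivAt_const z (0 : ℝ)).congr_of_eventuallyEq this
  · subst hz
    rw [h.deriv.left 1 le_rfl, h.left 1 le_rfl]
    obtain ⟨C, hC0, hC⟩ := h.exists_abs_le_pow (m + 2)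
    have hO : (fun z => φ z / (z + b) ^ m) =O[𝓝 1] fun x => ‖x - 1‖ ^ 2 := by
      refine Asymptotics.IsBigO.of_bound C (Eventually.of_forall fun y => ?_)
      rcases le_or_gt y 1 with hy | hy
      · rw [h.left y hy, zero_div, norm_zero]; positivity
      · have h1 : 0 < y - 1 := by linarith
        have h2 : y - 1 ≤ y + b := by linarith
        have h3 : 0 < y + b := by linarith
        rw [norm_div, norm_pow, Real.norm_of_nonneg h3.le, Real.norm_of_nonneg (r := y - 1) h1.le,
          Real.norm_of_nonneg (r := (y - 1) ^ 2) (by positivity), div_le_iff₀ (by positivity)]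
        calc ‖φ y‖ ≤ C * (y - 1) ^ (m + 2) := hC y hy.le
          _ = C * (y - 1) ^ 2 * (y - 1) ^ m := by ring
          _ ≤ C * (y - 1) ^ 2 * (y + b) ^ m := by gcongr
    simpa using (hO.hasFDerivAt (by norm_num)).hasDerivAt
  · have h3 : z + b ≠ 0 := by linarith
    have h1 : HasDerivAt φ (_root_.deriv φ z) z :=
      (h.smooth.differentiable (by simp)).differentiableAt.hasDerivAt
    have h2 : HasDerivAt (fun z => (z + b) ^ m) (m * (z + b) ^ (m - 1) * 1) z :=
      ((hasDerivAt_id z).add_const b).pow m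
    convert! h1.div h2 (pow_ne_zero _ h3) using 1
    rcases m with _ | m
    · simp
    · simp only [Nat.add_sub_cancel]
      field_simp
      ring

theorem FlatBump.div_bounded {φ : ℝ → ℝ} (h : FlatBump φ) (m : ℕ) :
    ∃ C, 0 ≤ C ∧ ∀ b, -1 ≤ b → ∀ z, |φ z / (z + b) ^ m| ≤ C := by
  obtain ⟨C, hC0, hC⟩ := h.exists_abs_le_pow m
  refine ⟨C, hC0, fun b hb z => ?_⟩
  rcases le_or_gt z 1 with hy | hy
  · rw [h.left z hy, zero_div, abs_zero]; exact hC0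
  · have h1 : 0 < z - 1 := by linarith
    have h2 : z - 1 ≤ z + b := by linarith
    have h3 : 0 < z + b := by linarith
    rw [abs_div, abs_of_pos (a := (z + b) ^ m) (by positivity), div_le_iff₀ (by positivity)]
    calc |φ z| ≤ C * (z - 1) ^ m := hC z hy.le
      _ ≤ C * (z + b) ^ m := by gcongr

/-- By the quotient rule the derivative is a combination of quotients of the same kind, with `(φ',
m)` and `(φ, m + 1)`, so induction over `j` applies. The constant is uniform in `b ≥ -1`, as bounds
independent of `B` and `Λ` require. -/
theorem FlatBump.div_contDiff (j : ℕ) : ∀ {φ : ℝ → ℝ}, FlatBump φ → ∀ m : ℕ,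
    (∀ b, -1 ≤ b → ContDiff ℝ j fun z => φ z / (z + b) ^ m) ∧
      ∃ C, 0 ≤ C ∧ ∀ b, -1 ≤ b → ∀ z, |iteratedDeriv j (fun z => φ z / (z + b) ^ m) z| ≤ C := by
  induction j with
  | zero =>
    intro φ h m
    refine ⟨fun b hb => ?_, ?_⟩
    · rw [Nat.cast_zero, contDiff_zero]
      exact continuous_iff_continuousAt.2 fun z => (h.hasDerivAt_div m hb z).continuousAt
    · simpa only [iteratedDeriv_zero] using h.div_bounded m
  | succ j ih =>
    intro φ h m
    have hd : ∀ b, -1 ≤ b → _root_.deriv (fun z => φ z / (z + b) ^ m) =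
        fun z => _root_.deriv φ z / (z + b) ^ m - m * (φ z / (z + b) ^ (m + 1)) :=
      fun b hb => funext fun z => (h.hasDerivAt_div m hb z).deriv
    obtain ⟨s1, C1, hC1, b1⟩ := ih h.deriv m
    obtain ⟨s2, C2, hC2, b2⟩ := ih h (m + 1)
    refine ⟨fun b hb => ?_, C1 + m * C2, by positivity, fun b hb z => ?_⟩
    · rw [Nat.cast_add, Nat.cast_one, contDiff_succ_iff_deriv]
      refine ⟨fun z => (h.hasDerivAt_div m hb z).differentiableAt, by simp, ?_⟩
      rw [hd b hb]
      exact (s1 b hb).sub (contDiff_const.mul (s2 b hb))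
    · rw [iteratedDeriv_succ', hd b hb,
        iteratedDeriv_fun_sub (s1 b hb).contDiffAt (contDiff_const.mul (s2 b hb)).contDiffAt,
        iteratedDeriv_const_mul_field]
      refine (abs_sub _ _).trans (add_le_add (b1 b hb z) ?_)
      rw [abs_mul, Nat.abs_cast]
      exact mul_le_mul_of_nonneg_left (b2 b hb z) (Nat.cast_nonneg m)

end Profile

/-! ### Smoothness and scaling of the differentiated propagator -/

section Propagator

variable {K : ℝ → ℝ}

theorem IsCutoff.deriv_eq_zero_of_le_one (hK : IsCutoff K) {z : ℝ} (h0 : 0 < z) (h1 : z ≤ 1) :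
    deriv K z = 0 := by
  have hcl : IsClosed {z | deriv K z = 0} :=
    isClosed_eq (contDiff_infty_iff_deriv.1 hK.smooth).2.continuous continuous_const
  have : Set.Ioo (0 : ℝ) 1 ⊆ {z | deriv K z = 0} := by
    intro z hz
    have : K =ᶠ[𝓝 z] fun _ => 1 := by
      filter_upwards [Ioo_mem_nhds hz.1 hz.2] with y hy using hK.eq_one y hy.1.le hy.2.le
    simpa using this.deriv_eq
  have h2 := hcl.closure_subset_iff.2 this
  rw [closure_Ioo (by norm_num)] at h2
  exact h2 ⟨h0.le, h1⟩

theorem IsCutoff.deriv_eq_zero_of_four_le (hK : IsCutoff K) {z : ℝ} (h : 4 ≤ z) :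
    deriv K z = 0 := by
  have hcl : IsClosed {z | deriv K z = 0} :=
    isClosed_eq (contDiff_infty_iff_deriv.1 hK.smooth).2.continuous continuous_const
  have : Set.Ioi (4 : ℝ) ⊆ {z | deriv K z = 0} := by
    intro z hz
    have : K =ᶠ[𝓝 z] fun _ => 0 := by
      filter_upwards [Ioi_mem_nhds hz] with y hy using hK.eq_zero y (le_of_lt hy)
    simpa using this.deriv_eq
  have h2 := hcl.closure_subset_iff.2 this
  rw [closure_Ioi] at h2
  exact h2 h

/-- The function `z K'(z)`, cut off at `z ≤ 1`. -/
noncomputable def profile (K : ℝ → ℝ) (z : ℝ) : ℝ := z * if z ≤ 1 then 0 else deriv K z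

theorem IsCutoff.profile_eq (hK : IsCutoff K) {z : ℝ} (hz : 0 ≤ z) :
    profile K z = z * deriv K z := by
  unfold profile
  rcases hz.eq_or_lt with rfl | h0
  · simp
  · split_ifs with h1
    · rw [hK.deriv_eq_zero_of_le_one h0 h1]
    · rfl

theorem IsCutoff.flatBump_profile (hK : IsCutoff K) : FlatBump (profile K) := by
  refine ⟨contDiff_iff_contDiffAt.2 fun z => ?_, fun z hz => by simp [profile, hz],
    fun z hz => ?_⟩
  · rcases lt_or_ge z 1 with hz | hz
    · have : profile K =ᶠ[𝓝 z] fun _ => 0 := by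
        filter_upwards [Iio_mem_nhds hz] with y hy
        simp [profile, le_of_lt (Set.mem_Iio.1 hy)]
      exact contDiffAt_const.congr_of_eventuallyEq this
    · have : profile K =ᶠ[𝓝 z] fun y => y * deriv K y := by
        filter_upwards [Ioi_mem_nhds (zero_lt_one.trans_le hz)] with y hy
        exact hK.profile_eq (le_of_lt hy)
      exact (contDiff_id.mul
        (contDiff_infty_iff_deriv.1 hK.smooth).2).contDiffAt.congr_of_eventuallyEq this
  · rw [hK.profile_eq (by linarith), hK.deriv_eq_zero_of_four_le hz, mul_zero]

/-- With `z = q²/Λ²` and `b = B/Λ²` the chain rule gives `-2 Λ⁻³ z K'(z) / (z + b)`, exhibiting the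
dimension `-3`. At `q² + B = 0` both sides are `0` by the convention for division. -/
theorem IsCutoff.propagatorDot_eq (hK : IsCutoff K) {B Λ : ℝ} (hΛ : 0 < Λ) (q : Momentum) :
    propagatorDot K B Λ q =
      -2 * (Λ ^ 3)⁻¹ * (profile K (‖Λ⁻¹ • q‖ ^ 2) / (‖Λ⁻¹ • q‖ ^ 2 + B / Λ ^ 2) ^ 1) := by
  have hz : ‖Λ⁻¹ • q‖ ^ 2 = ‖q‖ ^ 2 / Λ ^ 2 := by
    rw [norm_smul, Real.norm_of_nonneg (inv_nonneg.2 hΛ.le), mul_pow, inv_pow]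
    field_simp
  rw [hz, hK.profile_eq (by positivity), pow_one]
  unfold propagatorDot propagator
  have h1 : HasDerivAt (fun s : ℝ => ‖q‖ ^ 2 / s ^ 2) (-2 * ‖q‖ ^ 2 / Λ ^ 3) Λ := by
    convert! (((hasDerivAt_id Λ).pow 2).inv (pow_ne_zero 2 hΛ.ne')).const_mul (‖q‖ ^ 2) using 1
    simp only [Pi.pow_apply, id]
    field_simp
    ring
  have h2 : HasDerivAt K (deriv K (‖q‖ ^ 2 / Λ ^ 2)) (‖q‖ ^ 2 / Λ ^ 2) :=
    (hK.smooth.differentiable (by simp)).differentiableAt.hasDerivAt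
  have h3 := (h2.comp Λ h1).div_const (‖q‖ ^ 2 + B)
  have h4 := h3.deriv
  simp only [Function.comp_def] at h4
  rw [h4, ← add_div, div_div_eq_mul_div]
  field_simp

/-- `Δ̇_Λ` vanishes outside the ball of radius `2Λ`. -/
theorem IsCutoff.propagatorDot_eq_zero (hK : IsCutoff K) {B Λ : ℝ} (hΛ : 0 < Λ) {q : Momentum}
    (hq : 2 * Λ < ‖q‖) : propagatorDot K B Λ q = 0 := by
  have h2 : 4 ≤ ‖Λ⁻¹ • q‖ ^ 2 := by
    have h : 2 ≤ ‖Λ⁻¹ • q‖ := by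
      rw [norm_smul, Real.norm_of_nonneg (inv_nonneg.2 hΛ.le), inv_mul_eq_div, le_div_iff₀ hΛ]
      exact hq.le
    nlinarith
  rw [hK.propagatorDot_eq hΛ, hK.flatBump_profile.right _ h2, zero_div, mul_zero]

/-- This removes the term with `A` from the flow equation. -/
theorem IsCutoff.propagatorDot_zero (hK : IsCutoff K) {B Λ : ℝ} (hΛ : 0 < Λ) :
    propagatorDot K B Λ 0 = 0 := by
  rw [hK.propagatorDot_eq hΛ]
  simp [profile]

theorem neg_one_le_div_sq {B Λ : ℝ} (hΛ : 0 < Λ) (hB : |B| ≤ Λ ^ 2) : -1 ≤ B / Λ ^ 2 := by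
  rw [le_div_iff₀ (by positivity)]
  linarith [(abs_le.1 hB).1]

theorem IsCutoff.contDiff_radial (hK : IsCutoff K) {b : ℝ} (hb : -1 ≤ b) :
    ContDiff ℝ ∞ fun x : Momentum => profile K (‖x‖ ^ 2) / (‖x‖ ^ 2 + b) ^ 1 := by
  have h : ContDiff ℝ ∞ fun z => profile K z / (z + b) ^ 1 :=
    contDiff_infty.2 fun j => (hK.flatBump_profile.div_contDiff j 1).1 b hb
  exact h.comp (contDiff_norm_sq ℝ)

theorem IsCutoff.contDiff_propagatorDot (hK : IsCutoff K) {B Λ : ℝ} (hΛ : 0 < Λ)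
    (hB : |B| ≤ Λ ^ 2) : ContDiff ℝ ∞ (propagatorDot K B Λ) := by
  have h := hK.contDiff_radial (neg_one_le_div_sq hΛ hB)
  have h2 : propagatorDot K B Λ = fun q => -2 * (Λ ^ 3)⁻¹ *
      (profile K (‖Λ⁻¹ • q‖ ^ 2) / (‖Λ⁻¹ • q‖ ^ 2 + B / Λ ^ 2) ^ 1) :=
    funext fun q => hK.propagatorDot_eq hΛ q
  rw [h2]
  exact contDiff_const.mul (h.comp (contDiff_const_smul Λ⁻¹))

/-- The chain rule bound for iterated derivatives combines the estimates on the quotient, uniform in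
`b`, with those on `‖x‖²` over a compact ball. Radius `2` suffices because the profile vanishes from
`z = 4` on. -/
theorem IsCutoff.exists_radial_bound (hK : IsCutoff K) (P : ℕ) :
    ∃ C, 0 ≤ C ∧ ∀ b, -1 ≤ b → ∀ x : Momentum, ‖x‖ ≤ 2 → ∀ p ≤ P,
      ‖iteratedFDeriv ℝ p (fun x : Momentum => profile K (‖x‖ ^ 2) / (‖x‖ ^ 2 + b) ^ 1) x‖ ≤ C := by
  have h1 : ∀ j : ℕ, ∃ D, 0 ≤ D ∧ ∀ x : Momentum, ‖x‖ ≤ 2 →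
      ‖iteratedFDeriv ℝ j (fun x : Momentum => ‖x‖ ^ 2) x‖ ≤ D := by
    intro j
    obtain ⟨D, hD⟩ := (isCompact_closedBall (0 : Momentum) 2).exists_bound_of_continuousOn
      ((contDiff_norm_sq ℝ (E := Momentum) (n := ∞)).continuous_iteratedFDeriv (m := j)
        (by exact_mod_cast le_top)).continuousOn
    refine ⟨D, (norm_nonneg _).trans (hD 0 (by simp)), fun x hx => hD x (by simpa using hx)⟩
  choose D hD0 hD using h1
  choose s C hC0 hC using fun j => hK.flatBump_profile.div_contDiff j 1
  set C' := ∑ j ∈ Finset.range (P + 1), C j with hC'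
  set D' := 1 + ∑ j ∈ Finset.range (P + 1), D j with hD'
  have hC'0 : 0 ≤ C' := Finset.sum_nonneg fun j _ => hC0 j
  have hD'1 : 1 ≤ D' := le_add_of_nonneg_right (Finset.sum_nonneg fun j _ => hD0 j)
  refine ⟨P.factorial * C' * D' ^ P, by positivity, fun b hb x hx p hp => ?_⟩
  have hg : ContDiff ℝ ∞ fun z => profile K z / (z + b) ^ 1 := contDiff_infty.2 fun j => s j b hb
  have := norm_iteratedFDeriv_comp_le (n := p) hg (contDiff_norm_sq ℝ (E := Momentum))
    (by exact_mod_cast le_top) x (C := C') (D := D')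
    (fun i hi => by
      rw [norm_iteratedFDeriv_eq_norm_iteratedDeriv]
      exact (hC i b hb _).trans (Finset.single_le_sum (f := C) (fun j _ => hC0 j)
        (Finset.mem_range.2 (by omega))))
    (fun i hi hi' => by
      refine (hD i x hx).trans (le_trans ?_ (le_self_pow₀ hD'1 (by omega)))
      have := Finset.single_le_sum (f := D) (fun j _ => hD0 j)
        (Finset.mem_range.2 (show i < P + 1 by omega))
      linarith)
  refine this.trans ?_
  gcongr

theorem IsCutoff.exists_scaledLE_propagatorDot (hK : IsCutoff K) (P : ℕ) :
    ∃ C, 0 ≤ C ∧ ∀ B Λ : ℝ, 0 < Λ → |B| ≤ Λ ^ 2 → ∀ q : Momentum,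
      ScaledLE P Λ (propagatorDot K B Λ) q (C * (Λ ^ 3)⁻¹) := by
  obtain ⟨C, hC0, hC⟩ := hK.exists_radial_bound P
  refine ⟨2 * C, by positivity, fun B Λ hΛ hB q => ?_⟩
  rcases le_or_gt ‖q‖ (2 * Λ) with hq | hq
  · have hb := neg_one_le_div_sq hΛ hB
    have hrad := hK.contDiff_radial hb
    have h2 : propagatorDot K B Λ = fun q => -2 * (Λ ^ 3)⁻¹ *
        (profile K (‖Λ⁻¹ • q‖ ^ 2) / (‖Λ⁻¹ • q‖ ^ 2 + B / Λ ^ 2) ^ 1) :=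
      funext fun q => hK.propagatorDot_eq hΛ q
    have h3 : ScaledLE P Λ (fun q : Momentum =>
        profile K (‖Λ⁻¹ • q‖ ^ 2) / (‖Λ⁻¹ • q‖ ^ 2 + B / Λ ^ 2) ^ 1) q C := by
      intro p hp
      have h4 := (Λ⁻¹ • ContinuousLinearMap.id ℝ Momentum).iteratedFDeriv_comp_right hrad q
        (i := p) (by exact_mod_cast le_top)
      have h5 : (fun q : Momentum =>
          profile K (‖Λ⁻¹ • q‖ ^ 2) / (‖Λ⁻¹ • q‖ ^ 2 + B / Λ ^ 2) ^ 1) =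
          (fun x : Momentum => profile K (‖x‖ ^ 2) / (‖x‖ ^ 2 + B / Λ ^ 2) ^ 1) ∘
            (Λ⁻¹ • ContinuousLinearMap.id ℝ Momentum) := rfl
      rw [h5, h4]
      have h6 : ‖Λ⁻¹ • ContinuousLinearMap.id ℝ Momentum‖ ≤ Λ⁻¹ := by
        rw [norm_smul, Real.norm_of_nonneg (inv_nonneg.2 hΛ.le)]
        exact mul_le_of_le_one_right (inv_nonneg.2 hΛ.le) ContinuousLinearMap.norm_id_le
      have h7 : ‖Λ⁻¹ • q‖ ≤ 2 := by
        rw [norm_smul, Real.norm_of_nonneg (inv_nonneg.2 hΛ.le), inv_mul_eq_div, div_le_iff₀ hΛ]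
        exact hq
      refine (mul_le_mul_of_nonneg_left
        (ContinuousMultilinearMap.norm_compContinuousLinearMap_le _ _) (by positivity)).trans ?_
      rw [Finset.prod_const, Finset.card_univ, Fintype.card_fin]
      refine (mul_le_mul_of_nonneg_left (mul_le_mul (hC _ hb _ h7 p hp)
        (pow_le_pow_left₀ (norm_nonneg _) h6 p) (by positivity) hC0) (by positivity)).trans ?_
      rw [inv_pow]
      apply le_of_eq
      field_simp
    rw [h2]
    refine (h3.const_mul (hrad.comp (contDiff_const_smul Λ⁻¹)) _).mono (le_of_eq ?_)
    rw [abs_mul, abs_neg, abs_two, abs_of_nonneg (by positivity)]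
    ring
  · refine scaledLE_of_eventuallyEq_zero ?_ (by positivity)
    filter_upwards [(isOpen_lt continuous_const continuous_norm).mem_nhds hq] with y hy
    exact hK.propagatorDot_eq_zero hΛ hy

end Propagator

/-! ### Momentum configurations, regions and momentum derivatives -/

section Momenta

/-- The region `‖k_i‖ ≤ ρ Λ`, `i = 1, …, n`. -/
def region (ρ : ℝ) (n : ℕ) (Λ : ℝ) : Set (Momenta n) := {k | ∀ i, ‖k.1 i‖ ≤ ρ * Λ}

theorem region_mono {ρ : ℝ} (hρ : 0 ≤ ρ) (n : ℕ) {Λ Λ' : ℝ} (h : Λ ≤ Λ') :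
    region ρ n Λ ⊆ region ρ n Λ' := fun _ hk i =>
  (hk i).trans (mul_le_mul_of_nonneg_left h hρ)

theorem zero_mem_region {ρ Λ : ℝ} (hρ : 0 ≤ ρ) (hΛ : 0 ≤ Λ) (n : ℕ) :
    (0 : Momenta n) ∈ region ρ n Λ := fun i => by
  simpa using mul_nonneg hρ hΛ

theorem norm_le_of_mem_region {ρ Λ : ℝ} (hρ : 0 ≤ ρ) (hΛ : 0 ≤ Λ) {n : ℕ} {k : Momenta n}
    (hk : k ∈ region ρ n Λ) : ‖k‖ ≤ ρ * Λ :=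
  (pi_norm_le_iff_of_nonneg (mul_nonneg hρ hΛ)).2 hk

theorem convex_region (ρ : ℝ) (n : ℕ) (Λ : ℝ) : Convex ℝ (region ρ n Λ) := by
  intro x hx y hy a b ha hb hab i
  calc ‖a • x.1 i + b • y.1 i‖ ≤ ‖a • x.1 i‖ + ‖b • y.1 i‖ := norm_add_le _ _
    _ = a * ‖x.1 i‖ + b * ‖y.1 i‖ := by
      rw [norm_smul, norm_smul, Real.norm_of_nonneg ha, Real.norm_of_nonneg hb]
    _ ≤ a * (ρ * Λ) + b * (ρ * Λ) := by
      have h1 := hx i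
      have h2 := hy i
      gcongr
    _ = ρ * Λ := by rw [← add_mul, hab, one_mul]

theorem norm_direction_le {n : ℕ} (i j : Fin n) (μ : Fin 4) : ‖direction i j μ‖ ≤ 2 := by
  have h : ∀ l : Fin n, ‖(Pi.single l (EuclideanSpace.single μ (1 : ℝ)) : Fin n → Momentum)‖ ≤ 1 :=
    fun l => by
      rw [pi_norm_le_iff_of_nonneg zero_le_one]
      intro m
      rcases eq_or_ne m l with rfl | hml
      · simp
      · simp [hml]
  calc ‖direction i j μ‖ = ‖(Pi.single i (EuclideanSpace.single μ (1 : ℝ)) : Fin n → Momentum)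
        - Pi.single j (EuclideanSpace.single μ (1 : ℝ))‖ := rfl
    _ ≤ _ := norm_sub_le _ _
    _ ≤ 2 := by linarith [h i, h j]

theorem direction_self {n : ℕ} (i : Fin n) (μ : Fin 4) : direction i i μ = 0 :=
  Subtype.ext (sub_self _)

/-- The contributions at the reference leg `i₀` add up to the total momentum, which is zero. Thus
the directions relative to one leg span, and the operators `∂_{i,j}^μ` control the full derivative.
-/
theorem eq_sum_direction {n : ℕ} (i₀ : Fin n) (v : Momenta n) :
    v = ∑ x : Fin n × Fin 4, v.1 x.1 x.2 • direction x.1 i₀ x.2 := by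
  apply Subtype.ext
  have hv : ∑ i, v.1 i = 0 := v.2
  have hb : ∀ w : Momentum, ∑ μ, w μ • EuclideanSpace.single μ (1 : ℝ) = w := by
    intro w
    ext ν
    simp [Finset.sum_apply, Pi.single_apply]
  have h1 : ∀ x : Fin n × Fin 4, ((v.1 x.1 x.2 • direction x.1 i₀ x.2 : Momenta n) :
      Fin n → Momentum) = Pi.single x.1 (v.1 x.1 x.2 • EuclideanSpace.single x.2 (1 : ℝ)) -
        Pi.single i₀ (v.1 x.1 x.2 • EuclideanSpace.single x.2 (1 : ℝ)) := by
    intro x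
    rw [Pi.single_smul, Pi.single_smul, ← smul_sub]
    rfl
  have h2 : ∀ (l : Fin n) (w : Momentum), ∑ μ, (Pi.single l (w μ • EuclideanSpace.single μ (1 : ℝ)) :
      Fin n → Momentum) = Pi.single l w := by
    intro l w
    conv_rhs => rw [← hb w]
    exact (map_sum (AddMonoidHom.single (fun _ : Fin n => Momentum) l) _ _).symm
  rw [AddSubmonoidClass.coe_finsetSum, Finset.sum_congr rfl fun x _ => h1 x,
    Fintype.sum_prod_type]
  simp only [Finset.sum_sub_distrib, h2]
  have h3 : ∑ i, (Pi.single i₀ (v.1 i) : Fin n → Momentum) = 0 := by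
    have := (map_sum (AddMonoidHom.single (fun _ : Fin n => Momentum) i₀) v.1 Finset.univ).symm
    rw [hv, map_zero] at this
    exact this
  rw [h3, sub_zero, Finset.univ_sum_single]

/-- Expanding each argument in the `4 n` directions relative to `i₀` gives `(4 n)^p` terms, whose
coefficients are products of coordinates, each at most the norm of its argument. -/
theorem multilinear_norm_le {n p : ℕ} (i₀ : Fin n)
    (M : ContinuousMultilinearMap ℝ (fun _ : Fin p => Momenta n) ℝ) {C : ℝ} (hC : 0 ≤ C)
    (h : ∀ a : Fin p → Fin n × Fin 4, |M fun q => direction (a q).1 i₀ (a q).2| ≤ C) :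
    ‖M‖ ≤ (4 * n) ^ p * C := by
  refine M.opNorm_le_bound (by positivity) fun v => ?_
  have h1 : M v = ∑ a : Fin p → Fin n × Fin 4,
      (∏ q, (v q).1 (a q).1 (a q).2) * M fun q => direction (a q).1 i₀ (a q).2 := by
    conv_lhs => rw [show v = fun q => ∑ x : Fin n × Fin 4,
      (v q).1 x.1 x.2 • direction x.1 i₀ x.2 from funext fun q => eq_sum_direction i₀ (v q)]
    have := M.toMultilinearMap.map_sum
      (fun q (x : Fin n × Fin 4) => (v q).1 x.1 x.2 • direction x.1 i₀ x.2)
    refine this.trans (Finset.sum_congr rfl fun a _ => ?_)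
    exact M.toMultilinearMap.map_smul_univ _ _
  rw [h1]
  refine (norm_sum_le _ _).trans ?_
  have h2 : ∀ a ∈ (Finset.univ : Finset (Fin p → Fin n × Fin 4)),
      ‖(∏ q, (v q).1 (a q).1 (a q).2) * M fun q => direction (a q).1 i₀ (a q).2‖ ≤
        (∏ q, ‖v q‖) * C := by
    intro a _
    rw [norm_mul, norm_prod]
    refine mul_le_mul (Finset.prod_le_prod (fun q _ => norm_nonneg _) fun q _ => ?_) (h a)
      (norm_nonneg _) (Finset.prod_nonneg fun q _ => norm_nonneg _)
    exact (PiLp.norm_apply_le ((v q).1 (a q).1) (a q).2).trans (norm_le_pi_norm (v q).1 (a q).1)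
  refine (Finset.sum_le_card_nsmul _ _ _ h2).trans (le_of_eq ?_)
  rw [Finset.card_univ, Fintype.card_fun, Fintype.card_prod, Fintype.card_fin, Fintype.card_fin,
    Fintype.card_fin, nsmul_eq_mul]
  push_cast
  ring

theorem norm_iteratedFDeriv_le_of_momDeriv {n p : ℕ} (hn : 1 ≤ n) {f : Momenta n → ℝ}
    {k : Momenta n} {C : ℝ} (h : ∀ a : Fin p → Fin n × Fin n × Fin 4, |momDeriv a f k| ≤ C) :
    ‖iteratedFDeriv ℝ p f k‖ ≤ (4 * n) ^ p * C :=
  multilinear_norm_le ⟨0, hn⟩ _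
    ((abs_nonneg _).trans (h fun _ => (⟨0, hn⟩, ⟨0, hn⟩, 0)))
    fun a => h fun q => ((a q).1, ⟨0, hn⟩, (a q).2)

theorem abs_momDeriv_le {n p : ℕ} (a : Fin p → Fin n × Fin n × Fin 4) (f : Momenta n → ℝ)
    (k : Momenta n) : |momDeriv a f k| ≤ 2 ^ p * ‖iteratedFDeriv ℝ p f k‖ := by
  refine ((iteratedFDeriv ℝ p f k).le_opNorm _).trans ?_
  rw [mul_comm]
  gcongr
  refine (Finset.prod_le_prod (fun _ _ => norm_nonneg _)
    fun q _ => norm_direction_le (a q).1 (a q).2.1 (a q).2.2).trans (le_of_eq ?_)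
  simp

theorem momDeriv_const_mul {n p : ℕ} (a : Fin p → Fin n × Fin n × Fin 4) {f : Momenta n → ℝ}
    (hf : ContDiff ℝ ∞ f) (c : ℝ) (k : Momenta n) :
    momDeriv a (fun k => c * f k) k = c * momDeriv a f k := by
  have h1 : iteratedFDeriv ℝ p (fun y => c * f y) k = c • iteratedFDeriv ℝ p f k :=
    iteratedFDeriv_const_smul_apply (a := c) (hf.of_le (by exact_mod_cast le_top)).contDiffAt
  unfold momDeriv
  rw [h1]
  rfl

theorem momDeriv_sum {n p : ℕ} (a : Fin p → Fin n × Fin n × Fin 4) {ι : Type*} (s : Finset ι)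
    {f : ι → Momenta n → ℝ} (hf : ∀ i ∈ s, ContDiff ℝ ∞ (f i)) (k : Momenta n) :
    momDeriv a (fun k => ∑ i ∈ s, f i k) k = ∑ i ∈ s, momDeriv a (f i) k := by
  unfold momDeriv
  rw [iteratedFDeriv_fun_sum_apply
    (fun i hi => ((hf i hi).of_le (by exact_mod_cast le_top)).contDiffAt),
    sum_apply]

/-- `legs I` as a continuous linear map. -/
noncomputable def legsL {n : ℕ} (I : Finset (Fin n)) : Momenta n →L[ℝ] Momenta (I.card + 1) :=
  LinearMap.toContinuousLinearMap
    { toFun := legs I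
      map_add' := fun x y => by
        apply Subtype.ext
        funext l
        refine Fin.lastCases ?_ (fun l => ?_) l
        · simp [legs, Finset.sum_add_distrib, add_comm]
        · simp [legs]
      map_smul' := fun c x => by
        apply Subtype.ext
        funext l
        refine Fin.lastCases ?_ (fun l => ?_) l
        · simp [legs, Finset.smul_sum]
        · simp [legs] }

/-- The total momentum of a set of legs, as a continuous linear map. -/
noncomputable def totalL {n : ℕ} (I : Finset (Fin n)) : Momenta n →L[ℝ] Momentum :=
  LinearMap.toContinuousLinearMap
    { toFun := fun k => ∑ i ∈ I, k.1 i
      map_add' := fun x y => by simp [Finset.sum_add_distrib]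
      map_smul' := fun c x => by simp [Finset.smul_sum] }

theorem totalL_apply {n : ℕ} (I : Finset (Fin n)) (k : Momenta n) :
    totalL I k = ∑ i ∈ I, k.1 i := rfl

/-- The linear map `k ↦ (k_1, …, k_n, 0, 0)`. -/
noncomputable def padL (n : ℕ) : Momenta n →L[ℝ] Momenta (n + 2) :=
  LinearMap.toContinuousLinearMap
    { toFun := fun k => addPair k 0
      map_add' := fun x y => by
        apply Subtype.ext
        funext l
        refine Fin.lastCases ?_ (fun l => Fin.lastCases ?_ (fun l => ?_) l) l <;> simp [addPair]
      map_smul' := fun c x => by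
        apply Subtype.ext
        funext l
        refine Fin.lastCases ?_ (fun l => Fin.lastCases ?_ (fun l => ?_) l) l <;> simp [addPair] }

/-- The linear map `q ↦ (0, …, 0, q, -q)`. -/
noncomputable def pairL (n : ℕ) : Momentum →L[ℝ] Momenta (n + 2) :=
  LinearMap.toContinuousLinearMap
    { toFun := fun q => addPair 0 q
      map_add' := fun x y => by
        apply Subtype.ext
        funext l
        refine Fin.lastCases ?_ (fun l => Fin.lastCases ?_ (fun l => ?_) l) l <;>
          simp [addPair, add_comm]
      map_smul' := fun c x => by
        apply Subtype.ext
        funext l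
        refine Fin.lastCases ?_ (fun l => Fin.lastCases ?_ (fun l => ?_) l) l <;> simp [addPair] }

theorem addPair_eq {n : ℕ} (k : Momenta n) (q : Momentum) :
    addPair k q = padL n k + pairL n q := by
  apply Subtype.ext
  funext l
  change (addPair k q).1 l = (addPair k 0).1 l + (addPair 0 q).1 l
  refine Fin.lastCases ?_ (fun l => Fin.lastCases ?_ (fun l => ?_) l) l <;> simp [addPair]

theorem contDiff_comp_addPair {n : ℕ} {f : Momenta (n + 2) → ℝ} (hf : ContDiff ℝ ∞ f)
    (q : Momentum) : ContDiff ℝ ∞ fun k : Momenta n => f (addPair k q) := by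
  simp only [addPair_eq]
  exact hf.comp ((padL n).contDiff.add contDiff_const)

theorem momDeriv_comp_addPair {n p : ℕ} (a : Fin p → Fin n × Fin n × Fin 4)
    {f : Momenta (n + 2) → ℝ} (hf : ContDiff ℝ ∞ f) (q : Momentum) (k : Momenta n) :
    momDeriv a (fun k' => f (addPair k' q)) k =
      iteratedFDeriv ℝ p f (addPair k q)
        (fun j => padL n (direction (a j).1 (a j).2.1 (a j).2.2)) := by
  have h1 := (padL n).iteratedFDeriv_comp_right (f := fun x => f (x + pairL n q))
    (hf.comp (contDiff_id.add contDiff_const)) k (i := p) (by exact_mod_cast le_top)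
  have h2 : (fun k' => f (addPair k' q)) = (fun x => f (x + pairL n q)) ∘ padL n :=
    funext fun k' => by rw [addPair_eq]; rfl
  unfold momDeriv
  rw [h2, h1, iteratedFDeriv_comp_add_right, addPair_eq]
  rfl

theorem abs_momDeriv_comp_addPair_le {n p : ℕ} (a : Fin p → Fin n × Fin n × Fin 4)
    {f : Momenta (n + 2) → ℝ} (hf : ContDiff ℝ ∞ f) (q : Momentum) (k : Momenta n) :
    |momDeriv a (fun k' => f (addPair k' q)) k| ≤
      (2 * ‖padL n‖) ^ p * ‖iteratedFDeriv ℝ p f (addPair k q)‖ := by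
  rw [momDeriv_comp_addPair a hf]
  refine ((iteratedFDeriv ℝ p f (addPair k q)).le_opNorm _).trans ?_
  rw [mul_comm]
  gcongr
  refine (Finset.prod_le_prod (fun _ _ => norm_nonneg _)
    fun j _ => ((padL n).le_opNorm _).trans (mul_le_mul_of_nonneg_left
      (norm_direction_le (a j).1 (a j).2.1 (a j).2.2) (norm_nonneg _))).trans (le_of_eq ?_)
  rw [Finset.prod_const, Finset.card_univ, Fintype.card_fin, mul_comm]

theorem continuous_momDeriv_comp_addPair {n p : ℕ} (a : Fin p → Fin n × Fin n × Fin 4)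
    {f : Momenta (n + 2) → ℝ} (hf : ContDiff ℝ ∞ f) (k : Momenta n) :
    Continuous fun q => momDeriv a (fun k' => f (addPair k' q)) k := by
  rw [show (fun q => momDeriv a (fun k' => f (addPair k' q)) k) = _ from
    funext fun q => momDeriv_comp_addPair a hf q k]
  simp only [addPair_eq]
  have h1 : Continuous fun q => iteratedFDeriv ℝ p f (padL n k + pairL n q) :=
    (hf.continuous_iteratedFDeriv (m := p) (by exact_mod_cast le_top)).comp
      (continuous_const.add (pairL n).continuous)
  exact (ContinuousMultilinearMap.apply ℝ _ ℝ _).continuous.comp h1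

/-- `Δ̇_Λ` is supported in the ball of radius `2Λ`, so for `ρ ≥ 2` the loop momentum never leaves
the region where bounds are known. `legs_mem_region` does the same for the tree term. -/
theorem addPair_mem_region {ρ Λ : ℝ} (hρ : 2 ≤ ρ) (hΛ : 0 ≤ Λ) {n : ℕ} {k : Momenta n}
    (hk : k ∈ region ρ n Λ) {q : Momentum} (hq : ‖q‖ ≤ 2 * Λ) :
    addPair k q ∈ region ρ (n + 2) Λ := by
  have hq' : ‖q‖ ≤ ρ * Λ := hq.trans (mul_le_mul_of_nonneg_right hρ hΛ)
  intro l
  refine Fin.lastCases ?_ (fun l => Fin.lastCases ?_ (fun l => ?_) l) l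
  · simpa [addPair] using hq'
  · simpa [addPair] using hq'
  · simpa [addPair] using hk l

theorem legs_mem_region {ρ Λ : ℝ} (hρ : 2 ≤ ρ) (hΛ : 0 ≤ Λ) {n : ℕ} {k : Momenta n}
    (hk : k ∈ region ρ n Λ) {I : Finset (Fin n)} (hI : ‖∑ i ∈ I, k.1 i‖ ≤ 2 * Λ) :
    legs I k ∈ region ρ (I.card + 1) Λ := by
  have hq' : ‖∑ i ∈ I, k.1 i‖ ≤ ρ * Λ := hI.trans (mul_le_mul_of_nonneg_right hρ hΛ)
  intro l
  refine Fin.lastCases ?_ (fun l => ?_) l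
  · simpa [legs] using hq'
  · simpa [legs] using hk _

theorem sum_compl_eq_neg {n : ℕ} (I : Finset (Fin n)) (k : Momenta n) :
    ∑ i ∈ Iᶜ, k.1 i = -∑ i ∈ I, k.1 i := by
  have h : ∑ i, k.1 i = 0 := k.2
  rw [← Finset.sum_compl_add_sum I] at h
  exact eq_neg_of_add_eq_zero_left h

end Momenta

/-! ### Integration of the flow by power counting -/

section FlowStep

/-- `1 + ln (Λ₀ / Λ_R)`. -/
noncomputable def logFactor (Λ_R Λ₀ : ℝ) : ℝ := 1 + Real.log (Λ₀ / Λ_R)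

theorem one_le_logFactor {Λ_R Λ₀ : ℝ} (hR : 0 < Λ_R) (h : Λ_R ≤ Λ₀) : 1 ≤ logFactor Λ_R Λ₀ :=
  le_add_of_nonneg_right (Real.log_nonneg ((one_le_div hR).2 h))

theorem pow_mul_le_iff {Λ : ℝ} (hΛ : 0 < Λ) (p : ℕ) (m : ℤ) (x M : ℝ) :
    Λ ^ p * x ≤ M * Λ ^ m ↔ x ≤ M * Λ ^ (m - p) := by
  rw [zpow_sub₀ hΛ.ne', zpow_natCast, ← mul_div_assoc, le_div_iff₀ (by positivity), mul_comm x]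

theorem zpow_le_zpow_left_of_nonpos {a b : ℝ} (ha : 0 < a) (hab : a ≤ b) {e : ℤ} (he : e ≤ 0) :
    b ^ e ≤ a ^ e := by
  obtain ⟨m, rfl⟩ : ∃ m : ℕ, e = -(m : ℤ) := ⟨e.natAbs, by omega⟩
  rw [zpow_neg, zpow_neg, zpow_natCast, zpow_natCast]
  gcongr

/-- Comparison with the primitive `C ln x` of `C / x`; derivatives from the right suffice, so
one-sided differentiability at the endpoints is no obstacle. -/
theorem abs_sub_le_mul_log {f : ℝ → ℝ} {a b C : ℝ} (ha : 0 < a) (hab : a ≤ b)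
    (h : ∀ x ∈ Set.Icc a b, ∃ r, HasDerivWithinAt f r (Set.Icc a b) x ∧ |r| ≤ C * x⁻¹) :
    |f b - f a| ≤ C * Real.log (b / a) := by
  choose! r hr using h
  have hd : ∀ x ∈ Set.Ico a b, HasDerivWithinAt (fun x => f x - f a) (r x) (Set.Ici x) x :=
    fun x hx => ((hr x ⟨hx.1, hx.2.le⟩).1.sub_const (f a)).mono_of_mem_nhdsWithin
      (Icc_mem_nhdsGE_of_mem hx)
  have hB : ∀ x ∈ Set.Icc a b, HasDerivAt (fun x => C * (Real.log x - Real.log a)) (C * x⁻¹) x :=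
    fun x hx => ((Real.hasDerivAt_log (ha.trans_le hx.1).ne').sub_const _).const_mul C
  have := image_norm_le_of_norm_deriv_right_le_deriv_boundary' (f := fun x => f x - f a)
    (fun x hx => ((hr x hx).1.sub_const (f a)).continuousWithinAt) hd
    (B := fun x => C * (Real.log x - Real.log a)) (B' := fun x => C * x⁻¹) (by simp)
    (fun x hx => (hB x hx).continuousAt.continuousWithinAt)
    (fun x hx => (hB x ⟨hx.1, hx.2.le⟩).hasDerivWithinAt)
    (fun x hx => (hr x ⟨hx.1, hx.2.le⟩).2) (Set.right_mem_Icc.2 hab)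
  rwa [Real.norm_eq_abs, ← Real.log_div (ha.trans_le hab).ne' ha.ne'] at this

theorem log_le_logFactor {Λ_R Λ₀ a b : ℝ} (hR : 0 < Λ_R) (ha : Λ_R ≤ a) (hab : a ≤ b)
    (hb : b ≤ Λ₀) : 1 + Real.log (b / a) ≤ logFactor Λ_R Λ₀ := by
  have h0 : 0 < a := hR.trans_le ha
  have h1 : 0 < b := h0.trans_le hab
  have h2 : 0 ≤ Λ₀ := h1.le.trans hb
  unfold logFactor
  gcongr

/-- Integration of a flow whose right-hand side has the dimension `σ - 1 - n`: down from the cutoff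
for `n + p ≥ 5`, up from the renormalization scale at zero momentum for `n + p ≤ 4`, followed by
a Taylor expansion around zero momentum. -/
theorem scaledLE_of_flow {n P : ℕ} (hn : 1 ≤ n) (hP : 5 ≤ P) {ρ : ℝ} (hρ : 0 ≤ ρ) {Λ_R Λ₀ : ℝ}
    (hR : 0 < Λ_R) {G : ℝ → Momenta n → ℝ}
    (hG : ∀ Λ ∈ Set.Icc Λ_R Λ₀, ContDiff ℝ ∞ (G Λ)) {σ : ℤ} (hσ : 4 ≤ σ) (hσ' : σ ≤ 5) {M : ℝ}
    (hM : 0 ≤ M)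
    (hflow : ∀ p ≤ P, ∀ a : Fin p → Fin n × Fin n × Fin 4, ∀ Λ ∈ Set.Icc Λ_R Λ₀,
      ∀ k ∈ region ρ n Λ, ∃ r, HasDerivWithinAt (fun s => momDeriv a (G s) k) r
        (Set.Icc Λ_R Λ₀) Λ ∧ Λ ^ p * |r| ≤ M * Λ ^ (σ - 1 - n))
    (hbare : ∀ p ≤ P, 5 ≤ n + p → ∀ a : Fin p → Fin n × Fin n × Fin 4, ∀ k ∈ region ρ n Λ₀,
      Λ₀ ^ p * |momDeriv a (G Λ₀) k| ≤ M * Λ₀ ^ (σ - n))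
    (hren : ∀ p, n + p ≤ 4 → ∀ a : Fin p → Fin n × Fin n × Fin 4,
      Λ_R ^ p * |momDeriv a (G Λ_R) 0| ≤ M * Λ_R ^ (σ - n)) :
    ∀ Λ ∈ Set.Icc Λ_R Λ₀, ∀ k ∈ region ρ n Λ, ScaledLE P Λ (G Λ) k
      ((4 * n) ^ P * (1 + ρ) ^ 5 * (M * logFactor Λ_R Λ₀) * Λ ^ (σ - n)) := by
  have hn' : (1 : ℝ) ≤ 4 * n := by
    have : (1 : ℝ) ≤ n := by exact_mod_cast hn
    linarith
  have hbound : ∀ p ≤ P, ∀ a : Fin p → Fin n × Fin n × Fin 4, ∀ Λ ∈ Set.Icc Λ_R Λ₀,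
      ∀ k ∈ region ρ n Λ, (5 ≤ n + p ∨ k = 0) →
      |momDeriv a (G Λ) k| ≤ M * Λ ^ (σ - n - p) * logFactor Λ_R Λ₀ := by
    intro p hp a Λ hΛ k hk hcase
    have hΛ0 : 0 < Λ := hR.trans_le hΛ.1
    have hr : ∀ s ∈ Set.Icc Λ_R Λ₀, k ∈ region ρ n s → s ^ (σ - n - p) ≤ Λ ^ (σ - n - p) →
        ∃ r, HasDerivWithinAt (fun s => momDeriv a (G s) k) r (Set.Icc Λ_R Λ₀) s ∧
          |r| ≤ M * Λ ^ (σ - n - p) * s⁻¹ := by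
      intro s hs hks hle
      have hs0 : 0 < s := hR.trans_le hs.1
      obtain ⟨r, hd, hr⟩ := hflow p hp a s hs k hks
      refine ⟨r, hd, ((pow_mul_le_iff hs0 _ _ _ _).1 hr).trans ?_⟩
      rw [show σ - 1 - n - p = (σ - n - p) + (-1) by ring, zpow_add₀ hs0.ne', zpow_neg_one,
        ← mul_assoc]
      gcongr
    have hA : 0 ≤ M * Λ ^ (σ - n - p) := by positivity
    by_cases hnp : 5 ≤ n + p
    -- Irrelevant case: since `σ ≤ 5` the exponent is nonpositive, so the power is largest at the
    -- lower end `Λ`. The momentum `k` stays admissible because the regions grow with the scale.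
    · have hmono : ∀ s, Λ ≤ s → s ^ (σ - n - p) ≤ Λ ^ (σ - n - p) := fun s hs =>
        zpow_le_zpow_left_of_nonpos hΛ0 hs (by omega)
      have h1 := abs_sub_le_mul_log (f := fun s => momDeriv a (G s) k) hΛ0 hΛ.2 fun s hs => by
        obtain ⟨r, hd, hr⟩ := hr s ⟨hΛ.1.trans hs.1, hs.2⟩ (region_mono hρ n hs.1 hk)
          (hmono s hs.1)
        exact ⟨r, hd.mono (Set.Icc_subset_Icc_left hΛ.1), hr⟩
      have h2 := (pow_mul_le_iff (hΛ0.trans_le hΛ.2) _ _ _ _).1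
        (hbare p hp hnp a k (region_mono hρ n hΛ.2 hk))
      have h3 : M * Λ₀ ^ (σ - n - p) ≤ M * Λ ^ (σ - n - p) :=
        mul_le_mul_of_nonneg_left (hmono Λ₀ hΛ.2) hM
      have h4 := mul_le_mul_of_nonneg_left (log_le_logFactor hR hΛ.1 hΛ.2 le_rfl) hA
      have h5 := abs_sub_abs_le_abs_sub (momDeriv a (G Λ) k) (momDeriv a (G Λ₀) k)
      rw [abs_sub_comm] at h5
      linarith
    -- Relevant case: since `σ ≥ 4` the exponent is nonnegative, so the power is largest at the
    -- upper end `Λ`. A general `k` may leave the smaller regions on the way from `Λ_R`; zero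
    -- momentum does not.
    · obtain rfl : k = 0 := hcase.resolve_left hnp
      have hmono : ∀ s, Λ_R ≤ s → s ≤ Λ → s ^ (σ - n - p) ≤ Λ ^ (σ - n - p) := fun s hs hs' =>
        zpow_le_zpow_left₀ (by omega) (hR.le.trans hs) hs'
      have h1 := abs_sub_le_mul_log (f := fun s => momDeriv a (G s) 0) hR hΛ.1 fun s hs => by
        obtain ⟨r, hd, hr⟩ := hr s ⟨hs.1, hs.2.trans hΛ.2⟩
          (zero_mem_region hρ (hR.le.trans hs.1) n) (hmono s hs.1 hs.2)
        exact ⟨r, hd.mono (Set.Icc_subset_Icc_right hΛ.2), hr⟩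
      have h2 := (pow_mul_le_iff hR _ _ _ _).1 (hren p (by omega) a)
      have h3 : M * Λ_R ^ (σ - n - p) ≤ M * Λ ^ (σ - n - p) :=
        mul_le_mul_of_nonneg_left (hmono Λ_R le_rfl hΛ.1) hM
      have h4 := mul_le_mul_of_nonneg_left (log_le_logFactor hR le_rfl hΛ.1 hΛ.2) hA
      have h5 := abs_sub_abs_le_abs_sub (momDeriv a (G Λ) 0) (momDeriv a (G Λ_R) 0)
      linarith
  intro Λ hΛ
  have hΛ0 : 0 < Λ := hR.trans_le hΛ.1
  have hl : 0 ≤ logFactor Λ_R Λ₀ :=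
    zero_le_one.trans (one_le_logFactor hR (hΛ.1.trans hΛ.2))
  have hnorm : ∀ p ≤ P, ∀ k ∈ region ρ n Λ, (5 ≤ n + p ∨ k = 0) →
      ‖iteratedFDeriv ℝ p (G Λ) k‖ ≤
        (4 * n) ^ P * (M * Λ ^ (σ - n - p) * logFactor Λ_R Λ₀) := by
    intro p hp k hk hcase
    refine (norm_iteratedFDeriv_le_of_momDeriv hn fun a => hbound p hp a Λ hΛ k hk hcase).trans ?_
    gcongr
  -- Descent in `p`: the value at zero plus the mean value inequality with the bound of order `p +
  -- 1`. As `‖k‖ ≤ ρ Λ`, each step costs a factor `1 + ρ`, and five steps reach every `p`; `5 ≤ P`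
  -- keeps `p + 1` in range.
  have hmain : ∀ j p : ℕ, p ≤ P → 5 ≤ n + p + j → ∀ k ∈ region ρ n Λ,
      ‖iteratedFDeriv ℝ p (G Λ) k‖ ≤
        (1 + ρ) ^ j * ((4 * n) ^ P * (M * Λ ^ (σ - n - p) * logFactor Λ_R Λ₀)) := by
    intro j
    induction j with
    | zero =>
      intro p hp hnp k hk
      rw [pow_zero, one_mul]
      exact hnorm p hp k hk (Or.inl hnp)
    | succ j ih =>
      intro p hp hnp k hk
      have hX : 0 ≤ (4 * n : ℝ) ^ P * (M * Λ ^ (σ - n - p) * logFactor Λ_R Λ₀) := by positivity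
      by_cases h5 : 5 ≤ n + p
      · refine (hnorm p hp k hk (Or.inl h5)).trans (le_mul_of_one_le_left hX ?_)
        exact one_le_pow₀ (by linarith)
      · have h0 := zero_mem_region hρ hΛ0.le n (Λ := Λ)
        have h1 := (convex_region ρ n Λ).norm_image_sub_le_of_norm_fderiv_le
          (f := iteratedFDeriv ℝ p (G Λ)) (fun x _ => ((hG Λ hΛ).differentiable_iteratedFDeriv
            (m := p) (by exact_mod_cast ENat.natCast_lt_top p)).differentiableAt)
          (fun x hx => by
            rw [norm_fderiv_iteratedFDeriv]
            exact ih (p + 1) (by omega) (by omega) x hx) h0 hk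
        rw [sub_zero] at h1
        have h2 := hnorm p hp 0 h0 (Or.inr rfl)
        have h3 := norm_le_of_mem_region hρ hΛ0.le hk
        have h4 := norm_sub_norm_le (iteratedFDeriv ℝ p (G Λ) k) (iteratedFDeriv ℝ p (G Λ) 0)
        have h6 : Λ ^ (σ - n - ((p + 1 : ℕ) : ℤ)) * Λ = Λ ^ (σ - n - p) := by
          rw [← zpow_add_one₀ hΛ0.ne']
          congr 1
          push_cast
          ring
        have h7 : (1 + ρ) ^ j * ((4 * n) ^ P * (M * Λ ^ (σ - n - ((p + 1 : ℕ) : ℤ)) *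
            logFactor Λ_R Λ₀)) * ‖k‖ ≤ ρ * ((1 + ρ) ^ j * ((4 * n) ^ P *
              (M * Λ ^ (σ - n - p) * logFactor Λ_R Λ₀))) := by
          refine (mul_le_mul_of_nonneg_left h3 (by positivity)).trans (le_of_eq ?_)
          rw [← h6]
          ring
        have h8 := le_mul_of_one_le_left hX (one_le_pow₀ (n := j) (show 1 ≤ 1 + ρ by linarith))
        rw [pow_succ']
        linarith
  intro k hk p hp
  rw [pow_mul_le_iff hΛ0]
  refine (hmain 5 p hp (by omega) k hk).trans (le_of_eq ?_)
  ring

end FlowStep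

/-! ### Flow of linear combinations of solutions -/

section Combination

variable {K : ℝ → ℝ}

/-- A linear combination of systems of vertex functions. -/
noncomputable def comb {ι : Type*} [Fintype ι] (c : ι → ℝ) (L : ι → VertexSystem) : VertexSystem :=
  fun r₁ r₂ n Λ k => ∑ j, c j * L j r₁ r₂ n Λ k

/-- All vertex functions of `L` at scale `Λ` are smooth in the momenta. -/
def SmoothAt (L : VertexSystem) (Λ : ℝ) : Prop := ∀ r₁ r₂ n, 1 ≤ n → ContDiff ℝ ∞ (L r₁ r₂ n Λ)

theorem SmoothAt.comb {ι : Type*} [Fintype ι] {c : ι → ℝ} {L : ι → VertexSystem} {Λ : ℝ}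
    (h : ∀ j, SmoothAt (L j) Λ) : SmoothAt (comb c L) Λ := fun r₁ r₂ n hn =>
  ContDiff.sum fun j _ => contDiff_const.mul (h j r₁ r₂ n hn)

/-- The summand of the tree term with legs `I` on the first vertex. -/
noncomputable def treeSummand (K : ℝ → ℝ) (B Λ : ℝ) {n : ℕ} (I : Finset (Fin n))
    (f : Momenta (I.card + 1) → ℝ) (g : Momenta (Iᶜ.card + 1) → ℝ) (k : Momenta n) : ℝ :=
  propagatorDot K B Λ (∑ i ∈ I, k.1 i) * (f (legs I k) * g (legs Iᶜ k))

theorem IsCutoff.contDiff_treeSummand (hK : IsCutoff K) {B Λ : ℝ} (hΛ : 0 < Λ) (hB : |B| ≤ Λ ^ 2)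
    {n : ℕ} {I : Finset (Fin n)} {f : Momenta (I.card + 1) → ℝ} {g : Momenta (Iᶜ.card + 1) → ℝ}
    (hf : ContDiff ℝ ∞ f) (hg : ContDiff ℝ ∞ g) : ContDiff ℝ ∞ (treeSummand K B Λ I f g) :=
  ((hK.contDiff_propagatorDot hΛ hB).comp (totalL I).contDiff).mul
    ((hf.comp (legsL I).contDiff).mul (hg.comp (legsL Iᶜ).contDiff))

theorem IsCutoff.contDiff_treeTerm (hK : IsCutoff K) {B Λ : ℝ} (hΛ : 0 < Λ) (hB : |B| ≤ Λ ^ 2)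
    {L : VertexSystem} (hL : SmoothAt L Λ) (r₁ r₂ n : ℕ) :
    ContDiff ℝ ∞ (treeTerm K B L r₁ r₂ n Λ) :=
  ContDiff.sum fun _ _ => ContDiff.sum fun _ _ => ContDiff.sum fun _ _ =>
    hK.contDiff_treeSummand hΛ hB (hL _ _ _ (Nat.le_add_left 1 _)) (hL _ _ _ (Nat.le_add_left 1 _))

theorem IsCutoff.integrable_loop (hK : IsCutoff K) {B Λ : ℝ} (hΛ : 0 < Λ) (hB : |B| ≤ Λ ^ 2)
    {n p : ℕ} (a : Fin p → Fin n × Fin n × Fin 4) {f : Momenta (n + 2) → ℝ}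
    (hf : ContDiff ℝ ∞ f) (k : Momenta n) :
    MeasureTheory.Integrable fun q : Momentum => (1 / (2 * Real.pi) ^ 4) *
      (momDeriv a (fun k' => f (addPair k' q)) k * propagatorDot K B Λ q) := by
  refine Continuous.integrable_of_hasCompactSupport (continuous_const.mul
    ((continuous_momDeriv_comp_addPair a hf k).mul
      (hK.contDiff_propagatorDot hΛ hB).continuous)) ?_
  refine HasCompactSupport.intro (isCompact_closedBall (0 : Momentum) (2 * Λ)) fun q hq => ?_
  rw [hK.propagatorDot_eq_zero hΛ (by simpa using hq), mul_zero, mul_zero]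

/-- The loop term is linear, so it becomes that of the combination; the tree term is quadratic and
must stay a combination of tree terms. The term with `A` drops out because `Δ̇_Λ(0) = 0`. -/
theorem IsCutoff.hasDerivWithinAt_comb (hK : IsCutoff K) {A B Λ_R Λ₀ : ℝ} (hR : 0 < Λ_R)
    (hB : |B| ≤ Λ_R ^ 2) {ι : Type*} [Fintype ι] (c : ι → ℝ) {L : ι → VertexSystem}
    (hL : ∀ j, IsPerturbativeSolution K A B Λ_R Λ₀ (L j)) (r₁ r₂ : ℕ) {n p : ℕ} (hn : 1 ≤ n)
    (a : Fin p → Fin n × Fin n × Fin 4) (k : Momenta n) {Λ : ℝ} (hΛ : Λ ∈ Set.Icc Λ_R Λ₀) :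
    HasDerivWithinAt (fun s => momDeriv a (comb c L r₁ r₂ n s) k)
      (-(1 / 2) * momDeriv a (fun k => ∑ j, c j * treeTerm K B (L j) r₁ r₂ n Λ k) k -
        (1 / 2) * ∫ q : Momentum, (1 / (2 * Real.pi) ^ 4) *
          (momDeriv a (fun k' => comb c L r₁ r₂ (n + 2) Λ (addPair k' q)) k *
            propagatorDot K B Λ q)) (Set.Icc Λ_R Λ₀) Λ := by
  have hΛ0 : 0 < Λ := hR.trans_le hΛ.1
  have hB' : |B| ≤ Λ ^ 2 := hB.trans (pow_le_pow_left₀ hR.le hΛ.1 2)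
  have hs : ∀ s ∈ Set.Icc Λ_R Λ₀, momDeriv a (comb c L r₁ r₂ n s) k =
      ∑ j, c j * momDeriv a (L j r₁ r₂ n s) k := by
    intro s hs
    unfold comb
    rw [momDeriv_sum a Finset.univ
      (fun j _ => contDiff_const.mul ((hL j).smooth r₁ r₂ n hn s hs))]
    exact Finset.sum_congr rfl fun j _ => momDeriv_const_mul a ((hL j).smooth r₁ r₂ n hn s hs) _ _
  have hsm : ∀ j, SmoothAt (L j) Λ := fun j r₁ r₂ n hn => (hL j).smooth r₁ r₂ n hn Λ hΛ
  have hd := (HasDerivWithinAt.fun_sum (u := Finset.univ) fun j _ =>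
    ((hL j).flow r₁ r₂ n p hn a k Λ hΛ).const_mul (c j)).congr hs (hs Λ hΛ)
  convert! hd using 1
  have h1 : momDeriv a (fun k => ∑ j, c j * treeTerm K B (L j) r₁ r₂ n Λ k) k =
      ∑ j, c j * momDeriv a (treeTerm K B (L j) r₁ r₂ n Λ) k := by
    have ht := fun j => hK.contDiff_treeTerm hΛ0 hB' (hsm j) r₁ r₂ n
    rw [momDeriv_sum a Finset.univ (fun j _ => contDiff_const.mul (ht j))]
    exact Finset.sum_congr rfl fun j _ => momDeriv_const_mul a (ht j) _ _
  have h2 : ∀ q : Momentum, momDeriv a (fun k' => comb c L r₁ r₂ (n + 2) Λ (addPair k' q)) k =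
      ∑ j, c j * momDeriv a (fun k' => L j r₁ r₂ (n + 2) Λ (addPair k' q)) k := by
    intro q
    have ht := fun j => contDiff_comp_addPair (hsm j r₁ r₂ (n + 2) (by omega)) q
    unfold comb
    rw [momDeriv_sum a Finset.univ (fun j _ => contDiff_const.mul (ht j))]
    exact Finset.sum_congr rfl fun j _ => momDeriv_const_mul a (ht j) _ _
  have h3 : (∫ q : Momentum, (1 / (2 * Real.pi) ^ 4) *
      (momDeriv a (fun k' => comb c L r₁ r₂ (n + 2) Λ (addPair k' q)) k *
        propagatorDot K B Λ q)) = ∑ j, c j * ∫ q : Momentum, (1 / (2 * Real.pi) ^ 4) *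
      (momDeriv a (fun k' => L j r₁ r₂ (n + 2) Λ (addPair k' q)) k *
        propagatorDot K B Λ q) := by
    simp_rw [← MeasureTheory.integral_const_mul]
    rw [← MeasureTheory.integral_finsetSum _ fun j _ =>
      (hK.integrable_loop hΛ0 hB' a (hsm j r₁ r₂ (n + 2) (by omega)) k).const_mul (c j)]
    refine MeasureTheory.integral_congr_ae (Eventually.of_forall fun q => ?_)
    simp only [h2, Finset.sum_mul, Finset.mul_sum]
    exact Finset.sum_congr rfl fun j _ => by ring
  rw [h1, h3, Finset.mul_sum, Finset.mul_sum, ← Finset.sum_sub_distrib]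
  refine Finset.sum_congr rfl fun j _ => ?_
  unfold flowRHS
  rw [hK.propagatorDot_zero hΛ0]
  ring_nf

/-- The integral extends over a ball of volume proportional to `Λ⁴` and `Δ̇_Λ` contributes `Λ⁻³`, so
the dimension `σ - (n + 2)` rises by one to `σ - 1 - n`. -/
theorem IsCutoff.exists_loop_bound (hK : IsCutoff K) (n P : ℕ) :
    ∃ C, 0 ≤ C ∧ ∀ {B Λ ρ : ℝ}, 0 < Λ → |B| ≤ Λ ^ 2 → 2 ≤ ρ → ∀ {f : Momenta (n + 2) → ℝ},
      ContDiff ℝ ∞ f → ∀ {M : ℝ} {σ : ℤ},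
      (∀ k ∈ region ρ (n + 2) Λ, ScaledLE P Λ f k (M * Λ ^ (σ - (n + 2)))) →
      ∀ p ≤ P, ∀ (a : Fin p → Fin n × Fin n × Fin 4), ∀ k ∈ region ρ n Λ,
        Λ ^ p * |∫ q : Momentum, (1 / (2 * Real.pi) ^ 4) *
          (momDeriv a (fun k' => f (addPair k' q)) k * propagatorDot K B Λ q)| ≤
            C * (M * Λ ^ (σ - 1 - n)) := by
  obtain ⟨C, hC0, hC⟩ := hK.exists_scaledLE_propagatorDot 0
  set v := MeasureTheory.volume.real (Metric.ball (0 : Momentum) 1) with hv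
  set d := max 1 (2 * ‖padL n‖) with hd
  have hd1 : 1 ≤ d := le_max_left _ _
  have hv0 : 0 ≤ v := MeasureTheory.measureReal_nonneg
  refine ⟨d ^ P * C * 16 * v, by positivity, ?_⟩
  intro B Λ ρ hΛ hB hρ f hf M σ hM p hp a k hk
  have hM0 : 0 ≤ M * Λ ^ (σ - (n + 2)) :=
    (hM 0 (zero_mem_region (by linarith) hΛ.le _)).nonneg
  have hpi : 1 / (2 * Real.pi) ^ 4 ≤ 1 := by
    rw [div_le_one (by positivity)]
    exact one_le_pow₀ (by linarith [Real.pi_gt_three])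
  have hpt : ∀ q ∈ Metric.closedBall (0 : Momentum) (2 * Λ),
      ‖(1 / (2 * Real.pi) ^ 4) * (momDeriv a (fun k' => f (addPair k' q)) k *
        propagatorDot K B Λ q)‖ ≤
        d ^ P * (M * Λ ^ (σ - (n + 2)) / Λ ^ p) * (C * (Λ ^ 3)⁻¹) := by
    intro q hq
    have h1 := hM _ (addPair_mem_region hρ hΛ.le hk (by simpa using hq)) p hp
    have h2 := abs_momDeriv_comp_addPair_le a hf q k
    have h3 := hC B Λ hΛ hB q 0 le_rfl
    rw [pow_zero, one_mul, norm_iteratedFDeriv_zero] at h3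
    rw [norm_mul, norm_mul, Real.norm_of_nonneg (by positivity)]
    refine (mul_le_of_le_one_left (by positivity) hpi).trans ?_
    refine mul_le_mul (h2.trans ?_) h3 (norm_nonneg _) (by positivity)
    refine mul_le_mul ((pow_le_pow_left₀ (by positivity) (le_max_right _ _) p).trans
      (pow_le_pow_right₀ hd1 hp)) ?_ (norm_nonneg _) (by positivity)
    rw [le_div_iff₀ (by positivity), mul_comm]
    exact h1
  have hset : (∫ q : Momentum, (1 / (2 * Real.pi) ^ 4) *
      (momDeriv a (fun k' => f (addPair k' q)) k * propagatorDot K B Λ q)) =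
      ∫ q in Metric.closedBall (0 : Momentum) (2 * Λ), (1 / (2 * Real.pi) ^ 4) *
      (momDeriv a (fun k' => f (addPair k' q)) k * propagatorDot K B Λ q) := by
    refine (MeasureTheory.setIntegral_eq_integral_of_forall_compl_eq_zero fun q hq => ?_).symm
    rw [hK.propagatorDot_eq_zero hΛ (by simpa using hq), mul_zero, mul_zero]
  have hint := MeasureTheory.norm_setIntegral_le_of_norm_le_const
    (μ := MeasureTheory.volume) (isCompact_closedBall (0 : Momentum) (2 * Λ)).measure_lt_top hpt
  rw [MeasureTheory.Measure.addHaar_real_closedBall _ _ (by positivity), ← hv] at hint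
  simp only [finrank_euclideanSpace, Fintype.card_fin] at hint
  rw [hset]
  refine (mul_le_mul_of_nonneg_left hint (by positivity)).trans (le_of_eq ?_)
  rw [show σ - 1 - n = σ - (n + 2) + 1 by ring, zpow_add_one₀ hΛ.ne']
  field_simp
  ring

/-- The flow of a linear combination of solutions: bounds on its tree term and on its vertex
function with two more legs, together with the boundary data, bound the vertex function. -/
theorem IsCutoff.exists_comb_bound (hK : IsCutoff K) {n P : ℕ} (hn : 1 ≤ n) (hP : 5 ≤ P) {ρ : ℝ}
    (hρ : 2 ≤ ρ) :
    ∃ C, 0 ≤ C ∧ ∀ {A B Λ_R Λ₀ : ℝ}, 0 < Λ_R → |B| ≤ Λ_R ^ 2 →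
      ∀ {ι : Type} [Fintype ι] {c : ι → ℝ} {L : ι → VertexSystem},
      (∀ j, IsPerturbativeSolution K A B Λ_R Λ₀ (L j)) →
      ∀ {r₁ r₂ : ℕ} {σ : ℤ}, 4 ≤ σ → σ ≤ 5 → ∀ {M : ℝ}, 0 ≤ M →
      (∀ Λ ∈ Set.Icc Λ_R Λ₀, ∀ k ∈ region ρ n Λ,
        ScaledLE P Λ (fun k => ∑ j, c j * treeTerm K B (L j) r₁ r₂ n Λ k) k
          (M * Λ ^ (σ - 1 - n))) →
      (∀ Λ ∈ Set.Icc Λ_R Λ₀, ∀ k ∈ region ρ (n + 2) Λ,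
        ScaledLE P Λ (comb c L r₁ r₂ (n + 2) Λ) k (M * Λ ^ (σ - (n + 2)))) →
      (∀ p ≤ P, 5 ≤ n + p → ∀ a : Fin p → Fin n × Fin n × Fin 4, ∀ k ∈ region ρ n Λ₀,
        Λ₀ ^ p * |momDeriv a (comb c L r₁ r₂ n Λ₀) k| ≤ M * Λ₀ ^ (σ - n)) →
      (∀ p, n + p ≤ 4 → ∀ a : Fin p → Fin n × Fin n × Fin 4,
        Λ_R ^ p * |momDeriv a (comb c L r₁ r₂ n Λ_R) 0| ≤ M * Λ_R ^ (σ - n)) →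
      ∀ Λ ∈ Set.Icc Λ_R Λ₀, ∀ k ∈ region ρ n Λ, ScaledLE P Λ (comb c L r₁ r₂ n Λ) k
        (C * (M * logFactor Λ_R Λ₀) * Λ ^ (σ - n)) := by
  obtain ⟨C, hC0, hC⟩ := hK.exists_loop_bound n P
  have hρ0 : 0 ≤ ρ := by linarith
  -- In the last factor, `1` serves the boundary data, `2 ^ P` the tree term (each direction has
  -- norm at most `2`) and `C` the loop term.
  refine ⟨(4 * n) ^ P * (1 + ρ) ^ 5 * (1 + 2 ^ P + C), by positivity, ?_⟩
  intro A B Λ_R Λ₀ hR hB ι _ c L hL r₁ r₂ σ hσ hσ' M hM htree hloop hbare hren Λ hΛ k hk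
  have hle : ∀ x : ℝ, 0 ≤ x → M * x ≤ (1 + 2 ^ P + C) * M * x := by
    intro x hx
    have : M ≤ (1 + 2 ^ P + C) * M :=
      le_mul_of_one_le_left hM (by linarith [pow_pos (zero_lt_two (α := ℝ)) P])
    exact mul_le_mul_of_nonneg_right this hx
  have h := scaledLE_of_flow hn hP hρ0 hR (G := fun Λ => comb c L r₁ r₂ n Λ)
    (fun Λ hΛ => SmoothAt.comb (fun j r₁ r₂ n hn => (hL j).smooth r₁ r₂ n hn Λ hΛ) r₁ r₂ n hn)
    hσ hσ' (M := (1 + 2 ^ P + C) * M) (by positivity) ?_ ?_ ?_ Λ hΛ k hk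
  · refine h.mono (le_of_eq ?_)
    ring
  · intro p hp a Λ hΛ k hk
    have hΛ0 : 0 < Λ := hR.trans_le hΛ.1
    refine ⟨_, hK.hasDerivWithinAt_comb hR hB c hL r₁ r₂ hn a k hΛ, ?_⟩
    have h1 := hC hΛ0 (hB.trans (pow_le_pow_left₀ hR.le hΛ.1 2)) hρ
      (SmoothAt.comb (c := c) (fun j r₁ r₂ n hn => (hL j).smooth r₁ r₂ n hn Λ hΛ) r₁ r₂ (n + 2)
        (by omega)) (hloop Λ hΛ) p hp a k hk
    have h2 : Λ ^ p * |momDeriv a (fun k => ∑ j, c j * treeTerm K B (L j) r₁ r₂ n Λ k) k| ≤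
        2 ^ P * (M * Λ ^ (σ - 1 - n)) := by
      have h3 := htree Λ hΛ k hk p hp
      calc Λ ^ p * |momDeriv a (fun k => ∑ j, c j * treeTerm K B (L j) r₁ r₂ n Λ k) k|
          ≤ Λ ^ p * (2 ^ p * ‖iteratedFDeriv ℝ p
              (fun k => ∑ j, c j * treeTerm K B (L j) r₁ r₂ n Λ k) k‖) := by
            gcongr; exact abs_momDeriv_le _ _ _
        _ = 2 ^ p * (Λ ^ p * ‖iteratedFDeriv ℝ p
              (fun k => ∑ j, c j * treeTerm K B (L j) r₁ r₂ n Λ k) k‖) := by ring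
        _ ≤ 2 ^ P * (M * Λ ^ (σ - 1 - n)) := by
            gcongr
            norm_num
    have h4 : ∀ x y : ℝ, |-(1 / 2) * x - (1 / 2) * y| ≤ |x| + |y| := fun x y => by
      refine (abs_sub _ _).trans ?_
      rw [abs_mul, abs_mul, abs_neg, abs_of_pos (by norm_num : (0 : ℝ) < 1 / 2)]
      linarith [abs_nonneg x, abs_nonneg y]
    refine (mul_le_mul_of_nonneg_left (h4 _ _) (by positivity)).trans ?_
    have h5 : 0 ≤ M * Λ ^ (σ - 1 - n) := by positivity
    linarith
  · intro p hp hnp a k hk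
    have h0 : 0 < Λ₀ := hR.trans_le (hΛ.1.trans hΛ.2)
    exact (hbare p hp hnp a k hk).trans (hle _ (by positivity))
  · intro p hnp a
    exact (hren p hnp a).trans (hle _ (by positivity))

end Combination

/-! ### Power counting for the tree term -/

section Tree

variable {K : ℝ → ℝ}

/-- If `‖K_I‖ ≤ 2Λ`, both vertices are evaluated inside their regions and the product rule applies.
Otherwise the propagator vanishes in a neighbourhood of `k`, and so do all derivatives of the
summand. -/
theorem IsCutoff.exists_treeSummand_bound (hK : IsCutoff K) (n P : ℕ) {ρ : ℝ} (hρ : 2 ≤ ρ) :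
    ∃ C, 0 ≤ C ∧ ∀ {B Λ : ℝ}, 0 < Λ → |B| ≤ Λ ^ 2 → ∀ {I : Finset (Fin n)}
      {f : Momenta (I.card + 1) → ℝ} {g : Momenta (Iᶜ.card + 1) → ℝ}, ContDiff ℝ ∞ f →
      ContDiff ℝ ∞ g → ∀ {X Y : ℝ}, (∀ k ∈ region ρ (I.card + 1) Λ, ScaledLE P Λ f k X) →
      (∀ k ∈ region ρ (Iᶜ.card + 1) Λ, ScaledLE P Λ g k Y) → ∀ k ∈ region ρ n Λ,
        ScaledLE P Λ (treeSummand K B Λ I f g) k (C * ((Λ ^ 3)⁻¹ * (X * Y))) := by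
  obtain ⟨C, hC0, hC⟩ := hK.exists_scaledLE_propagatorDot P
  set d := 1 + ∑ I : Finset (Fin n), (‖totalL I‖ + ‖legsL I‖) with hd
  have hsum : ∀ I : Finset (Fin n), ‖totalL I‖ + ‖legsL I‖ ≤
      ∑ I : Finset (Fin n), (‖totalL I‖ + ‖legsL I‖) := fun I =>
    Finset.single_le_sum (f := fun I : Finset (Fin n) => ‖totalL I‖ + ‖legsL I‖)
      (fun I _ => by positivity) (Finset.mem_univ I)
  have hd1 : 1 ≤ d := le_add_of_nonneg_right (Finset.sum_nonneg fun I _ => by positivity)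
  have hdt : ∀ I : Finset (Fin n), ‖totalL I‖ ≤ d := fun I => by
    linarith [hsum I, norm_nonneg (legsL I)]
  have hdl : ∀ I : Finset (Fin n), ‖legsL I‖ ≤ d := fun I => by
    linarith [hsum I, norm_nonneg (totalL I)]
  refine ⟨2 ^ P * (d ^ P * C * (2 ^ P * (d ^ P * d ^ P))), by positivity, ?_⟩
  intro B Λ hΛ hB I f g hf hg X Y hX hY k hk
  have hX0 : 0 ≤ X := (hX 0 (zero_mem_region (by linarith) hΛ.le _)).nonneg
  have hY0 : 0 ≤ Y := (hY 0 (zero_mem_region (by linarith) hΛ.le _)).nonneg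
  rcases le_or_gt ‖totalL I k‖ (2 * Λ) with hI | hI
  · have hI' : ‖∑ i ∈ Iᶜ, k.1 i‖ ≤ 2 * Λ := by
      rw [sum_compl_eq_neg, norm_neg]
      exact hI
    have h1 := (hC B Λ hΛ hB (totalL I k)).comp_linear hΛ.le (totalL I)
      (hK.contDiff_propagatorDot hΛ hB) hd1 (hdt I)
    have h2 := (hX _ (legs_mem_region hρ hΛ.le hk hI)).comp_linear hΛ.le (legsL I) hf hd1 (hdl I)
    have h3 := (hY _ (legs_mem_region hρ hΛ.le hk hI')).comp_linear hΛ.le (legsL Iᶜ) hg hd1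
      (hdl Iᶜ)
    have sf := hf.comp (legsL I).contDiff
    have sg := hg.comp (legsL Iᶜ).contDiff
    have h4 := h1.mul hΛ.le (h2.mul hΛ.le h3 sf sg)
      ((hK.contDiff_propagatorDot hΛ hB).comp (totalL I).contDiff) (sf.mul sg)
    refine ScaledLE.mono h4 (le_of_eq ?_)
    ring
  · refine scaledLE_of_eventuallyEq_zero ?_ (by positivity)
    filter_upwards [(isOpen_lt continuous_const (totalL I).continuous.norm).mem_nhds hI] with y hy
    unfold treeSummand
    rw [← totalL_apply, hK.propagatorDot_eq_zero hΛ hy, zero_mul]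

/-- The tree term, as a bilinear expression in two systems of vertex functions. -/
noncomputable def treeBilin (K : ℝ → ℝ) (B : ℝ) (L L' : VertexSystem) (r₁ r₂ n : ℕ) (Λ : ℝ)
    (k : Momenta n) : ℝ :=
  ∑ I : Finset (Fin n), ∑ s ∈ Finset.HasAntidiagonal.antidiagonal r₁,
    ∑ u ∈ Finset.HasAntidiagonal.antidiagonal r₂,
      treeSummand K B Λ I (L s.1 u.1 (I.card + 1) Λ) (L' s.2 u.2 (Iᶜ.card + 1) Λ) k

theorem treeTerm_eq_treeBilin (K : ℝ → ℝ) (B : ℝ) (L : VertexSystem) (r₁ r₂ n : ℕ) (Λ : ℝ) :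
    treeTerm K B L r₁ r₂ n Λ = treeBilin K B L L r₁ r₂ n Λ := rfl

theorem IsCutoff.contDiff_treeBilin (hK : IsCutoff K) {B Λ : ℝ} (hΛ : 0 < Λ) (hB : |B| ≤ Λ ^ 2)
    {L L' : VertexSystem} (hL : SmoothAt L Λ) (hL' : SmoothAt L' Λ) (r₁ r₂ n : ℕ) :
    ContDiff ℝ ∞ (treeBilin K B L L' r₁ r₂ n Λ) :=
  ContDiff.sum fun _ _ => ContDiff.sum fun _ _ => ContDiff.sum fun _ _ =>
    hK.contDiff_treeSummand hΛ hB (hL _ _ _ (Nat.le_add_left 1 _))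
      (hL' _ _ _ (Nat.le_add_left 1 _))

/-- The vertex functions of order less than `R` are bounded by `β` in units of `Λ` and `Λ_R`, where
the dimension of the `n`-point function is `σ - n`. -/
def OrderLE (P : ℕ) (ρ : ℝ) (R : ℕ) (σ : ℤ) (β Λ_R Λ : ℝ) (L : VertexSystem) : Prop :=
  ∀ r₁ r₂ n, 1 ≤ n → r₁ + r₂ < R → ∀ k ∈ region ρ n Λ,
    ScaledLE P Λ (L r₁ r₂ n Λ) k (β * Λ ^ (σ - n) * (Λ_R ^ r₁)⁻¹)

/-- The vertices have `n + 2` legs in total, whence the dimension `-3 + σ + σ' - (n + 2)`. With `σ'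
= 4` this is `σ - 1 - n`, as the flow for dimension `σ - n` requires. The powers of `Λ_R` multiply
to the one of order `r₁`. -/
theorem IsCutoff.exists_treeBilin_bound (hK : IsCutoff K) (n P R : ℕ) {ρ : ℝ} (hρ : 2 ≤ ρ) :
    ∃ C, 0 ≤ C ∧ ∀ {B Λ Λ_R : ℝ}, 0 < Λ_R → 0 < Λ → |B| ≤ Λ ^ 2 → ∀ {L L' : VertexSystem},
      SmoothAt L Λ → SmoothAt L' Λ → (∀ n, 1 ≤ n → ∀ k, L 0 0 n Λ k = 0) →
      (∀ n, 1 ≤ n → ∀ k, L' 0 0 n Λ k = 0) → ∀ {σ σ' : ℤ} {β β' : ℝ}, 0 ≤ β → 0 ≤ β' →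
      OrderLE P ρ R σ β Λ_R Λ L → OrderLE P ρ R σ' β' Λ_R Λ L' → ∀ r₁ r₂, r₁ + r₂ ≤ R →
      ∀ k ∈ region ρ n Λ, ScaledLE P Λ (treeBilin K B L L' r₁ r₂ n Λ) k
        (C * (β * β' * (Λ_R ^ r₁)⁻¹) * Λ ^ (σ + σ' - 5 - n)) := by
  obtain ⟨C, hC0, hC⟩ := hK.exists_treeSummand_bound n P hρ
  refine ⟨C * (2 ^ n * ((R + 1) * (R + 1))), by positivity, ?_⟩
  intro B Λ Λ_R hR hΛ hB L L' hL hL' hz hz' σ σ' β β' hβ hβ' hLE hLE' r₁ r₂ hr k hk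
  set X := C * (β * β' * (Λ_R ^ r₁)⁻¹ * Λ ^ (σ + σ' - 5 - n)) with hX
  have hX0 : 0 ≤ X := by positivity
  have hterm : ∀ I : Finset (Fin n), ∀ s ∈ Finset.HasAntidiagonal.antidiagonal r₁,
      ∀ u ∈ Finset.HasAntidiagonal.antidiagonal r₂,
      ScaledLE P Λ (treeSummand K B Λ I (L s.1 u.1 (I.card + 1) Λ)
        (L' s.2 u.2 (Iᶜ.card + 1) Λ)) k X := by
    intro I s hs u hu
    have hs' : s.1 + s.2 = r₁ := Finset.HasAntidiagonal.mem_antidiagonal.1 hs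
    have hu' : u.1 + u.2 = r₂ := Finset.HasAntidiagonal.mem_antidiagonal.1 hu
    have sf := hL s.1 u.1 (I.card + 1) (Nat.le_add_left 1 _)
    have sg := hL' s.2 u.2 (Iᶜ.card + 1) (Nat.le_add_left 1 _)
    -- A factor of order at least `R` leaves order zero for the other one, which vanishes; so bounds
    -- on orders below `R` control order `R`.
    by_cases h1 : s.1 + u.1 < R
    · by_cases h2 : s.2 + u.2 < R
      · refine (hC hΛ hB sf sg (fun k hk => hLE _ _ _ (Nat.le_add_left 1 _) h1 k hk)
          (fun k hk => hLE' _ _ _ (Nat.le_add_left 1 _) h2 k hk) k hk).mono (le_of_eq ?_)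
        have hcard : I.card + Iᶜ.card = n := by
          exact (Finset.card_add_card_compl I).trans (Fintype.card_fin n)
        have he : Λ ^ (σ + σ' - 5 - n) = (Λ ^ 3)⁻¹ * (Λ ^ (σ - ((I.card + 1 : ℕ) : ℤ)) *
            Λ ^ (σ' - ((Iᶜ.card + 1 : ℕ) : ℤ))) := by
          rw [← zpow_natCast Λ 3, ← zpow_neg, ← zpow_add₀ hΛ.ne', ← zpow_add₀ hΛ.ne']
          congr 1
          push_cast
          omega
        rw [hX, he, ← hs', pow_add]
        field_simp
      · have h0 : s.1 = 0 ∧ u.1 = 0 := by omega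
        refine scaledLE_of_eventuallyEq_zero (Eventually.of_forall fun y => ?_) hX0
        unfold treeSummand
        rw [h0.1, h0.2, hz _ (Nat.le_add_left 1 _), zero_mul, mul_zero]
    · have h0 : s.2 = 0 ∧ u.2 = 0 := by omega
      refine scaledLE_of_eventuallyEq_zero (Eventually.of_forall fun y => ?_) hX0
      unfold treeSummand
      rw [h0.1, h0.2, hz' _ (Nat.le_add_left 1 _), mul_zero, mul_zero]
  have hsm : ∀ (I : Finset (Fin n)) (s u : ℕ × ℕ), ContDiff ℝ ∞ (treeSummand K B Λ I
      (L s.1 u.1 (I.card + 1) Λ) (L' s.2 u.2 (Iᶜ.card + 1) Λ)) := fun I s u =>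
    hK.contDiff_treeSummand hΛ hB (hL _ _ _ (Nat.le_add_left 1 _)) (hL' _ _ _ (Nat.le_add_left 1 _))
  have hsum := ScaledLE.sum hΛ.le (s := (Finset.univ : Finset (Finset (Fin n))))
    (fun I _ => ScaledLE.sum hΛ.le (fun s hs => ScaledLE.sum hΛ.le (fun u hu => hterm I s hs u hu)
      (fun u _ => hsm I s u)) (fun s _ => ContDiff.sum fun u _ => hsm I s u))
    (fun I _ => ContDiff.sum fun s _ => ContDiff.sum fun u _ => hsm I s u)
  refine ScaledLE.mono hsum ?_
  simp only [Finset.sum_const, Finset.Nat.card_antidiagonal, nsmul_eq_mul, Finset.card_univ,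
    Fintype.card_finset, Fintype.card_fin]
  have h1 : ((r₁ + 1 : ℕ) : ℝ) ≤ R + 1 := by
    push_cast
    exact_mod_cast (show r₁ + 1 ≤ R + 1 by omega)
  have h2 : ((r₂ + 1 : ℕ) : ℝ) ≤ R + 1 := by
    push_cast
    exact_mod_cast (show r₂ + 1 ≤ R + 1 by omega)
  calc ((2 ^ n : ℕ) : ℝ) * (((r₁ + 1 : ℕ) : ℝ) * (((r₂ + 1 : ℕ) : ℝ) * X))
      ≤ 2 ^ n * ((R + 1) * ((R + 1) * X)) := by
        push_cast at h1 h2 ⊢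
        gcongr
    _ = _ := by rw [hX]; ring

end Tree

/-! ### Bounds by powers of the logarithm -/

section LogPowers

/-- `g` is nonnegative and grows at most polynomially on `[1, ∞)`. -/
def PolyBdd (g : ℝ → ℝ) : Prop := ∃ N : ℕ, ∀ l, 1 ≤ l → 0 ≤ g l ∧ g l ≤ N * l ^ N

theorem mul_pow_le_mul_pow {N M : ℕ} (h : N ≤ M) {l : ℝ} (hl : 1 ≤ l) :
    (N : ℝ) * l ^ N ≤ M * l ^ M := by
  gcongr

theorem polyBdd_pow (N : ℕ) : PolyBdd fun l => N * l ^ N :=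
  ⟨N, fun _ hl => ⟨by positivity, le_rfl⟩⟩

theorem polyBdd_id : PolyBdd fun l => l :=
  ⟨1, fun l hl => ⟨by linarith, by simp⟩⟩

theorem polyBdd_const {c : ℝ} (hc : 0 ≤ c) : PolyBdd fun _ => c :=
  ⟨⌈c⌉₊, fun _ hl => ⟨hc, (Nat.le_ceil c).trans
    (le_mul_of_one_le_right (Nat.cast_nonneg _) (one_le_pow₀ hl))⟩⟩

theorem PolyBdd.add {f g : ℝ → ℝ} (hf : PolyBdd f) (hg : PolyBdd g) :
    PolyBdd fun l => f l + g l := by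
  obtain ⟨N, hN⟩ := hf
  obtain ⟨M, hM⟩ := hg
  refine ⟨N + M, fun l hl => ⟨add_nonneg (hN l hl).1 (hM l hl).1,
    (add_le_add (hN l hl).2 (hM l hl).2).trans ?_⟩⟩
  have h1 : l ^ N ≤ l ^ (N + M) := pow_le_pow_right₀ hl (Nat.le_add_right _ _)
  have h2 : l ^ M ≤ l ^ (N + M) := pow_le_pow_right₀ hl (Nat.le_add_left _ _)
  rw [Nat.cast_add, add_mul]
  gcongr

theorem PolyBdd.mul {f g : ℝ → ℝ} (hf : PolyBdd f) (hg : PolyBdd g) :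
    PolyBdd fun l => f l * g l := by
  obtain ⟨N, hN⟩ := hf
  obtain ⟨M, hM⟩ := hg
  refine ⟨N * M + (N + M), fun l hl => ⟨mul_nonneg (hN l hl).1 (hM l hl).1,
    (mul_le_mul (hN l hl).2 (hM l hl).2 (hM l hl).1 (by positivity)).trans ?_⟩⟩
  calc (N : ℝ) * l ^ N * (M * l ^ M) = (N * M : ℕ) * l ^ (N + M) := by
        push_cast; ring
    _ ≤ (N * M + (N + M) : ℕ) * l ^ (N * M + (N + M)) :=
        mul_le_mul (by exact_mod_cast Nat.le_add_right _ _)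
          (pow_le_pow_right₀ hl (Nat.le_add_left _ _)) (by positivity) (Nat.cast_nonneg _)

/-- One integer serves as constant and as exponent. Since every large `N` will do, finitely many
polynomials can share one. -/
theorem eventually_Pln_le {Q : Polynomial ℝ} (hQ : ∀ i, 0 ≤ Q.coeff i) :
    ∀ᶠ N : ℕ in atTop, ∀ z, 1 ≤ z → Pln Q z ≤ N * (1 + Real.log z) ^ N := by
  filter_upwards [eventually_ge_atTop (max ⌈Q.eval 1⌉₊ Q.natDegree)] with N hN z hz
  have hlog := Real.log_nonneg hz
  have h1 : Q.eval 1 ≤ N := (Nat.le_ceil _).trans (by exact_mod_cast (le_max_left _ _).trans hN)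
  calc Pln Q z = ∑ i ∈ Finset.range (Q.natDegree + 1), Q.coeff i * Real.log z ^ i :=
        Polynomial.eval_eq_sum_range _
    _ ≤ ∑ i ∈ Finset.range (Q.natDegree + 1), Q.coeff i * (1 + Real.log z) ^ N := by
        refine Finset.sum_le_sum fun i hi => mul_le_mul_of_nonneg_left ?_ (hQ i)
        refine (pow_le_pow_left₀ hlog (by linarith) i).trans (pow_le_pow_right₀ (by linarith) ?_)
        have := Finset.mem_range.1 hi
        have := (le_max_right _ _).trans hN
        omega
    _ = Q.eval 1 * (1 + Real.log z) ^ N := by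
        rw [← Finset.sum_mul, Polynomial.eval_eq_sum_range]
        simp
    _ ≤ N * (1 + Real.log z) ^ N := by gcongr

theorem PlnFamily.exists_le (F : PlnFamily) (n P R : ℕ) :
    ∃ N : ℕ, ∀ r₁ r₂ p, r₁ + r₂ ≤ R → p ≤ P → ∀ z, 1 ≤ z →
      Pln (F.poly n p r₁ r₂) z ≤ N * (1 + Real.log z) ^ N := by
  have h : ∀ᶠ N : ℕ in atTop, ∀ r₁ ∈ Finset.range (R + 1), ∀ r₂ ∈ Finset.range (R + 1),
      ∀ p ∈ Finset.range (P + 1), ∀ z, 1 ≤ z →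
        Pln (F.poly n p r₁ r₂) z ≤ N * (1 + Real.log z) ^ N := by
    simp only [eventually_all_finset]
    exact fun r₁ _ r₂ _ p _ => eventually_Pln_le (F.nonneg n p r₁ r₂)
  obtain ⟨N, hN⟩ := h.exists
  refine ⟨N, fun r₁ r₂ p hr hp => hN r₁ ?_ r₂ ?_ p ?_⟩ <;> rw [Finset.mem_range] <;> omega

end LogPowers

/-! ### Renormalization conditions and bare data -/

section Boundary

variable {K : ℝ → ℝ} {A B Λ_R Λ₀ : ℝ} {L : VertexSystem}

theorem IsPerturbativeSolution.smoothAt (h : IsPerturbativeSolution K A B Λ_R Λ₀ L) {Λ : ℝ}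
    (hΛ : Λ ∈ Set.Icc Λ_R Λ₀) : SmoothAt L Λ := fun r₁ r₂ n hn => h.smooth r₁ r₂ n hn Λ hΛ

theorem momDeriv_zero_order {n : ℕ} (a : Fin 0 → Fin n × Fin n × Fin 4) (f : Momenta n → ℝ)
    (k : Momenta n) : momDeriv a f k = f k := iteratedFDeriv_zero_apply _

theorem momDeriv_one_eq_zero_of_even {n : ℕ} (a : Fin 1 → Fin n × Fin n × Fin 4)
    {f : Momenta n → ℝ} (hd : ContDiff ℝ ∞ f) (hf : ∀ k, f (-k) = f k) :
    momDeriv a f 0 = 0 := by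
  unfold momDeriv
  rw [iteratedFDeriv_one_apply]
  have h0 : HasFDerivAt f (fderiv ℝ f 0) (-(0 : Momenta n)) := by
    rw [neg_zero]
    exact (hd.differentiable (by simp)).differentiableAt.hasFDerivAt
  have h1 := h0.comp (0 : Momenta n) (hasFDerivAt_id (0 : Momenta n)).neg
  have h2 : f ∘ Neg.neg = f := funext hf
  rw [h2] at h1
  have h3 := DFunLike.congr_fun h1.fderiv (direction (a 0).1 (a 0).2.1 (a 0).2.2)
  simp only [ContinuousLinearMap.comp_apply, neg_apply,
    ContinuousLinearMap.id_apply, map_neg] at h3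
  exact self_eq_neg.1 h3

theorem direction_two (i j : Fin 2) (μ : Fin 4) :
    ∃ c : ℝ, direction i j μ = c • direction 0 1 μ := by
  fin_cases i <;> fin_cases j
  · exact ⟨0, by rw [zero_smul]; exact direction_self _ _⟩
  · exact ⟨1, by rw [one_smul]; rfl⟩
  · refine ⟨-1, Subtype.ext ?_⟩
    refine Eq.trans ?_ (congrArg Subtype.val (neg_one_smul ℝ (direction (0 : Fin 2) 1 μ)).symm)
    exact (neg_sub _ _).symm
  · exact ⟨0, by rw [zero_smul]; exact direction_self _ _⟩

/-- The value of the relevant data prescribed by the renormalization conditions. -/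
def renValue (r₁ r₂ n p : ℕ) : ℝ :=
  if p = 0 ∧ ((n = 3 ∧ r₁ = 1 ∧ r₂ = 0) ∨ (n = 4 ∧ r₁ = 0 ∧ r₂ = 1)) then 1 else 0

/-- Besides the prescribed values, first derivatives at zero vanish by invariance under `k ↦ -k`,
and derivatives of the one-point function vanish because its momentum space is trivial. For `n = p =
2` every direction is a multiple of `∂_{1,2}^μ`. So all relevant data at zero momentum are fixed. -/
theorem RenormalizationConditions.momDeriv_eq (hren : RenormalizationConditions Λ_R L)
    (h : IsPerturbativeSolution K A B Λ_R Λ₀ L) (hle : Λ_R ≤ Λ₀) (r₁ r₂ : ℕ) {n p : ℕ} (hn : 1 ≤ n)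
    (hnp : n + p ≤ 4) (a : Fin p → Fin n × Fin n × Fin 4) :
    momDeriv a (L r₁ r₂ n Λ_R) 0 = renValue r₁ r₂ n p := by
  have hmem : Λ_R ∈ Set.Icc Λ_R Λ₀ := Set.left_mem_Icc.2 hle
  have heven : ∀ k, L r₁ r₂ n Λ_R (-k) = L r₁ r₂ n Λ_R k := fun k =>
    h.invariant r₁ r₂ n hn Λ_R hmem (LinearIsometryEquiv.neg ℝ) k (-k) fun i => rfl
  rcases Nat.eq_zero_or_pos p with rfl | hp
  · rw [momDeriv_zero_order]
    obtain rfl | rfl | rfl | rfl : n = 1 ∨ n = 2 ∨ n = 3 ∨ n = 4 := by omega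
    · rw [hren.rho_one]; simp [renValue]
    · rw [hren.rho_two]; simp [renValue]
    · rw [hren.rho_four]; simp [renValue]
    · rw [hren.rho_five]; simp [renValue]
  · have h0 : renValue r₁ r₂ n p = 0 := by
      simp [renValue, hp.ne']
    rw [h0]
    obtain rfl | rfl | hp3 : p = 1 ∨ p = 2 ∨ 3 ≤ p := by omega
    · exact momDeriv_one_eq_zero_of_even a (h.smooth r₁ r₂ n hn Λ_R hmem) heven
    · obtain rfl | rfl : n = 1 ∨ n = 2 := by omega
      · refine (iteratedFDeriv ℝ 2 (L r₁ r₂ 1 Λ_R) 0).map_coord_zero 0 ?_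
        rw [Subsingleton.elim (a 0).1 (a 0).2.1, direction_self]
      · choose c hc using fun q => direction_two (a q).1 (a q).2.1 (a q).2.2
        unfold momDeriv
        simp only [hc]
        rw [ContinuousMultilinearMap.map_smul_univ]
        have h3 := hren.rho_three r₁ r₂ (a 0).2.2 (a 1).2.2
        unfold momDeriv at h3
        have h4 : (fun q : Fin 2 => direction (0 : Fin 2) 1 (a q).2.2) = fun q =>
            direction (![((0 : Fin 2), (1 : Fin 2), (a 0).2.2), (0, 1, (a 1).2.2)] q).1
              (![((0 : Fin 2), (1 : Fin 2), (a 0).2.2), (0, 1, (a 1).2.2)] q).2.1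
              (![((0 : Fin 2), (1 : Fin 2), (a 0).2.2), (0, 1, (a 1).2.2)] q).2.2 := by
          funext q
          fin_cases q <;> rfl
        rw [h4, h3, smul_zero]
    · obtain rfl : n = 1 := by omega
      refine (iteratedFDeriv ℝ p (L r₁ r₂ 1 Λ_R) 0).map_coord_zero ⟨0, hp⟩ ?_
      rw [Subsingleton.elim (a ⟨0, hp⟩).1 (a ⟨0, hp⟩).2.1, direction_self]

theorem abs_renValue_le (hR : 0 < Λ_R) (r₁ r₂ n p : ℕ) :
    Λ_R ^ p * |renValue r₁ r₂ n p| ≤ (Λ_R ^ r₁)⁻¹ * Λ_R ^ ((4 : ℤ) - n) := by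
  unfold renValue
  split_ifs with h
  · obtain ⟨rfl, ⟨rfl, rfl, rfl⟩ | ⟨rfl, rfl, rfl⟩⟩ := h
    · norm_num [hR.ne']
    · norm_num
  · rw [abs_zero, mul_zero]
    positivity

theorem momDeriv_dimensionless {n p : ℕ} (a : Fin p → Fin n × Fin n × Fin 4) {Λ : ℝ}
    {r₁ r₂ : ℕ} (hL : ContDiff ℝ ∞ (L r₁ r₂ n Λ)) (k : Momenta n) :
    momDeriv a (dimensionless L r₁ r₂ n Λ) k =
      Λ ^ ((n : ℤ) + r₁ - 4) * momDeriv a (L r₁ r₂ n Λ) k := momDeriv_const_mul a hL _ k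

/-- Dictionary between bounds on `A_n` and bounds on `L_n` in units of `Λ`: the factor `(Λ/Λ_R)^r₁`
becomes `Λ_R^(-r₁)`, which is multiplicative in the order as the tree term needs. -/
theorem abs_dimensionless_le_iff {Λ : ℝ} (hΛ : 0 < Λ) (n p r₁ : ℕ) (x X : ℝ) :
    |Λ ^ ((n : ℤ) + r₁ - 4) * x| ≤ Λ ^ (-(p : ℤ)) * (Λ / Λ_R) ^ r₁ * X ↔
      Λ ^ p * |x| ≤ X * (Λ_R ^ r₁)⁻¹ * Λ ^ ((4 : ℤ) - n) := by
  have h1 : (0 : ℝ) < Λ ^ ((n : ℤ) + r₁ - 4) := by positivity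
  have h2 : (0 : ℝ) < Λ ^ p := by positivity
  rw [abs_mul, abs_of_pos h1, ← mul_le_mul_iff_of_pos_left (b := Λ ^ p * |x|) h1,
    ← mul_le_mul_iff_of_pos_left (b := Λ ^ ((n : ℤ) + r₁ - 4) * |x|) h2]
  have e1 : Λ ^ p * (Λ ^ (-(p : ℤ)) * (Λ / Λ_R) ^ r₁ * X) =
      Λ ^ ((n : ℤ) + r₁ - 4) * (X * (Λ_R ^ r₁)⁻¹ * Λ ^ ((4 : ℤ) - n)) := by
    have e2 : Λ ^ p * Λ ^ (-(p : ℤ)) = 1 := by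
      rw [zpow_neg, zpow_natCast]
      exact mul_inv_cancel₀ h2.ne'
    have e3 : Λ ^ ((n : ℤ) + r₁ - 4) * Λ ^ ((4 : ℤ) - n) = Λ ^ r₁ := by
      rw [← zpow_add₀ hΛ.ne', ← zpow_natCast Λ r₁]
      congr 1
      ring
    calc _ = (Λ ^ p * Λ ^ (-(p : ℤ))) * ((Λ / Λ_R) ^ r₁ * X) := by ring
      _ = (Λ ^ ((n : ℤ) + r₁ - 4) * Λ ^ ((4 : ℤ) - n)) * (X * (Λ_R ^ r₁)⁻¹) := by
        rw [e2, e3, one_mul, div_pow]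
        ring
      _ = _ := by ring
  rw [e1, mul_left_comm]

theorem SmallBareData.abs_momDeriv_le {F : PlnFamily} (h0 : 0 < Λ₀)
    (h : SmallBareData F Λ_R Λ₀ L) (hL : SmoothAt L Λ₀) (r₁ r₂ : ℕ) {n p : ℕ} (hn : 1 ≤ n)
    (hnp : 5 ≤ n + p) (a : Fin p → Fin n × Fin n × Fin 4) {k : Momenta n}
    (hk : k ∈ region 2 n Λ₀) :
    Λ₀ ^ p * |momDeriv a (L r₁ r₂ n Λ₀) k| ≤
      Pln (F.poly n p r₁ r₂) (Λ₀ / Λ_R) * (Λ_R ^ r₁)⁻¹ * Λ₀ ^ ((4 : ℤ) - n) := by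
  have := h r₁ r₂ n p hn hnp a k hk
  rwa [momDeriv_dimensionless a (hL r₁ r₂ n hn), abs_dimensionless_le_iff h0] at this

end Boundary

/-! ### Induction over order and legs; boundedness and differences -/

section Induction

variable {K : ℝ → ℝ}

/-- A linear combination of systems of vertex functions, with its parameters and a weight `w` that
measures its size. -/
structure Config where
  (A B Λ_R Λ₀ w : ℝ)
  m : ℕ
  c : Fin m → ℝ
  L : Fin m → VertexSystem

/-- The vertex functions of the linear combination. -/
noncomputable def Config.sys (x : Config) : VertexSystem := comb x.c x.L

/-- The logarithmic factor of a configuration. -/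
noncomputable def Config.log (x : Config) : ℝ := logFactor x.Λ_R x.Λ₀

/-- The combined systems are solutions of the flow equation with common parameters. -/
structure Config.Valid (K : ℝ → ℝ) (x : Config) : Prop where
  pos : 0 < x.Λ_R
  le : x.Λ_R ≤ x.Λ₀
  abs_B_le : |x.B| ≤ x.Λ_R ^ 2
  w_nonneg : 0 ≤ x.w
  sol : ∀ j, IsPerturbativeSolution K x.A x.B x.Λ_R x.Λ₀ (x.L j)

theorem Config.Valid.one_le_log {x : Config} (h : x.Valid K) : 1 ≤ x.log :=
  one_le_logFactor h.pos h.le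

theorem Config.Valid.many_legs {x : Config} (h : x.Valid K) {r₁ r₂ n : ℕ}
    (hn : 2 * (r₁ + r₂) + 2 < n) {Λ : ℝ} (hΛ : Λ ∈ Set.Icc x.Λ_R x.Λ₀) (k : Momenta n) :
    x.sys r₁ r₂ n Λ k = 0 := by
  unfold Config.sys comb
  exact Finset.sum_eq_zero fun j _ => by rw [(h.sol j).many_legs r₁ r₂ n hn Λ hΛ k, mul_zero]

/-- Induction over the order and, downwards, over the number of legs: for a class of configurations
closed under the hypotheses, bounds on the boundary data and on the tree term in terms of lower
orders imply bounds on all vertex functions. -/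
theorem IsCutoff.exists_orderLE (hK : IsCutoff K) {P : ℕ} (hP : 5 ≤ P) {σ : ℤ} (hσ : 4 ≤ σ)
    (hσ' : σ ≤ 5) {S : Set Config} (hS : ∀ x ∈ S, x.Valid K)
    (hbare : ∀ n R, 1 ≤ n → ∃ N : ℕ, ∀ x ∈ S, ∀ r₁ r₂ p, r₁ + r₂ ≤ R → p ≤ P → 5 ≤ n + p →
      ∀ a : Fin p → Fin n × Fin n × Fin 4, ∀ k ∈ region 2 n x.Λ₀,
        x.Λ₀ ^ p * |momDeriv a (x.sys r₁ r₂ n x.Λ₀) k| ≤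
          x.w * (N * x.log ^ N) * (x.Λ_R ^ r₁)⁻¹ * x.Λ₀ ^ (σ - n))
    (hren : ∀ x ∈ S, ∀ r₁ r₂ n p, 1 ≤ n → n + p ≤ 4 → ∀ a : Fin p → Fin n × Fin n × Fin 4,
      x.Λ_R ^ p * |momDeriv a (x.sys r₁ r₂ n x.Λ_R) 0| ≤
        x.w * (x.Λ_R ^ r₁)⁻¹ * x.Λ_R ^ (σ - n))
    (htree : ∀ R n, 1 ≤ n → (∃ N : ℕ, ∀ x ∈ S, ∀ Λ ∈ Set.Icc x.Λ_R x.Λ₀,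
        OrderLE P 2 R σ (x.w * (N * x.log ^ N)) x.Λ_R Λ x.sys) →
      ∃ N : ℕ, ∀ x ∈ S, ∀ Λ ∈ Set.Icc x.Λ_R x.Λ₀, ∀ r₁ r₂, r₁ + r₂ ≤ R → ∀ k ∈ region 2 n Λ,
        ScaledLE P Λ (fun k => ∑ j, x.c j * treeTerm K x.B (x.L j) r₁ r₂ n Λ k) k
          (x.w * (N * x.log ^ N) * (x.Λ_R ^ r₁)⁻¹ * Λ ^ (σ - 1 - n)))
    (R : ℕ) : ∃ N : ℕ, ∀ x ∈ S, ∀ Λ ∈ Set.Icc x.Λ_R x.Λ₀,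
      OrderLE P 2 R σ (x.w * (N * x.log ^ N)) x.Λ_R Λ x.sys := by
  induction R with
  | zero => exact ⟨0, fun x _ Λ _ r₁ r₂ n _ h => absurd h (Nat.not_lt_zero _)⟩
  | succ R ih =>
    -- The downward induction over legs, written upward in `j`: for `j = 0` there are more than `2 R
    -- + 2` legs and the functions vanish; each increment admits one smaller `n`, whose loop term
    -- has `n + 2` legs and is already bounded.
    have hlegs : ∀ j : ℕ, ∃ N : ℕ, ∀ x ∈ S, ∀ Λ ∈ Set.Icc x.Λ_R x.Λ₀, ∀ r₁ r₂ n, 1 ≤ n →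
        r₁ + r₂ ≤ R → 2 * R + 3 ≤ n + j → ∀ k ∈ region 2 n Λ,
        ScaledLE P Λ (x.sys r₁ r₂ n Λ) k
          (x.w * (N * x.log ^ N) * Λ ^ (σ - n) * (x.Λ_R ^ r₁)⁻¹) := by
      intro j
      induction j with
      | zero =>
        refine ⟨0, fun x hx Λ hΛ r₁ r₂ n _ hr hn k _ => ?_⟩
        refine scaledLE_of_eventuallyEq_zero
          (Eventually.of_forall fun y => (hS x hx).many_legs (by omega) hΛ y) (le_of_eq ?_)
        simp
      | succ j ihj =>
        obtain ⟨N₁, hN₁⟩ := ihj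
        -- Here `n ≥ 1` alone already gives `2 * R + 3 ≤ n + j`, so no new number of legs appears.
        by_cases hj : 2 * R + 3 ≤ j + 1
        · refine ⟨N₁, fun x hx Λ hΛ r₁ r₂ n hn hr _ => hN₁ x hx Λ hΛ r₁ r₂ n hn hr ?_⟩
          omega
        obtain ⟨n, hn1, hnj⟩ : ∃ n, 1 ≤ n ∧ 2 * R + 3 = n + (j + 1) :=
          ⟨2 * R + 3 - (j + 1), by omega, by omega⟩
        obtain ⟨Nt, hNt⟩ := htree R n hn1 ih
        obtain ⟨Nb, hNb⟩ := hbare n R hn1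
        obtain ⟨C, hC0, hC⟩ := hK.exists_comb_bound hn1 hP (le_refl (2 : ℝ))
        obtain ⟨N₂, hN₂⟩ := (polyBdd_const hC0).mul (((((polyBdd_pow N₁).add (polyBdd_pow Nt)).add
          (polyBdd_pow Nb)).add (polyBdd_const zero_le_one)).mul polyBdd_id)
        refine ⟨max N₁ N₂, fun x hx Λ hΛ r₁ r₂ n' hn' hr hnj' k hk => ?_⟩
        have hv := hS x hx
        have hw := hv.w_nonneg
        have hR := hv.pos
        have hΛ0 : 0 < Λ := hv.pos.trans_le hΛ.1
        have hΛ₀ : 0 < x.Λ₀ := hv.pos.trans_le hv.le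
        have hl := hv.one_le_log
        rcases (show n ≤ n' by omega).eq_or_lt with rfl | hlt
        -- The four summands majorize the loop term, the tree term, the bare data and the
        -- renormalized data, in this order.
        · set M := x.w * (x.Λ_R ^ r₁)⁻¹ *
            (N₁ * x.log ^ N₁ + Nt * x.log ^ Nt + Nb * x.log ^ Nb + 1) with hM
          have hV : 0 ≤ x.w * (x.Λ_R ^ r₁)⁻¹ := by positivity
          have hM1 : ∀ y, y ≤ N₁ * x.log ^ N₁ + Nt * x.log ^ Nt + Nb * x.log ^ Nb + 1 →
              x.w * (x.Λ_R ^ r₁)⁻¹ * y ≤ M := fun y hy => mul_le_mul_of_nonneg_left hy hV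
          have p1 : 0 ≤ N₁ * x.log ^ N₁ := by positivity
          have p2 : 0 ≤ Nt * x.log ^ Nt := by positivity
          have p3 : 0 ≤ Nb * x.log ^ Nb := by positivity
          have hmul : ∀ {u y z : ℝ}, 0 ≤ z → u = x.w * (x.Λ_R ^ r₁)⁻¹ * y * z →
              y ≤ N₁ * x.log ^ N₁ + Nt * x.log ^ Nt + Nb * x.log ^ Nb + 1 → u ≤ M * z :=
            fun hz hu hy => hu.trans_le (mul_le_mul_of_nonneg_right (hM1 _ hy) hz)
          have hfin := hC hv.pos hv.abs_B_le hv.sol (r₁ := r₁) (r₂ := r₂) hσ hσ' (M := M)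
            (by positivity)
            (fun Λ hΛ k hk => (hNt x hx Λ hΛ r₁ r₂ hr k hk).mono (by
              have : 0 < Λ := hv.pos.trans_le hΛ.1
              exact hmul (y := Nt * x.log ^ Nt) (by positivity) (by ring) (by linarith)))
            (fun Λ hΛ k hk => (hN₁ x hx Λ hΛ r₁ r₂ (n + 2) (by omega) hr (by omega) k hk).mono (by
              have : 0 < Λ := hv.pos.trans_le hΛ.1
              push_cast
              exact hmul (y := N₁ * x.log ^ N₁) (by positivity) (by ring) (by linarith)))
            (fun p hp hnp a k hk => (hNb x hx r₁ r₂ p hr hp hnp a k hk).trans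
              (hmul (y := Nb * x.log ^ Nb) (by positivity) (by ring) (by linarith)))
            (fun p hnp a => (hren x hx r₁ r₂ n p hn1 hnp a).trans
              (hmul (y := 1) (by positivity) (by ring) (by linarith))) Λ hΛ k hk
          refine ScaledLE.mono hfin ?_
          have h2 := ((hN₂ x.log hl).2).trans (mul_pow_le_mul_pow (le_max_right N₁ N₂) hl)
          have h3 := mul_le_mul_of_nonneg_right (mul_le_mul_of_nonneg_left h2 hV)
            (show 0 ≤ Λ ^ (σ - n) by positivity)
          refine le_trans (le_of_eq ?_) (h3.trans (le_of_eq ?_))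
          · rw [hM, Config.log]
            ring
          · ring
        · refine (hN₁ x hx Λ hΛ r₁ r₂ n' hn' hr (by omega) k hk).mono ?_
          have h2 := mul_pow_le_mul_pow (le_max_left N₁ N₂) hl
          gcongr
    obtain ⟨N, hN⟩ := hlegs (2 * R + 3)
    exact ⟨N, fun x hx Λ hΛ r₁ r₂ n hn hr => hN x hx Λ hΛ r₁ r₂ n hn (by omega) (by omega)⟩

/-- The hypotheses of the boundedness theorem for a system of vertex functions. -/
structure Admissible (K : ℝ → ℝ) (F : PlnFamily) (A B Λ_R Λ₀ : ℝ) (L : VertexSystem) : Prop where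
  pos : 0 < Λ_R
  le : Λ_R ≤ Λ₀
  abs_B_le : |B| ≤ Λ_R ^ 2
  sol : IsPerturbativeSolution K A B Λ_R Λ₀ L
  ren : RenormalizationConditions Λ_R L
  bare : SmallBareData F Λ_R Λ₀ L

theorem comb_single (L : VertexSystem) : comb (fun _ : Fin 1 => (1 : ℝ)) (fun _ => L) = L := by
  funext r₁ r₂ n Λ k
  simp [comb]

/-- Boundedness of the vertex functions. -/
theorem IsCutoff.exists_bound (hK : IsCutoff K) (F : PlnFamily) {P : ℕ} (hP : 5 ≤ P) (R : ℕ) :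
    ∃ N : ℕ, ∀ {A B Λ_R Λ₀ : ℝ} {L : VertexSystem}, Admissible K F A B Λ_R Λ₀ L →
      ∀ Λ ∈ Set.Icc Λ_R Λ₀,
        OrderLE P 2 R 4 (N * logFactor Λ_R Λ₀ ^ N) Λ_R Λ L := by
  -- Single systems with weight `1`; quantifying over the whole class makes `N` independent of all
  -- parameters.
  set S : Set Config := {x | ∃ A B Λ_R Λ₀ L, Admissible K F A B Λ_R Λ₀ L ∧
    x = ⟨A, B, Λ_R, Λ₀, 1, 1, fun _ => 1, fun _ => L⟩} with hS
  suffices hmain : ∃ N : ℕ, ∀ x ∈ S, ∀ Λ ∈ Set.Icc x.Λ_R x.Λ₀,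
      OrderLE P 2 R 4 (x.w * (N * x.log ^ N)) x.Λ_R Λ x.sys by
    obtain ⟨N, hN⟩ := hmain
    refine ⟨N, fun {A B Λ_R Λ₀ L} h Λ hΛ => ?_⟩
    have := hN _ ⟨A, B, Λ_R, Λ₀, L, h, rfl⟩ Λ hΛ
    simp only [Config.sys, comb_single, one_mul] at this
    exact this
  refine hK.exists_orderLE hP (σ := 4) le_rfl (by norm_num) (S := S) ?_ ?_ ?_ ?_ R
  · rintro _ ⟨A, B, Λ_R, Λ₀, L, h, rfl⟩
    exact ⟨h.pos, h.le, h.abs_B_le, zero_le_one, fun _ => h.sol⟩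
  · intro n R hn
    obtain ⟨N, hN⟩ := F.exists_le n P R
    refine ⟨N, ?_⟩
    rintro _ ⟨A, B, Λ_R, Λ₀, L, h, rfl⟩ r₁ r₂ p hr hp hnp a k hk
    have hR := h.pos
    have h0 : 0 < Λ₀ := h.pos.trans_le h.le
    simp only [Config.sys, comb_single, one_mul, Config.log]
    refine (h.bare.abs_momDeriv_le h0 (h.sol.smoothAt (Set.right_mem_Icc.2 h.le)) r₁ r₂ hn hnp a
      hk).trans ?_
    have := hN r₁ r₂ p hr hp (Λ₀ / Λ_R) ((one_le_div h.pos).2 h.le)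
    unfold logFactor
    gcongr
  · rintro _ ⟨A, B, Λ_R, Λ₀, L, h, rfl⟩ r₁ r₂ n p hn hnp a
    simp only [Config.sys, comb_single, one_mul]
    rw [h.ren.momDeriv_eq h.sol h.le r₁ r₂ hn hnp a]
    exact abs_renValue_le h.pos r₁ r₂ n p
  · rintro R n hn ⟨N, hN⟩
    obtain ⟨C, hC0, hC⟩ := hK.exists_treeBilin_bound n P R (le_refl (2 : ℝ))
    obtain ⟨N', hN'⟩ := (polyBdd_const hC0).mul ((polyBdd_pow N).mul (polyBdd_pow N))
    refine ⟨N', ?_⟩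
    rintro _ ⟨A, B, Λ_R, Λ₀, L, h, rfl⟩ Λ hΛ r₁ r₂ hr k hk
    have hR := h.pos
    have hΛ0 : 0 < Λ := h.pos.trans_le hΛ.1
    have hl := one_le_logFactor h.pos h.le
    have hLE := hN _ ⟨A, B, Λ_R, Λ₀, L, h, rfl⟩ Λ hΛ
    simp only [Config.sys, comb_single, one_mul, Config.log] at hLE
    have hβ : 0 ≤ (N : ℝ) * logFactor Λ_R Λ₀ ^ N := by positivity
    have hz : ∀ n, 1 ≤ n → ∀ k, L 0 0 n Λ k = 0 := fun n hn => h.sol.zeroth_order n hn Λ hΛ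
    have := hC h.pos hΛ0 (h.abs_B_le.trans (pow_le_pow_left₀ hR.le hΛ.1 2)) (h.sol.smoothAt hΛ)
      (h.sol.smoothAt hΛ) hz hz hβ hβ hLE hLE r₁ r₂ hr k hk
    simp only [Finset.univ_unique, Finset.sum_const, Finset.card_singleton, one_smul, one_mul,
      Config.log]
    refine ScaledLE.mono this ?_
    have h2 := (hN' _ hl).2
    calc _ = (C * (N * logFactor Λ_R Λ₀ ^ N * (N * logFactor Λ_R Λ₀ ^ N))) * (Λ_R ^ r₁)⁻¹ *
          Λ ^ ((4 : ℤ) + 4 - 5 - n) := by ring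
      _ ≤ (N' * logFactor Λ_R Λ₀ ^ N') * (Λ_R ^ r₁)⁻¹ * Λ ^ ((4 : ℤ) + 4 - 5 - n) := by gcongr
      _ = _ := by norm_num

theorem comb_pair (L L' : VertexSystem) (r₁ r₂ n : ℕ) (Λ : ℝ) (k : Momenta n) :
    comb ![1, -1] ![L, L'] r₁ r₂ n Λ k = L r₁ r₂ n Λ k - L' r₁ r₂ n Λ k := by
  simp [comb, Fin.sum_univ_two, sub_eq_add_neg]

theorem momDeriv_sub {n p : ℕ} (a : Fin p → Fin n × Fin n × Fin 4) {f g : Momenta n → ℝ}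
    (hf : ContDiff ℝ ∞ f) (hg : ContDiff ℝ ∞ g) (k : Momenta n) :
    momDeriv a (fun k => f k - g k) k = momDeriv a f k - momDeriv a g k := by
  have := momDeriv_sum a Finset.univ (f := ![f, fun k => -1 * g k])
    (by intro i _; fin_cases i; exacts [hf, contDiff_const.mul hg]) k
  simpa [Fin.sum_univ_two, momDeriv_const_mul a hg (-1) k, sub_eq_add_neg,
    show (fun k => -1 * g k) = fun k => -g k from funext fun k => neg_one_mul _,
    show momDeriv a (fun k => -g k) k = -momDeriv a g k by
      simpa using momDeriv_const_mul a hg (-1) k] using this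

theorem momDeriv_comb_pair {n p : ℕ} (a : Fin p → Fin n × Fin n × Fin 4) {L L' : VertexSystem}
    {Λ : ℝ} (hL : SmoothAt L Λ) (hL' : SmoothAt L' Λ) (hn : 1 ≤ n) (r₁ r₂ : ℕ) (k : Momenta n) :
    momDeriv a (comb ![1, -1] ![L, L'] r₁ r₂ n Λ) k =
      momDeriv a (L r₁ r₂ n Λ) k - momDeriv a (L' r₁ r₂ n Λ) k := by
  rw [← momDeriv_sub a (hL r₁ r₂ n hn) (hL' r₁ r₂ n hn)]
  exact congrArg (fun f => momDeriv a f k) (funext fun k => comb_pair L L' r₁ r₂ n Λ k)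

/-- The identity `x y - x' y' = (x - x') y + x' (y - y')`: the tree term of the difference is linear
in the difference, with bounded coefficients. -/
theorem treeBilin_sub (K : ℝ → ℝ) (B : ℝ) (L L' : VertexSystem) (r₁ r₂ n : ℕ) (Λ : ℝ)
    (k : Momenta n) :
    treeTerm K B L r₁ r₂ n Λ k - treeTerm K B L' r₁ r₂ n Λ k =
      treeBilin K B (comb ![1, -1] ![L, L']) L r₁ r₂ n Λ k +
        treeBilin K B L' (comb ![1, -1] ![L, L']) r₁ r₂ n Λ k := by
  rw [treeTerm_eq_treeBilin, treeTerm_eq_treeBilin]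
  unfold treeBilin
  simp only [← Finset.sum_sub_distrib, ← Finset.sum_add_distrib]
  refine Finset.sum_congr rfl fun I _ => Finset.sum_congr rfl fun s _ =>
    Finset.sum_congr rfl fun u _ => ?_
  unfold treeSummand
  rw [comb_pair, comb_pair]
  ring

/-- The difference of two systems with the same renormalization conditions is of order `Λ / Λ₀`
relative to the bound on the vertex functions. -/
theorem IsCutoff.exists_diff_bound (hK : IsCutoff K) (F : PlnFamily) {P : ℕ} (hP : 5 ≤ P)
    (R : ℕ) :
    ∃ N : ℕ, ∀ {A B Λ_R Λ₀ ε : ℝ} {L L' : VertexSystem}, Admissible K F A B Λ_R Λ₀ L →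
      Admissible K F A B Λ_R Λ₀ L' → 0 ≤ ε →
      (∀ r₁ r₂ n p, 1 ≤ n → 5 ≤ n + p → ∀ a : Fin p → Fin n × Fin n × Fin 4,
        ∀ k ∈ region 2 n Λ₀,
        Λ₀ ^ p * |momDeriv a (L r₁ r₂ n Λ₀) k - momDeriv a (L' r₁ r₂ n Λ₀) k| ≤
          ε * (Pln (F.poly n p r₁ r₂) (Λ₀ / Λ_R) * (Λ_R ^ r₁)⁻¹ * Λ₀ ^ ((4 : ℤ) - n))) →
      ∀ Λ ∈ Set.Icc Λ_R Λ₀, OrderLE P 2 R 5 (ε / Λ₀ * (N * logFactor Λ_R Λ₀ ^ N)) Λ_R Λ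
        (comb ![1, -1] ![L, L']) := by
  set S : Set Config := {x | ∃ A B Λ_R Λ₀ ε L L', Admissible K F A B Λ_R Λ₀ L ∧
    Admissible K F A B Λ_R Λ₀ L' ∧ 0 ≤ ε ∧
      (∀ r₁ r₂ n p, 1 ≤ n → 5 ≤ n + p → ∀ a : Fin p → Fin n × Fin n × Fin 4,
        ∀ k ∈ region 2 n Λ₀,
        Λ₀ ^ p * |momDeriv a (L r₁ r₂ n Λ₀) k - momDeriv a (L' r₁ r₂ n Λ₀) k| ≤
          ε * (Pln (F.poly n p r₁ r₂) (Λ₀ / Λ_R) * (Λ_R ^ r₁)⁻¹ * Λ₀ ^ ((4 : ℤ) - n))) ∧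
    x = ⟨A, B, Λ_R, Λ₀, ε / Λ₀, 2, ![1, -1], ![L, L']⟩} with hS
  suffices hmain : ∃ N : ℕ, ∀ x ∈ S, ∀ Λ ∈ Set.Icc x.Λ_R x.Λ₀,
      OrderLE P 2 R 5 (x.w * (N * x.log ^ N)) x.Λ_R Λ x.sys by
    obtain ⟨N, hN⟩ := hmain
    exact ⟨N, fun h h' hε hb Λ hΛ => hN _ ⟨_, _, _, _, _, _, _, h, h', hε, hb, rfl⟩ Λ hΛ⟩
  refine hK.exists_orderLE hP (σ := 5) (by norm_num) le_rfl (S := S) ?_ ?_ ?_ ?_ R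
  · rintro _ ⟨A, B, Λ_R, Λ₀, ε, L, L', h, h', hε, hb, rfl⟩
    refine ⟨h.pos, h.le, h.abs_B_le, div_nonneg hε (h.pos.le.trans h.le), fun j => ?_⟩
    fin_cases j
    exacts [h.sol, h'.sol]
  · intro n R hn
    obtain ⟨N, hN⟩ := F.exists_le n P R
    refine ⟨N, ?_⟩
    rintro _ ⟨A, B, Λ_R, Λ₀, ε, L, L', h, h', hε, hb, rfl⟩ r₁ r₂ p hr hp hnp a k hk
    have hR := h.pos
    have h0 : 0 < Λ₀ := h.pos.trans_le h.le
    have hmem : Λ₀ ∈ Set.Icc Λ_R Λ₀ := Set.right_mem_Icc.2 h.le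
    simp only [Config.sys, Config.log]
    rw [momDeriv_comb_pair a (h.sol.smoothAt hmem) (h'.sol.smoothAt hmem) hn]
    refine (hb r₁ r₂ n p hn hnp a k hk).trans ?_
    have h1 := hN r₁ r₂ p hr hp (Λ₀ / Λ_R) ((one_le_div h.pos).2 h.le)
    -- The extra unit of dimension at `Λ₀` is paid for by the weight `ε / Λ₀`.
    have h2 : Λ₀ ^ ((5 : ℤ) - n) = Λ₀ * Λ₀ ^ ((4 : ℤ) - n) := by
      rw [← zpow_one_add₀ h0.ne']
      congr 1
      ring
    calc _ ≤ ε * (N * (1 + Real.log (Λ₀ / Λ_R)) ^ N * (Λ_R ^ r₁)⁻¹ * Λ₀ ^ ((4 : ℤ) - n)) := by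
          gcongr
      _ = _ := by
          rw [h2, logFactor]
          field_simp
  · rintro _ ⟨A, B, Λ_R, Λ₀, ε, L, L', h, h', hε, hb, rfl⟩ r₁ r₂ n p hn hnp a
    have hR := h.pos
    have h0 : 0 < Λ₀ := h.pos.trans_le h.le
    have hmem : Λ_R ∈ Set.Icc Λ_R Λ₀ := Set.left_mem_Icc.2 h.le
    simp only [Config.sys]
    rw [momDeriv_comb_pair a (h.sol.smoothAt hmem) (h'.sol.smoothAt hmem) hn,
      h.ren.momDeriv_eq h.sol h.le r₁ r₂ hn hnp a, h'.ren.momDeriv_eq h'.sol h.le r₁ r₂ hn hnp a,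
      sub_self, abs_zero, mul_zero]
    positivity
  · rintro R n hn ⟨N, hN⟩
    obtain ⟨Nb, hNb⟩ := hK.exists_bound F hP R
    obtain ⟨C, hC0, hC⟩ := hK.exists_treeBilin_bound n P R (le_refl (2 : ℝ))
    obtain ⟨N', hN'⟩ := (polyBdd_const (c := 2 * C) (by positivity)).mul
      ((polyBdd_pow N).mul (polyBdd_pow Nb))
    refine ⟨N', ?_⟩
    rintro _ ⟨A, B, Λ_R, Λ₀, ε, L, L', h, h', hε, hb, rfl⟩ Λ hΛ r₁ r₂ hr k hk
    have hR := h.pos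
    have h0 : 0 < Λ₀ := h.pos.trans_le h.le
    have hΛ0 : 0 < Λ := h.pos.trans_le hΛ.1
    have hl := one_le_logFactor h.pos h.le
    have hD := hN _ ⟨_, _, _, _, _, _, _, h, h', hε, hb, rfl⟩ Λ hΛ
    simp only [Config.sys, Config.log] at hD
    have hβ : 0 ≤ (Nb : ℝ) * logFactor Λ_R Λ₀ ^ Nb := by positivity
    have hβ' : 0 ≤ ε / Λ₀ * ((N : ℝ) * logFactor Λ_R Λ₀ ^ N) := by positivity
    have hz : ∀ n, 1 ≤ n → ∀ k, L 0 0 n Λ k = 0 := fun n hn => h.sol.zeroth_order n hn Λ hΛ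
    have hz' : ∀ n, 1 ≤ n → ∀ k, L' 0 0 n Λ k = 0 := fun n hn => h'.sol.zeroth_order n hn Λ hΛ
    have hzD : ∀ n, 1 ≤ n → ∀ k, comb ![1, -1] ![L, L'] 0 0 n Λ k = 0 := fun n hn k => by
      rw [comb_pair, hz n hn, hz' n hn, sub_zero]
    have sL := h.sol.smoothAt hΛ
    have sL' := h'.sol.smoothAt hΛ
    have sD : SmoothAt (comb ![1, -1] ![L, L']) Λ :=
      SmoothAt.comb fun j => by fin_cases j; exacts [sL, sL']
    have hB := h.abs_B_le.trans (pow_le_pow_left₀ hR.le hΛ.1 2)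
    -- Dimension `5` for the difference and `4` for the bounded factor combine to `5 - 1 - n`; only
    -- the difference carries the weight.
    have t1 := hC h.pos hΛ0 hB sD sL hzD hz hβ' hβ hD (hNb h Λ hΛ) r₁ r₂ hr k hk
    have t2 := hC h.pos hΛ0 hB sL' sD hz' hzD hβ hβ' (hNb h' Λ hΛ) hD r₁ r₂ hr k hk
    have t3 := t1.add hΛ0.le t2 (hK.contDiff_treeBilin hΛ0 hB sD sL r₁ r₂ n)
      (hK.contDiff_treeBilin hΛ0 hB sL' sD r₁ r₂ n)
    have e1 : (fun k => ∑ j, (![1, -1] : Fin 2 → ℝ) j *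
        treeTerm K B ((![L, L'] : Fin 2 → VertexSystem) j) r₁ r₂ n Λ k) = fun k =>
        treeBilin K B (comb ![1, -1] ![L, L']) L r₁ r₂ n Λ k +
        treeBilin K B L' (comb ![1, -1] ![L, L']) r₁ r₂ n Λ k := by
      funext k
      rw [← treeBilin_sub]
      simp [Fin.sum_univ_two, sub_eq_add_neg]
    simp only [Config.log]
    rw [e1]
    refine ScaledLE.mono t3 ?_
    have h2 := (hN' _ hl).2
    calc _ = (ε / Λ₀ * (2 * C * (N * logFactor Λ_R Λ₀ ^ N * (Nb * logFactor Λ_R Λ₀ ^ Nb)))) *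
          (Λ_R ^ r₁)⁻¹ * Λ ^ ((5 : ℤ) - 1 - n) := by
          rw [show (5 : ℤ) + 4 - 5 - n = 5 - 1 - n by ring,
            show (4 : ℤ) + 5 - 5 - n = 5 - 1 - n by ring]
          ring
      _ ≤ ε / Λ₀ * (N' * logFactor Λ_R Λ₀ ^ N') * (Λ_R ^ r₁)⁻¹ * Λ ^ ((5 : ℤ) - 1 - n) := by
          gcongr

end Induction

/-! ### Polynomial dependence on `t` -/

section PolynomialDependence

/-- `f` agrees on `[0, 1]` with a polynomial of degree at most `d`. -/
def PolyOn (d : ℕ) (f : ℝ → ℝ) : Prop :=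
  ∃ Q : Polynomial ℝ, Q.natDegree ≤ d ∧ ∀ t ∈ Set.Icc (0 : ℝ) 1, f t = Q.eval t

theorem PolyOn.mono {d e : ℕ} {f : ℝ → ℝ} (h : PolyOn d f) (hde : d ≤ e) : PolyOn e f :=
  h.imp fun _ hQ => ⟨hQ.1.trans hde, hQ.2⟩

theorem PolyOn.congr {d : ℕ} {f g : ℝ → ℝ} (h : PolyOn d f)
    (hfg : ∀ t ∈ Set.Icc (0 : ℝ) 1, g t = f t) : PolyOn d g :=
  h.imp fun _ hQ => ⟨hQ.1, fun t ht => (hfg t ht).trans (hQ.2 t ht)⟩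

theorem polyOn_const (d : ℕ) (c : ℝ) : PolyOn d fun _ => c :=
  ⟨Polynomial.C c, by simp, by simp⟩

theorem polyOn_id : PolyOn 1 fun t => t :=
  ⟨Polynomial.X, by simp, by simp⟩

theorem PolyOn.mul {d e : ℕ} {f g : ℝ → ℝ} (hf : PolyOn d f) (hg : PolyOn e g) :
    PolyOn (d + e) fun t => f t * g t := by
  obtain ⟨Q, hQ, hfQ⟩ := hf
  obtain ⟨Q', hQ', hgQ⟩ := hg
  exact ⟨Q * Q', Polynomial.natDegree_mul_le.trans (add_le_add hQ hQ'), fun t ht => by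
    simp only [hfQ t ht, hgQ t ht, Polynomial.eval_mul]⟩

theorem PolyOn.const_mul {d : ℕ} {f : ℝ → ℝ} (hf : PolyOn d f) (c : ℝ) :
    PolyOn d fun t => c * f t :=
  ((polyOn_const 0 c).mul hf).mono (zero_add d).le

theorem PolyOn.sum {d : ℕ} {ι : Type*} {s : Finset ι} {f : ι → ℝ → ℝ}
    (h : ∀ i ∈ s, PolyOn d (f i)) : PolyOn d fun t => ∑ i ∈ s, f i t := by
  choose! Q hQ hfQ using h
  refine ⟨∑ i ∈ s, Q i, Polynomial.natDegree_sum_le_of_forall_le s Q hQ, fun t ht => ?_⟩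
  rw [Polynomial.eval_finsetSum]
  exact Finset.sum_congr rfl fun i hi => hfQ i hi t ht

theorem PolyOn.differentiableWithinAt {d : ℕ} {f : ℝ → ℝ} (h : PolyOn d f) {t : ℝ}
    (ht : t ∈ Set.Icc (0 : ℝ) 1) : DifferentiableWithinAt ℝ f (Set.Icc 0 1) t := by
  obtain ⟨Q, _, hQ⟩ := h
  exact (Q.differentiable.differentiableAt.differentiableWithinAt).congr hQ (hQ t ht)

/-- Lagrange interpolation at `d + 1` nodes in `[0, 1]`. Nodes and coefficients do not depend on
`f`, so being polynomial in `t` becomes the vanishing of fixed linear combinations, a property the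
flow can propagate. -/
theorem exists_interpolation (d : ℕ) : ∃ (τ : Fin (d + 1) → ℝ) (l : Fin (d + 1) → Polynomial ℝ),
    (∀ j, τ j ∈ Set.Icc (0 : ℝ) 1) ∧ (∀ j, (l j).natDegree ≤ d) ∧
      ∀ f, PolyOn d f → ∀ t ∈ Set.Icc (0 : ℝ) 1, f t = ∑ j, (l j).eval t * f (τ j) := by
  have hd : (0 : ℝ) < d + 1 := by positivity
  set τ : Fin (d + 1) → ℝ := fun j => (j : ℕ) / (d + 1) with hτ
  have hmem : ∀ j, τ j ∈ Set.Icc (0 : ℝ) 1 := fun j =>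
    ⟨by positivity, (div_le_one hd).2 (by exact_mod_cast j.2.le)⟩
  have hinj : Set.InjOn τ (Finset.univ : Finset (Fin (d + 1))) := by
    intro i _ j _ hij
    have h1 : ((i : ℕ) : ℝ) = (j : ℕ) := by
      simpa [hτ, div_left_inj' hd.ne'] using hij
    exact Fin.ext (by exact_mod_cast h1)
  refine ⟨τ, fun j => Lagrange.basis Finset.univ τ j, hmem, fun j => ?_, ?_⟩
  · refine Polynomial.natDegree_le_iff_degree_le.2 ?_
    rw [Lagrange.degree_basis hinj (Finset.mem_univ j)]
    simp
  · rintro f ⟨Q, hQ, hfQ⟩ t ht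
    have h1 : Q = Lagrange.interpolate Finset.univ τ fun i => Q.eval (τ i) := by
      refine Lagrange.eq_interpolate hinj ?_
      refine Polynomial.degree_le_natDegree.trans_lt ?_
      rw [Finset.card_univ, Fintype.card_fin]
      exact_mod_cast Nat.lt_succ_of_le hQ
    rw [hfQ t ht]
    conv_lhs => rw [h1]
    rw [Lagrange.interpolate_apply, Polynomial.eval_finsetSum]
    refine Finset.sum_congr rfl fun j _ => ?_
    rw [Polynomial.eval_mul, Polynomial.eval_C, hfQ _ (hmem j), mul_comm]

/-- Interpolating pointwise in `k` with coefficients independent of `k` writes `f t` as a finite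
sum, which can be differentiated in the momenta term by term. -/
theorem PolyOn.momDeriv {d n p : ℕ} {f : ℝ → Momenta n → ℝ}
    (h : ∀ k, PolyOn d fun t => f t k)
    (hf : ∀ t ∈ Set.Icc (0 : ℝ) 1, ContDiff ℝ ∞ (f t)) (a : Fin p → Fin n × Fin n × Fin 4)
    (k : Momenta n) : PolyOn d fun t => momDeriv a (f t) k := by
  obtain ⟨τ, l, hτ, hl, hint⟩ := exists_interpolation d
  refine ⟨∑ j, Polynomial.C (PolchinskiFlow.momDeriv a (f (τ j)) k) * l j, ?_, fun t ht => ?_⟩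
  · exact Polynomial.natDegree_sum_le_of_forall_le _ _ fun j _ =>
      (Polynomial.natDegree_C_mul_le _ _).trans (hl j)
  · have h1 : f t = fun k => ∑ j, (l j).eval t * f (τ j) k := funext fun k => hint _ (h k) t ht
    beta_reduce
    rw [h1, momDeriv_sum a _ fun j _ => contDiff_const.mul (hf _ (hτ j)),
      Polynomial.eval_finsetSum]
    refine Finset.sum_congr rfl fun j _ => ?_
    rw [momDeriv_const_mul a (hf _ (hτ j)), Polynomial.eval_mul, Polynomial.eval_C, mul_comm]

theorem momDeriv_comb {ι : Type*} [Fintype ι] {c : ι → ℝ} {L : ι → VertexSystem} {Λ : ℝ}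
    (h : ∀ j, SmoothAt (L j) Λ) (r₁ r₂ : ℕ) {n p : ℕ} (hn : 1 ≤ n)
    (a : Fin p → Fin n × Fin n × Fin 4) (k : Momenta n) :
    momDeriv a (comb c L r₁ r₂ n Λ) k = ∑ j, c j * momDeriv a (L j r₁ r₂ n Λ) k := by
  unfold comb
  rw [momDeriv_sum a _ fun j _ => contDiff_const.mul (h j r₁ r₂ n hn)]
  exact Finset.sum_congr rfl fun j _ => momDeriv_const_mul a (h j r₁ r₂ n hn) _ _

variable {K : ℝ → ℝ} {A B Λ_R Λ₀ : ℝ} {L : ℝ → VertexSystem}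

theorem polyOn_treeTerm {d R : ℕ} {Λ : ℝ}
    (hz : ∀ t ∈ Set.Icc (0 : ℝ) 1, ∀ n, 1 ≤ n → ∀ k, L t 0 0 n Λ k = 0)
    (h : ∀ r₁ r₂ n, 1 ≤ n → r₁ + r₂ < R → ∀ k, PolyOn d fun t => L t r₁ r₂ n Λ k) {r₁ r₂ : ℕ}
    (hr : r₁ + r₂ ≤ R) (n : ℕ) (k : Momenta n) :
    PolyOn (d + d) fun t => treeTerm K B (L t) r₁ r₂ n Λ k := by
  unfold treeTerm
  refine PolyOn.sum fun I _ => PolyOn.sum fun s hs => PolyOn.sum fun u hu => PolyOn.const_mul ?_ _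
  have hs' : s.1 + s.2 = r₁ := Finset.HasAntidiagonal.mem_antidiagonal.1 hs
  have hu' : u.1 + u.2 = r₂ := Finset.HasAntidiagonal.mem_antidiagonal.1 hu
  by_cases h1 : s.1 + u.1 < R
  · by_cases h2 : s.2 + u.2 < R
    · exact (h _ _ _ (Nat.le_add_left 1 _) h1 _).mul (h _ _ _ (Nat.le_add_left 1 _) h2 _)
    · have h0 : s.1 = 0 ∧ u.1 = 0 := by omega
      refine (polyOn_const _ 0).congr fun t ht => ?_
      rw [h0.1, h0.2, hz t ht _ (Nat.le_add_left 1 _), zero_mul]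
  · have h0 : s.2 = 0 ∧ u.2 = 0 := by omega
    refine (polyOn_const _ 0).congr fun t ht => ?_
    rw [h0.1, h0.2, hz t ht _ (Nat.le_add_left 1 _), mul_zero]

/-- The interpolation defect `L_t - ∑ l_j(t) L_{τ_j}` is a combination of solutions. Its tree term,
loop term and boundary data vanish by hypothesis, so the general bound with `M = 0` makes it zero.
-/
theorem IsCutoff.polyOn_step (hK : IsCutoff K) (hR : 0 < Λ_R) (hle : Λ_R ≤ Λ₀)
    (hB : |B| ≤ Λ_R ^ 2)
    (hL : ∀ t ∈ Set.Icc (0 : ℝ) 1, IsPerturbativeSolution K A B Λ_R Λ₀ (L t)) {n r₁ r₂ d : ℕ}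
    (hn : 1 ≤ n)
    (htree : ∀ Λ ∈ Set.Icc Λ_R Λ₀, ∀ k,
      PolyOn d fun t => treeTerm K B (L t) r₁ r₂ n Λ k)
    (hloop : ∀ Λ ∈ Set.Icc Λ_R Λ₀, ∀ k, PolyOn d fun t => L t r₁ r₂ (n + 2) Λ k)
    (hbare : ∀ p, 5 ≤ n + p → ∀ (a : Fin p → Fin n × Fin n × Fin 4) (k : Momenta n),
      PolyOn d fun t => momDeriv a (L t r₁ r₂ n Λ₀) k)
    (hren : ∀ p, n + p ≤ 4 → ∀ a : Fin p → Fin n × Fin n × Fin 4,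
      PolyOn d fun t => momDeriv a (L t r₁ r₂ n Λ_R) 0) :
    ∀ Λ ∈ Set.Icc Λ_R Λ₀, ∀ k, PolyOn d fun t => L t r₁ r₂ n Λ k := by
  intro Λ hΛ k
  have hΛ0 : 0 < Λ := hR.trans_le hΛ.1
  obtain ⟨τ, l, hτ, hl, hint⟩ := exists_interpolation d
  refine ⟨∑ j, Polynomial.C (L (τ j) r₁ r₂ n Λ k) * l j, ?_, fun t ht => ?_⟩
  · exact Polynomial.natDegree_sum_le_of_forall_le _ _ fun j _ =>
      (Polynomial.natDegree_C_mul_le _ _).trans (hl j)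
  -- The index `none` stands for the system at `t`, the others for those at the nodes.
  set c : Option (Fin (d + 1)) → ℝ := fun o => o.elim 1 fun j => -(l j).eval t with hc
  set τ' : Option (Fin (d + 1)) → ℝ := fun o => o.elim t τ with hτ'
  have hmem : ∀ o, τ' o ∈ Set.Icc (0 : ℝ) 1 := by
    rintro (_ | j)
    exacts [ht, hτ j]
  have hsum : ∀ f : ℝ → ℝ, ∑ o, c o * f (τ' o) = f t - ∑ j, (l j).eval t * f (τ j) := by
    intro f
    rw [Fintype.sum_option]
    simp [hc, hτ', sub_eq_add_neg]
  have hzero : ∀ f : ℝ → ℝ, PolyOn d f → ∑ o, c o * f (τ' o) = 0 := fun f hf => by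
    rw [hsum, ← hint f hf t ht, sub_self]
  have hsm : ∀ Λ ∈ Set.Icc Λ_R Λ₀, ∀ o, SmoothAt (L (τ' o)) Λ := fun Λ hΛ o =>
    (hL _ (hmem o)).smoothAt hΛ
  -- Polynomiality is needed at every momentum; this radius puts the given `k` into the region, and
  -- the dependence of the constant on `ρ` is harmless since it multiplies zero.
  set ρ := 2 + ‖k‖ / Λ with hρ
  have hρ2 : 2 ≤ ρ := le_add_of_nonneg_right (by positivity)
  have hk : k ∈ region ρ n Λ := fun i => by
    refine (norm_le_pi_norm k.1 i).trans ?_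
    have h1 : ρ * Λ = 2 * Λ + ‖k‖ := by rw [hρ]; field_simp
    have h2 : ‖k.1‖ = ‖k‖ := rfl
    rw [h1, h2]
    linarith
  obtain ⟨C, _, hC⟩ := hK.exists_comb_bound hn (le_refl 5) hρ2
  have hfin := hC hR hB (c := c) (L := fun o => L (τ' o)) (fun o => hL _ (hmem o)) (r₁ := r₁)
    (r₂ := r₂) (σ := 4) le_rfl (by norm_num) (M := 0) le_rfl
    (fun Λ hΛ k _ => scaledLE_of_eventuallyEq_zero
      (Eventually.of_forall fun y => hzero _ (htree Λ hΛ y)) (by rw [zero_mul]))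
    (fun Λ hΛ k _ => scaledLE_of_eventuallyEq_zero
      (Eventually.of_forall fun y => hzero _ (hloop Λ hΛ y)) (by rw [zero_mul]))
    (fun p _ hnp a k _ => by
      rw [momDeriv_comb (hsm _ (Set.right_mem_Icc.2 hle)) r₁ r₂ hn, hzero _ (hbare p hnp a k),
        abs_zero, mul_zero, zero_mul])
    (fun p hnp a => by
      rw [momDeriv_comb (hsm _ (Set.left_mem_Icc.2 hle)) r₁ r₂ hn, hzero _ (hren p hnp a),
        abs_zero, mul_zero, zero_mul]) Λ hΛ k hk 0 (Nat.zero_le _)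
  rw [pow_zero, one_mul, norm_iteratedFDeriv_zero, zero_mul, mul_zero, zero_mul] at hfin
  have h1 : ∑ o, c o * L (τ' o) r₁ r₂ n Λ k = 0 := norm_le_zero_iff.1 hfin
  rw [hsum fun s => L s r₁ r₂ n Λ k] at h1
  beta_reduce
  rw [sub_eq_zero.1 h1, Polynomial.eval_finsetSum]
  refine Finset.sum_congr rfl fun j _ => ?_
  rw [Polynomial.eval_mul, Polynomial.eval_C, mul_comm]

/-- The vertex functions are polynomials in the parameter `t` that scales the irrelevant bare
data. -/
theorem IsCutoff.exists_polyOn (hK : IsCutoff K) (hR : 0 < Λ_R) (hle : Λ_R ≤ Λ₀)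
    (hB : |B| ≤ Λ_R ^ 2)
    (hL : ∀ t ∈ Set.Icc (0 : ℝ) 1, IsPerturbativeSolution K A B Λ_R Λ₀ (L t))
    (hren : ∀ t ∈ Set.Icc (0 : ℝ) 1, RenormalizationConditions Λ_R (L t))
    (hbare : ∀ r₁ r₂ n p, 1 ≤ n → 5 ≤ n + p → ∀ (a : Fin p → Fin n × Fin n × Fin 4)
      (k : Momenta n), ∀ t ∈ Set.Icc (0 : ℝ) 1,
        momDeriv a (L t r₁ r₂ n Λ₀) k = t * momDeriv a (L 1 r₁ r₂ n Λ₀) k) (R : ℕ) :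
    ∃ d, ∀ Λ ∈ Set.Icc Λ_R Λ₀, ∀ r₁ r₂ n, 1 ≤ n → r₁ + r₂ < R → ∀ k,
      PolyOn d fun t => L t r₁ r₂ n Λ k := by
  induction R with
  | zero => exact ⟨0, fun Λ _ r₁ r₂ n _ h => absurd h (Nat.not_lt_zero _)⟩
  | succ R ih =>
    obtain ⟨d₀, hd₀⟩ := ih
    have hlegs : ∀ j : ℕ, ∃ d, ∀ Λ ∈ Set.Icc Λ_R Λ₀, ∀ r₁ r₂ n, 1 ≤ n → r₁ + r₂ ≤ R →
        2 * R + 3 ≤ n + j → ∀ k, PolyOn d fun t => L t r₁ r₂ n Λ k := by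
      intro j
      induction j with
      | zero =>
        exact ⟨0, fun Λ hΛ r₁ r₂ n _ hr hn k => (polyOn_const 0 0).congr fun t ht =>
          (hL t ht).many_legs r₁ r₂ n (by omega) Λ hΛ k⟩
      | succ j ihj =>
        obtain ⟨d₁, hd₁⟩ := ihj
        -- Degrees of the loop term, of the quadratic tree term, and of the bare data, which are
        -- linear in `t`.
        set d := max d₁ (max (d₀ + d₀) 1) with hd
        have h1 : d₁ ≤ d := le_max_left _ _
        have h2 : d₀ + d₀ ≤ d := (le_max_left _ _).trans (le_max_right _ _)
        have h3 : 1 ≤ d := (le_max_right _ _).trans (le_max_right _ _)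
        refine ⟨d, fun Λ hΛ r₁ r₂ n hn hr hnj => hK.polyOn_step hR hle hB hL hn ?_ ?_ ?_ ?_ Λ hΛ⟩
        · exact fun Λ hΛ k => (polyOn_treeTerm (fun t ht n hn =>
            (hL t ht).zeroth_order n hn Λ hΛ) (hd₀ Λ hΛ) hr n k).mono h2
        · exact fun Λ hΛ k => (hd₁ Λ hΛ r₁ r₂ (n + 2) (by omega) hr (by omega) k).mono h1
        · exact fun p hnp a k => (((polyOn_id.mul (polyOn_const 0 _)).congr
            (hbare r₁ r₂ n p hn hnp a k)).mono h3)
        · exact fun p hnp a => (polyOn_const d (renValue r₁ r₂ n p)).congr fun t ht =>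
            (hren t ht).momDeriv_eq (hL t ht) hle r₁ r₂ hn hnp a
    obtain ⟨d, hd⟩ := hlegs (2 * R + 3)
    exact ⟨d, fun Λ hΛ r₁ r₂ n hn hr => hd Λ hΛ r₁ r₂ n hn (by omega) (by omega)⟩

end PolynomialDependence

/-! ### Bound on the derivative in `t`, and the no-cutoff limit -/

section Main

variable {K : ℝ → ℝ}

/-- The difference bound in terms of `A_n`: `Λ^(5-n)` against the weight `ε/Λ₀` leaves `ε Λ/Λ₀`. The
factor `2 ^ p` comes from the norms of the directions. -/
theorem IsCutoff.exists_dimensionless_diff_bound (hK : IsCutoff K) (F : PlnFamily) (p R : ℕ) :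
    ∃ N : ℕ, ∀ {A B Λ_R Λ₀ ε : ℝ} {L L' : VertexSystem}, Admissible K F A B Λ_R Λ₀ L →
      Admissible K F A B Λ_R Λ₀ L' → 0 ≤ ε →
      (∀ r₁ r₂ n p, 1 ≤ n → 5 ≤ n + p → ∀ a : Fin p → Fin n × Fin n × Fin 4,
        ∀ k ∈ region 2 n Λ₀, |momDeriv a (dimensionless L r₁ r₂ n Λ₀) k -
            momDeriv a (dimensionless L' r₁ r₂ n Λ₀) k| ≤
          ε * (Λ₀ ^ (-(p : ℤ)) * (Λ₀ / Λ_R) ^ r₁ * Pln (F.poly n p r₁ r₂) (Λ₀ / Λ_R))) →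
      ∀ Λ ∈ Set.Icc Λ_R Λ₀, ∀ r₁ r₂ n, 1 ≤ n → r₁ + r₂ ≤ R →
        ∀ a : Fin p → Fin n × Fin n × Fin 4, ∀ k ∈ region 2 n Λ,
        |momDeriv a (dimensionless L r₁ r₂ n Λ) k - momDeriv a (dimensionless L' r₁ r₂ n Λ) k| ≤
          Λ ^ (-(p : ℤ)) * (Λ / Λ_R) ^ r₁ *
            (ε * (Λ / Λ₀) * (2 ^ p * (N * logFactor Λ_R Λ₀ ^ N))) := by
  obtain ⟨N, hN⟩ := hK.exists_diff_bound F (le_max_left 5 p) (R + 1)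
  refine ⟨N, fun {A B Λ_R Λ₀ ε L L'} h h' hε hb Λ hΛ r₁ r₂ n hn hr a k hk => ?_⟩
  have hR := h.pos
  have h0 : 0 < Λ₀ := h.pos.trans_le h.le
  have hΛ0 : 0 < Λ := h.pos.trans_le hΛ.1
  have hsub : ∀ Λ ∈ Set.Icc Λ_R Λ₀, ∀ r₁ r₂ n p, 1 ≤ n → ∀ (a : Fin p → Fin n × Fin n × Fin 4) k,
      momDeriv a (dimensionless L r₁ r₂ n Λ) k - momDeriv a (dimensionless L' r₁ r₂ n Λ) k =
        Λ ^ ((n : ℤ) + r₁ - 4) *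
          (momDeriv a (L r₁ r₂ n Λ) k - momDeriv a (L' r₁ r₂ n Λ) k) := by
    intro Λ hΛ r₁ r₂ n p hn a k
    rw [momDeriv_dimensionless a (h.sol.smoothAt hΛ r₁ r₂ n hn),
      momDeriv_dimensionless a (h'.sol.smoothAt hΛ r₁ r₂ n hn), mul_sub]
  have hD := hN h h' hε (fun r₁ r₂ n p hn hnp a k hk => by
    have h1 := hb r₁ r₂ n p hn hnp a k hk
    rw [hsub Λ₀ (Set.right_mem_Icc.2 h.le) r₁ r₂ n p hn, mul_left_comm,
      abs_dimensionless_le_iff h0] at h1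
    refine h1.trans (le_of_eq ?_)
    ring) Λ hΛ r₁ r₂ n hn (by omega) k hk p (le_max_right 5 p)
  rw [hsub Λ hΛ r₁ r₂ n p hn, abs_dimensionless_le_iff hΛ0,
    ← momDeriv_comb_pair a (h.sol.smoothAt hΛ) (h'.sol.smoothAt hΛ) hn]
  refine (mul_le_mul_of_nonneg_left (abs_momDeriv_le a _ k) (by positivity)).trans ?_
  rw [mul_left_comm]
  refine (mul_le_mul_of_nonneg_left hD (by positivity)).trans (le_of_eq ?_)
  rw [show (5 : ℤ) - n = 4 - n + 1 by ring, zpow_add_one₀ hΛ0.ne']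
  ring

theorem abs_derivWithin_le_of_lipschitz {f : ℝ → ℝ} {t C : ℝ} (ht : t ∈ Set.Icc (0 : ℝ) 1)
    (hf : DifferentiableWithinAt ℝ f (Set.Icc 0 1) t)
    (h : ∀ s ∈ Set.Icc (0 : ℝ) 1, |f s - f t| ≤ |s - t| * C) :
    |derivWithin f (Set.Icc 0 1) t| ≤ C := by
  have h1 := hasDerivWithinAt_iff_tendsto_slope.1 hf.hasDerivWithinAt
  have hne : (𝓝[Set.Icc (0 : ℝ) 1 \ {t}] t).NeBot := by
    have := (uniqueDiffOn_Icc (zero_lt_one (α := ℝ)) t ht).accPt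
    exact accPt_principal_iff_nhdsWithin.1 this
  refine le_of_tendsto h1.abs ?_
  filter_upwards [self_mem_nhdsWithin] with s hs
  have h2 : 0 < |s - t| := abs_pos.2 (sub_ne_zero.2 hs.2)
  rw [slope_def_field, abs_div, div_le_iff₀ h2, mul_comm]
  exact h s hs.1

/-- The logarithmic factor equals `ln (e Λ₀ / Λ_R)`, and powers of `ln x` are `o(x)`. -/
theorem tendsto_logFactor_pow_div (N : ℕ) {Λ_R : ℝ} (hR : 0 < Λ_R) :
    Tendsto (fun Λ₀ => logFactor Λ_R Λ₀ ^ N / Λ₀) atTop (𝓝 0) := by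
  have hc : 0 < Real.exp 1 / Λ_R := by positivity
  have h1 := (Real.isLittleO_pow_log_id_atTop (n := N)).tendsto_div_nhds_zero
  have h2 := (h1.comp (tendsto_id.const_mul_atTop hc)).const_mul (Real.exp 1 / Λ_R)
  rw [mul_zero] at h2
  refine h2.congr' ?_
  filter_upwards [eventually_gt_atTop 0] with x hx
  have h3 : Real.log (Real.exp 1 / Λ_R * x) = logFactor Λ_R x := by
    rw [show Real.exp 1 / Λ_R * x = Real.exp 1 * (x / Λ_R) by ring,
      Real.log_mul (Real.exp_pos 1).ne' (by positivity), Real.log_exp, logFactor]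
  simp only [Function.comp_apply, id]
  rw [h3]
  field_simp

theorem TendstoUniformlyOn.of_abs_sub_le {α : Type*} {f g : ℝ → α → ℝ} {F : α → ℝ} {s : Set α}
    {b : ℝ → ℝ} (hb : Tendsto b atTop (𝓝 0)) (h : ∀ᶠ x in atTop, ∀ k ∈ s, |f x k - g x k| ≤ b x)
    (hf : TendstoUniformlyOn f F atTop s) : TendstoUniformlyOn g F atTop s := by
  rw [Metric.tendstoUniformlyOn_iff] at hf ⊢
  intro ε hε
  filter_upwards [hf (ε / 2) (half_pos hε), h, hb.eventually_lt_const (half_pos hε)]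
    with x h1 h2 h3 k hk
  have h4 := h1 k hk
  have h5 := h2 k hk
  rw [Real.dist_eq] at h4 ⊢
  have h6 := abs_add_le (F k - f x k) (f x k - g x k)
  rw [sub_add_sub_cancel] at h6
  linarith

/-- The polynomials `2 ^ p * N * (1 + X) ^ N`. -/
noncomputable def powerFamily (N : ℕ → ℕ → ℕ → ℕ → ℕ) : PlnFamily where
  poly n p r₁ r₂ := Polynomial.C (2 ^ p * (N n p r₁ r₂ : ℝ)) * (1 + Polynomial.X) ^ N n p r₁ r₂
  nonneg n p r₁ r₂ i := by
    rw [Polynomial.coeff_C_mul, Polynomial.coeff_one_add_X_pow]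
    positivity

theorem Pln_powerFamily (N : ℕ → ℕ → ℕ → ℕ → ℕ) (n p r₁ r₂ : ℕ) (Λ_R Λ₀ : ℝ) :
    Pln ((powerFamily N).poly n p r₁ r₂) (Λ₀ / Λ_R) =
      2 ^ p * (N n p r₁ r₂ * logFactor Λ_R Λ₀ ^ N n p r₁ r₂) := by
  simp [Pln, powerFamily, logFactor, mul_assoc]

theorem IsCutoff.exists_bound_derivWithin (hK : IsCutoff K) (P : PlnFamily) :
    ∃ Q : PlnFamily,
      ∀ Λ_R Λ₀ A B : ℝ, 0 < Λ_R → Λ_R ≤ Λ₀ → |B| ≤ Λ_R ^ 2 →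
      ∀ L : ℝ → VertexSystem,
      (∀ t ∈ Set.Icc (0 : ℝ) 1,
        IsPerturbativeSolution K A B Λ_R Λ₀ (L t) ∧
        RenormalizationConditions Λ_R (L t)) →
      (∀ t ∈ Set.Icc (0 : ℝ) 1, ∀ r₁ r₂ n p, 1 ≤ n → 5 ≤ n + p →
        ∀ (a : Fin p → Fin n × Fin n × Fin 4) (k : Momenta n),
        momDeriv a (dimensionless (L t) r₁ r₂ n Λ₀) k =
          t * momDeriv a (dimensionless (L 1) r₁ r₂ n Λ₀) k) →
      (∀ t ∈ Set.Icc (0 : ℝ) 1, ∀ r₁ r₂ n p, 1 ≤ n → 5 ≤ n + p →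
        ∀ a : Fin p → Fin n × Fin n × Fin 4,
        NormLE Λ₀
          (fun k => derivWithin (fun τ => momDeriv a
            (dimensionless (L τ) r₁ r₂ n Λ₀) k) (Set.Icc 0 1) t)
          (Λ₀ ^ (-(p : ℤ)) * (Λ₀ / Λ_R) ^ r₁ *
            Pln (P.poly n p r₁ r₂) (Λ₀ / Λ_R))) →
      ∀ t ∈ Set.Icc (0 : ℝ) 1, ∀ Λ ∈ Set.Icc Λ_R Λ₀, ∀ r₁ r₂ n p, 1 ≤ n →
        ∀ a : Fin p → Fin n × Fin n × Fin 4,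
        (∀ k : Momenta n, DifferentiableWithinAt ℝ
          (fun τ => momDeriv a (dimensionless (L τ) r₁ r₂ n Λ) k)
          (Set.Icc 0 1) t) ∧
        NormLE Λ
          (fun k => derivWithin (fun τ => momDeriv a
            (dimensionless (L τ) r₁ r₂ n Λ) k) (Set.Icc 0 1) t)
          (Λ ^ (-(p : ℤ)) * (Λ / Λ_R) ^ r₁ * (Λ / Λ₀) *
            Pln (Q.poly n p r₁ r₂) (Λ₀ / Λ_R)) := by
  choose N hN using fun p R => hK.exists_dimensionless_diff_bound P p R
  refine ⟨powerFamily fun n p r₁ r₂ => N p (r₁ + r₂), ?_⟩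
  intro Λ_R Λ₀ A B hR hle hB L hL hscale hderiv
  have h0 : 0 < Λ₀ := hR.trans_le hle
  have hone : (1 : ℝ) ∈ Set.Icc (0 : ℝ) 1 := Set.right_mem_Icc.2 zero_le_one
  have hmem : Λ₀ ∈ Set.Icc Λ_R Λ₀ := Set.right_mem_Icc.2 hle
  have hdata : ∀ r₁ r₂ n p, 1 ≤ n → 5 ≤ n + p → ∀ a : Fin p → Fin n × Fin n × Fin 4,
      ∀ k ∈ region 2 n Λ₀, |momDeriv a (dimensionless (L 1) r₁ r₂ n Λ₀) k| ≤
        Λ₀ ^ (-(p : ℤ)) * (Λ₀ / Λ_R) ^ r₁ * Pln (P.poly n p r₁ r₂) (Λ₀ / Λ_R) := by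
    intro r₁ r₂ n p hn hnp a k hk
    -- The bare data are `t` times those at `1`, so their derivative is the data at `1` themselves:
    -- the hypothesis on the derivative makes the bare data small for every `t`.
    have h1 := hderiv 1 hone r₁ r₂ n p hn hnp a k hk
    have h2 : HasDerivWithinAt (fun τ => momDeriv a (dimensionless (L τ) r₁ r₂ n Λ₀) k)
        (momDeriv a (dimensionless (L 1) r₁ r₂ n Λ₀) k) (Set.Icc 0 1) 1 := by
      have h3 := ((hasDerivAt_id (1 : ℝ)).mul_const
        (momDeriv a (dimensionless (L 1) r₁ r₂ n Λ₀) k)).hasDerivWithinAt (s := Set.Icc 0 1)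
      rw [one_mul] at h3
      exact h3.congr (fun t ht => hscale t ht r₁ r₂ n p hn hnp a k)
        (hscale 1 hone r₁ r₂ n p hn hnp a k)
    beta_reduce at h1
    rwa [h2.derivWithin (uniqueDiffOn_Icc zero_lt_one 1 hone)] at h1
  have hadm : ∀ t ∈ Set.Icc (0 : ℝ) 1, Admissible K P A B Λ_R Λ₀ (L t) := by
    refine fun t ht => ⟨hR, hle, hB, (hL t ht).1, (hL t ht).2, fun r₁ r₂ n p hn hnp a k hk => ?_⟩
    rw [hscale t ht r₁ r₂ n p hn hnp a k, abs_mul, abs_of_nonneg ht.1]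
    exact (mul_le_of_le_one_left (abs_nonneg _) ht.2).trans (hdata r₁ r₂ n p hn hnp a k hk)
  have hscale' : ∀ r₁ r₂ n p, 1 ≤ n → 5 ≤ n + p → ∀ (a : Fin p → Fin n × Fin n × Fin 4)
      (k : Momenta n), ∀ t ∈ Set.Icc (0 : ℝ) 1,
        momDeriv a (L t r₁ r₂ n Λ₀) k = t * momDeriv a (L 1 r₁ r₂ n Λ₀) k := by
    intro r₁ r₂ n p hn hnp a k t ht
    have h1 := hscale t ht r₁ r₂ n p hn hnp a k
    rw [momDeriv_dimensionless a ((hL t ht).1.smoothAt hmem r₁ r₂ n hn),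
      momDeriv_dimensionless a ((hL 1 hone).1.smoothAt hmem r₁ r₂ n hn), mul_left_comm] at h1
    exact mul_left_cancel₀ (zpow_ne_zero _ h0.ne') h1
  intro t ht Λ hΛ r₁ r₂ n p hn a
  have hdiff : ∀ k : Momenta n, DifferentiableWithinAt ℝ
      (fun τ => momDeriv a (dimensionless (L τ) r₁ r₂ n Λ) k) (Set.Icc 0 1) t := by
    intro k
    obtain ⟨d, hd⟩ := hK.exists_polyOn hR hle hB (fun t ht => (hL t ht).1)
      (fun t ht => (hL t ht).2) hscale' (r₁ + r₂ + 1)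
    have h1 := PolyOn.momDeriv (hd Λ hΛ r₁ r₂ n hn (Nat.lt_succ_self _))
      (fun t ht => (hL t ht).1.smoothAt hΛ r₁ r₂ n hn) a k
    refine PolyOn.differentiableWithinAt
      ((h1.const_mul (Λ ^ ((n : ℤ) + r₁ - 4))).congr fun s hs => ?_) ht
    exact momDeriv_dimensionless a ((hL s hs).1.smoothAt hΛ r₁ r₂ n hn) k
  refine ⟨hdiff, fun k hk => abs_derivWithin_le_of_lipschitz ht (hdiff k) fun s hs => ?_⟩
  -- The difference bound with `ε = |s - t|`, since the bare data at `s` and `t` differ by `s - t`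
  -- times those at `1`.
  have h1 := hN p (r₁ + r₂) (hadm s hs) (hadm t ht) (abs_nonneg (s - t))
    (fun r₁ r₂ n p hn hnp a k hk => by
      rw [hscale s hs r₁ r₂ n p hn hnp a k, hscale t ht r₁ r₂ n p hn hnp a k, ← sub_mul, abs_mul]
      exact mul_le_mul_of_nonneg_left (hdata r₁ r₂ n p hn hnp a k hk) (abs_nonneg _))
    Λ hΛ r₁ r₂ n hn le_rfl a k hk
  refine h1.trans (le_of_eq ?_)
  rw [Pln_powerFamily]
  ring

theorem IsCutoff.tendstoUniformlyOn_of_smallBareData (hK : IsCutoff K) (P : PlnFamily) {Λ_R : ℝ}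
    {A B : ℝ → ℝ} {L L' : ℝ → VertexSystem}
    (hL : ∀ Λ₀, Λ_R ≤ Λ₀ → Admissible K P (A Λ₀) (B Λ₀) Λ_R Λ₀ (L Λ₀))
    (hL' : ∀ Λ₀, Λ_R ≤ Λ₀ → Admissible K P (A Λ₀) (B Λ₀) Λ_R Λ₀ (L' Λ₀)) {Λ : ℝ} (hΛ : Λ_R ≤ Λ)
    (r₁ r₂ : ℕ) {n p : ℕ} (hn : 1 ≤ n) (a : Fin p → Fin n × Fin n × Fin 4) {F : Momenta n → ℝ}
    (h : TendstoUniformlyOn (fun Λ₀ => momDeriv a (dimensionless (L Λ₀) r₁ r₂ n Λ)) F atTop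
      (momentumRegion n Λ)) :
    TendstoUniformlyOn (fun Λ₀ => momDeriv a (dimensionless (L' Λ₀) r₁ r₂ n Λ)) F atTop
      (momentumRegion n Λ) := by
  obtain ⟨N, hN⟩ := hK.exists_dimensionless_diff_bound P p (r₁ + r₂)
  have hR := (hL Λ hΛ).pos
  have hlim := (tendsto_logFactor_pow_div N hR).const_mul
    (Λ ^ (-(p : ℤ)) * (Λ / Λ_R) ^ r₁ * (2 * Λ * (2 ^ p * N)))
  rw [mul_zero] at hlim
  refine TendstoUniformlyOn.of_abs_sub_le hlim ?_ h
  filter_upwards [eventually_ge_atTop Λ] with Λ₀ hΛ₀ k hk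
  have h1 := hL Λ₀ (hΛ.trans hΛ₀)
  have h2 := hL' Λ₀ (hΛ.trans hΛ₀)
  -- Here `ε = 2`: the two sets of bare data are unrelated, and the triangle inequality suffices
  -- because the decay comes from `Λ / Λ₀`.
  have h3 := hN h1 h2 zero_le_two (fun r₁ r₂ n p hn hnp a k hk => by
    refine (abs_sub _ _).trans ?_
    rw [two_mul]
    exact add_le_add (h1.bare r₁ r₂ n p hn hnp a k hk) (h2.bare r₁ r₂ n p hn hnp a k hk))
    Λ ⟨hΛ, hΛ₀⟩ r₁ r₂ n hn le_rfl a k hk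
  refine h3.trans (le_of_eq ?_)
  ring

end Main

end PolchinskiFlow

open PolchinskiFlow
theorem mainTheorem6 (K : ℝ → ℝ) (hK : IsCutoff K)
    (P : PlnFamily) :
    -- the bound on the `t`-derivative
    (∃ Q : PlnFamily,
      ∀ Λ_R Λ₀ A B : ℝ, 0 < Λ_R → Λ_R ≤ Λ₀ → |A| ≤ Λ_R ^ 3 → |B| ≤ Λ_R ^ 2 →
      ∀ L : ℝ → VertexSystem,
      (∀ t ∈ Set.Icc (0 : ℝ) 1,
        IsPerturbativeSolution K A B Λ_R Λ₀ (L t) ∧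
        RenormalizationConditions Λ_R (L t)) →
      -- the bare data with `n + p ≥ 5` are scaled by `t`
      (∀ t ∈ Set.Icc (0 : ℝ) 1, ∀ r₁ r₂ n p, 1 ≤ n → 5 ≤ n + p →
        ∀ (a : Fin p → Fin n × Fin n × Fin 4) (k : Momenta n),
        momDeriv a (dimensionless (L t) r₁ r₂ n Λ₀) k =
          t * momDeriv a (dimensionless (L 1) r₁ r₂ n Λ₀) k) →
      -- and their `t`-derivative is small
      (∀ t ∈ Set.Icc (0 : ℝ) 1, ∀ r₁ r₂ n p, 1 ≤ n → 5 ≤ n + p →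
        ∀ a : Fin p → Fin n × Fin n × Fin 4,
        NormLE Λ₀
          (fun k => derivWithin (fun τ => momDeriv a
            (dimensionless (L τ) r₁ r₂ n Λ₀) k) (Set.Icc 0 1) t)
          (Λ₀ ^ (-(p : ℤ)) * (Λ₀ / Λ_R) ^ r₁ *
            Pln (P.poly n p r₁ r₂) (Λ₀ / Λ_R))) →
      ∀ t ∈ Set.Icc (0 : ℝ) 1, ∀ Λ ∈ Set.Icc Λ_R Λ₀, ∀ r₁ r₂ n p, 1 ≤ n →
        ∀ a : Fin p → Fin n × Fin n × Fin 4,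
        (∀ k : Momenta n, DifferentiableWithinAt ℝ
          (fun τ => momDeriv a (dimensionless (L τ) r₁ r₂ n Λ) k)
          (Set.Icc 0 1) t) ∧
        NormLE Λ
          (fun k => derivWithin (fun τ => momDeriv a
            (dimensionless (L τ) r₁ r₂ n Λ) k) (Set.Icc 0 1) t)
          (Λ ^ (-(p : ℤ)) * (Λ / Λ_R) ^ r₁ * (Λ / Λ₀) *
            Pln (Q.poly n p r₁ r₂) (Λ₀ / Λ_R))) ∧
    -- independence of the no-cutoff limit of the small bare irrelevant data
    (∀ Λ_R : ℝ, 0 < Λ_R → ∀ A B : ℝ → ℝ,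
      (∀ Λ₀, Λ_R ≤ Λ₀ → |A Λ₀| ≤ Λ_R ^ 3 ∧ |B Λ₀| ≤ Λ_R ^ 2) →
      ∀ L L' : ℝ → VertexSystem,
      (∀ Λ₀, Λ_R ≤ Λ₀ →
        (IsPerturbativeSolution K (A Λ₀) (B Λ₀) Λ_R Λ₀ (L Λ₀) ∧
          RenormalizationConditions Λ_R (L Λ₀) ∧
          SmallBareData P Λ_R Λ₀ (L Λ₀)) ∧
        (IsPerturbativeSolution K (A Λ₀) (B Λ₀) Λ_R Λ₀ (L' Λ₀) ∧
          RenormalizationConditions Λ_R (L' Λ₀) ∧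
          SmallBareData P Λ_R Λ₀ (L' Λ₀))) →
      ∀ Λ, Λ_R ≤ Λ → ∀ r₁ r₂ n p, 1 ≤ n → ∀ (a : Fin p → Fin n × Fin n × Fin 4)
        (F : Momenta n → ℝ),
        TendstoUniformlyOn (fun Λ₀ => momDeriv a
            (dimensionless (L Λ₀) r₁ r₂ n Λ)) F Filter.atTop
            (momentumRegion n Λ) ↔
          TendstoUniformlyOn (fun Λ₀ => momDeriv a
            (dimensionless (L' Λ₀) r₁ r₂ n Λ)) F Filter.atTop
            (momentumRegion n Λ)) := by
  refine ⟨?_, ?_⟩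
  · obtain ⟨Q, hQ⟩ := hK.exists_bound_derivWithin P
    exact ⟨Q, fun Λ_R Λ₀ A B hR hle _ hB => hQ Λ_R Λ₀ A B hR hle hB⟩
  · intro Λ_R hR A B hAB L L' h Λ hΛ r₁ r₂ n p hn a F
    have h1 : ∀ Λ₀, Λ_R ≤ Λ₀ → Admissible K P (A Λ₀) (B Λ₀) Λ_R Λ₀ (L Λ₀) := fun Λ₀ hle =>
      ⟨hR, hle, (hAB Λ₀ hle).2, (h Λ₀ hle).1.1, (h Λ₀ hle).1.2.1, (h Λ₀ hle).1.2.2⟩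
    have h2 : ∀ Λ₀, Λ_R ≤ Λ₀ → Admissible K P (A Λ₀) (B Λ₀) Λ_R Λ₀ (L' Λ₀) := fun Λ₀ hle =>
      ⟨hR, hle, (hAB Λ₀ hle).2, (h Λ₀ hle).2.1, (h Λ₀ hle).2.2.1, (h Λ₀ hle).2.2.2⟩
    exact ⟨hK.tendstoUniformlyOn_of_smallBareData P h1 h2 hΛ r₁ r₂ hn a,
      hK.tendstoUniformlyOn_of_smallBareData P h2 h1 hΛ r₁ r₂ hn a⟩
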